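/- Let $k$ be a field with a valuation $|\cdot|\colon k\to\Gamma\cup\{0\}$ ($\Gamma$ a totally ordered abelian group, of arbitrary height; the trivial valuation is allowed), with valuation ring $k^\circ$ and residue field $\tilde k$, and let $p\ge 1$ be the characteristic exponent of $\tilde k$. Suppose that $k$ is $p$-closed: every algebraic extension $l/k$ such that all finite subextensions have degree a power of $p$ (a $p$-extension; it is not assumed to be Galois) is trivial. Then the valued field $k$ is tame: $k^a=k^t$, and every algebraic extension of valued fields $l/k$ is tame. Here the notions are as follows. For a valued field $k$, fix an extension of the valuation to an algebraic closure $k^a$. The henselization $k^h\subseteq k^a$ is the smallest henselian valued subfield containing $k$, and $k^u\subseteq k^a$ is the smallest henselian valued subfield containing $k$ with separably closed residue field (its valuation ring is the strict henselization of $k^\circ$). If $k$ is henselian, an algebraic extension of $k$ is unramified if it lies in $k^u$, and totally ramified if it is linearly disjoint from $k^u$ over $k$; an algebraic extension $l/k$ is tame if it decomposes as $l/m/k$ with $m/k$ unramified, $l/m$ totally ramified, and all finite subextensions of $l/m$ of degree prime to $p$. For arbitrary $k$, an algebraic extension of valued fields $l/k$ is tame if $l^h/k^h$ is tame. Finally,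 $k^t$ is the compositum in $k^a$ of all tame extensions of $k^h$. -/

import Mathlib

open IsLocalRing

universe u v w x

noncomputable section

namespace ValuedTame

/-! ### Extensions with prescribed primes in the degree -/

/-- The set of prime divisors of `n`. -/
def primesOf (n : ℕ) : Set ℕ := {q | q.Prime ∧ q ∣ n}

/-- The set of primes outside `P`. -/
def primeCompl (P : Set ℕ) : Set ℕ := {q | q.Prime ∧ q ∉ P}

/-- All prime divisors of `n` lie in `P`. -/
def IsPNumber (P : Set ℕ) (n : ℕ) : Prop := ∀ q : ℕ, q.Prime → q ∣ n → q ∈ P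

/-- `L / K` is a `P`-extension: it is algebraic and every finite subextension has as its degree
a `P`-number. -/
def IsPExtension (P : Set ℕ) (K : Type u) (L : Type v) [Field K] [Field L] [Algebra K L] : Prop :=
  Algebra.IsAlgebraic K L ∧
    ∀ F : IntermediateField K L, FiniteDimensional K F → IsPNumber P (Module.finrank K F)

/-- `K` has no non-trivial `P`-extension. (An algebraic extension of `K` is isomorphic to one
in the universe of `K`.) -/
def IsPClosed (P : Set ℕ) (K : Type u) [Field K] : Prop :=
  ∀ (L : Type u) [Field L] [Algebra K L],
    IsPExtension P K L → Function.Surjective (algebraMap K L)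

/-! ### The ramification tower inside a valued field `(Ω, O)`

In the applications `Ω` is an algebraic closure of `K`. Every field `E` with a map to `Ω` carries
the valuation ring `O.comap (algebraMap E Ω)`, written `O ∩ E` in the comments. -/

section Tower

variable (K : Type u) {Ω : Type v} [Field K] [Field Ω] [Algebra K Ω] (O : ValuationSubring Ω)

/-- The henselization `K^h` in `Ω`: the smallest henselian valued subfield of `Ω` over `K`. -/
def henselization : IntermediateField K Ω :=
  sInf {E | HenselianLocalRing (O.comap (algebraMap E Ω))}

/-- The field `K^u` whose valuation ring is the strict henselization in `Ω` of the valuation ring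
of `K`: the smallest henselian valued subfield of `Ω` over `K` whose residue field is separably
closed. -/
def strictHenselization : IntermediateField K Ω :=
  sInf {E | HenselianLocalRing (O.comap (algebraMap E Ω)) ∧
    IsSepClosed (ResidueField (O.comap (algebraMap E Ω)))}

/-- For `K` henselian: `L / K` is unramified, that is, contained in `K^u`. -/
def IsUnramifiedHenselian (L : IntermediateField K Ω) : Prop :=
  L ≤ strictHenselization K O

/-- For `K` henselian: `L / K` is totally ramified, that is, linearly disjoint from `K^u`. -/
def IsTotallyRamifiedHenselian (L : IntermediateField K Ω) : Prop :=
  L.LinearDisjoint (strictHenselization K O)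

/-- For `K` henselian with residual characteristic exponent `p`: the extension `L / K` is tame,
that is, in the decomposition `L / M / K` with `M / K` unramified and `L / M` totally ramified,
`L / M` is a `p'`-extension. -/
def IsTameHenselian (L : IntermediateField K Ω) : Prop :=
  ∃ (M : IntermediateField K Ω) (hM : M ≤ L),
    IsUnramifiedHenselian K O M ∧
    IsTotallyRamifiedHenselian M O (IntermediateField.extendScalars hM) ∧
    IsPExtension
      (primeCompl (primesOf (ringExpChar (ResidueField (O.comap (algebraMap K Ω))))))
      M (IntermediateField.extendScalars hM)

/-- The maximal tame extension `K^t = (K^h)^t` of `K` in `Ω`: the compositum of all tame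
extensions of `K^h` in `Ω`. -/
def tameClosure : IntermediateField K Ω :=
  (sSup {E : IntermediateField (henselization K O) Ω |
    IsTameHenselian (henselization K O) O E}).restrictScalars K

variable (L : Type w) [Field L] [Algebra K L] [Algebra L Ω] [IsScalarTower K L Ω]

/-- `K^h ⊆ L^h`. -/
theorem henselization_le :
    henselization K O ≤ (henselization L O).restrictScalars K := by
  intro x hx
  rw [IntermediateField.mem_restrictScalars]
  simp only [henselization, IntermediateField.mem_sInf] at hx ⊢
  intro E hE
  exact hx (E.restrictScalars K) hE

/-- For `K ⊆ L ⊆ Ω`: the extension `L / K` is tame for the valuations induced from `O`, that is,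
`L^h / K^h` is tame. -/
def IsTameIn : Prop :=
  IsTameHenselian (henselization K O) O
    (IntermediateField.extendScalars (henselization_le K O L))

end Tower

/-- Let `L / K` be an algebraic extension, `B` a valuation ring of `L`, and give `K` the induced
valuation. The extension `L / K` is tame. (Extensions `O` of `B` to the algebraic closure exist
and are conjugate over `L`, so the choice of `O` is irrelevant.) -/
def IsTameExtension (K : Type u) {L : Type v} [Field K] [Field L] [Algebra K L]
    (B : ValuationSubring L) : Prop :=
  ∀ O : ValuationSubring (AlgebraicClosure L),
    O.comap (algebraMap L (AlgebraicClosure L)) = B → IsTameIn K O L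

/-- The field `K` with the valuation ring `A` is tame: `K^a = K^t`. -/
def IsTameField {K : Type u} [Field K] (A : ValuationSubring K) : Prop :=
  ∀ O : ValuationSubring (AlgebraicClosure K),
    O.comap (algebraMap K (AlgebraicClosure K)) = A → tameClosure K O = ⊤

end ValuedTame

end

/-!
Extend the valuation to `Ω = kᵃ`, with decomposition group `D` and inertia group `I` over `k`. Then
`kʰ` and `kᵘ` are the fixed fields of `D` and `I`, and every algebraic extension `l` of `kʰ` is
tame, through `l ∩ kᵘ`, as soon as the pro-order of `I` is prime to `p`. Since `k` is `p`-closed, no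
element of `Ω` has degree `p ^ n` over `k` with `0 < n`, and a nontrivial element of order a power
of `p` in the image of `I` in a finite quotient has to contradict this.

In rank one, `k` is dense in the fixed field of `D`. By Krasner's lemma, an open subgroup of `D` of
index `p ^ n` then yields an element of degree `p ^ n` over `k` itself, and not only over `kʰ`. Such
a subgroup is the zero set of a crossed homomorphism `c : D → Q`, where `Q` is an elementary abelian
quotient of the wild inertia group `W` at a finite level, and `c` agrees with `W → Q` on `I ∩ W`.
To construct `c`, first extend `W → Q` to a crossed homomorphism with values in `Λ ⊗ Q`, where `Λ`
is the residue field of `Ω`. The map `x ↦ x ^ p - x` makes it trivial on `W`, hence a coboundary by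
Hilbert 90, and the surjectivity of this map on `Λ` allows one to correct the values into `Q`.

In general, passage to the algebraic closure in `Ω` of a finitely generated subfield leaves only
finitely many overrings of residue characteristic `p`. If `T` is the least overring of `S`, then `S`
is the composite of `T` with a rank one valuation of the residue field of `T`, and the rank one case
moves a bad element of the inertia group of `S` to that of `T`. Eventually `T` is trivial, and so is
its inertia group, or the residue characteristic is not `p`. In the latter case an inertia element
acts on leading terms through a character of the value group of `Ω` modulo that of `k`; this
quotient has no `p`-torsion because `k` is closed under `p`-th roots.
-/

noncomputable section

namespace ValuedTame

open scoped Pointwise Polynomial TensorProduct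

section IntegralClosure

theorem isIntegral_of_forall_mem_valuationSubring {R Ω : Type*} [CommRing R] [Field Ω]
    [Algebra R Ω] {x : Ω}
    (hx : ∀ V : ValuationSubring Ω, (∀ r : R, algebraMap R Ω r ∈ V) → x ∈ V) :
    IsIntegral R x := by
  by_contra hxR
  have : IsIntegrallyClosedIn (integralClosure R Ω).toSubring Ω :=
    inferInstanceAs (IsIntegrallyClosedIn (integralClosure R Ω) Ω)
  obtain ⟨V, hV, hxV⟩ := Subring.exists_le_valuationSubring_of_isIntegrallyClosedIn
    (R := (integralClosure R Ω).toSubring) (x := x) hxR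
  exact hxV (hx V fun r => hV isIntegral_algebraMap)

variable {R K Ω : Type*} [CommRing R] [Field K] [Field Ω] [Algebra R K] [Algebra K Ω]
  [Algebra R Ω] [IsScalarTower R K Ω]

instance : Algebra (integralClosure R K) (integralClosure R Ω) :=
  (IsScalarTower.toAlgHom R K Ω).mapIntegralClosure.toAlgebra

instance : SMulCommClass Gal(Ω/K) (integralClosure R K) (integralClosure R Ω) where
  smul_comm σ a b := Subtype.ext <| (map_mul σ _ _).trans
    (congrArg (· * σ (b : Ω)) (σ.commutes (a : K)))

instance [IsGalois K Ω] :
    Algebra.IsInvariant (integralClosure R K) (integralClosure R Ω) Gal(Ω/K) where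
  isInvariant b hb := by
    obtain ⟨a, ha⟩ := IntermediateField.mem_bot.mp
      ((InfiniteGalois.mem_bot_iff_fixed (k := K) (b : Ω)).mpr fun σ => congrArg Subtype.val (hb σ))
    have ha_int : IsIntegral R a :=
      (isIntegral_algebraMap_iff (algebraMap K Ω).injective).mp (ha ▸ b.2)
    exact ⟨⟨a, ha_int⟩, Subtype.ext ha⟩

instance [Algebra.IsAlgebraic K Ω] [TopologicalSpace (integralClosure R Ω)]
    [DiscreteTopology (integralClosure R Ω)] : ContinuousSMul Gal(Ω/K) (integralClosure R Ω) := by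
  rw [continuousSMul_iff_stabilizer_isOpen]
  intro b
  convert! stabilizer_isOpen_of_isIntegral (K := K) (b : Ω) using 1
  ext σ
  exact Subtype.ext_iff

theorem exists_smul_eq_of_under_eq [IsGalois K Ω] (P Q : Ideal (integralClosure R Ω)) [P.IsPrime]
    [Q.IsPrime] (h : P.under (integralClosure R K) = Q.under (integralClosure R K)) :
    ∃ σ : Gal(Ω/K), Q = σ • P := by
  let : TopologicalSpace (integralClosure R Ω) := ⊥
  have : DiscreteTopology (integralClosure R Ω) := ⟨rfl⟩
  exact Algebra.IsInvariant.exists_smul_of_under_eq_of_profinite P Q h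

theorem exists_apply_smul_eq [IsGalois K Ω] {Λ : Type*} [CommRing Λ] [IsDomain Λ]
    {φ : integralClosure R Ω →+* Λ} (hφ : Function.Surjective φ) (g : Λ ≃+* Λ)
    (hg : ∀ a, g (φ (algebraMap (integralClosure R K) _ a)) = φ (algebraMap _ _ a)) :
    ∃ σ : Gal(Ω/K), ∀ b, φ (σ • b) = g (φ b) := by
  let : TopologicalSpace (integralClosure R Ω) := ⊥
  have : DiscreteTopology (integralClosure R Ω) := ⟨rfl⟩
  let Q : Ideal (integralClosure R Ω) := RingHom.ker φ
  have : Q.IsPrime := RingHom.ker_isPrime φ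
  let e : integralClosure R Ω ⧸ Q ≃+* Λ := RingHom.quotientKerEquivOfSurjective hφ
  let s := (e.trans g).trans e.symm
  have hs (r : integralClosure R K ⧸ Q.under (integralClosure R K)) :
      s (algebraMap _ _ r) = algebraMap _ _ r := by
    obtain ⟨a, rfl⟩ := Ideal.Quotient.mk_surjective r
    exact (RingEquiv.symm_apply_eq e).mpr (hg a)
  obtain ⟨σ, hσ⟩ := Ideal.Quotient.stabilizerHom_surjective_of_profinite
    (G := Gal(Ω/K)) (Q.under (integralClosure R K)) Q (AlgEquiv.ofRingEquiv (f := s) hs)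
  refine ⟨σ, fun b => ?_⟩
  have hσb : Ideal.Quotient.mk Q (σ.1 • b) = e.symm (g (φ b)) :=
    DFunLike.congr_fun hσ (Ideal.Quotient.mk Q b)
  exact (RingEquiv.eq_symm_apply e).mp hσb

end IntegralClosure

/-! ### Decomposition and inertia -/

section Inertia

variable {K Ω : Type*} [Field K] [Field Ω] [Algebra K Ω] {O : ValuationSubring Ω} {σ τ : Gal(Ω/K)}

theorem mem_decomposition_iff : σ ∈ O.decompositionSubgroup K ↔ ∀ x, σ x ∈ O ↔ x ∈ O := by
  rw [← inv_mem_iff, MulAction.mem_stabilizer_iff, SetLike.ext_iff]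
  exact forall_congr' fun x => by rw [ValuationSubring.mem_inv_pointwise_smul_iff]; rfl

theorem isEquiv_comap_of_forall_mem_iff {g : Ω ≃+* Ω} (hg : ∀ x, g x ∈ O ↔ x ∈ O) :
    (O.valuation.comap (g : Ω →+* Ω)).IsEquiv O.valuation :=
  (Valuation.isEquiv_iff_val_le_one).mpr fun {x} => by
    rw [Valuation.comap_apply, O.valuation_le_one_iff, O.valuation_le_one_iff]
    exact hg x

theorem valuation_lt_one_of_forall_mem_iff {g : Ω ≃+* Ω} (hg : ∀ x, g x ∈ O ↔ x ∈ O) (x : Ω) :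
    O.valuation (g x) < 1 ↔ O.valuation x < 1 :=
  (isEquiv_comap_of_forall_mem_iff hg).lt_one_iff_lt_one

theorem valuation_lt_one_of_mem_decomposition (hσ : σ ∈ O.decompositionSubgroup K) (x : Ω) :
    O.valuation (σ x) < 1 ↔ O.valuation x < 1 :=
  valuation_lt_one_of_forall_mem_iff (g := (σ : Ω ≃+* Ω)) (mem_decomposition_iff.mp hσ) x

theorem exists_pow_apply_eq [Algebra.IsAlgebraic K Ω] (σ : Gal(Ω/K)) (x : Ω) :
    ∃ n : ℕ, 0 < n ∧ (σ ^ n) x = x := by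
  have : Finite ((minpoly K x).rootSet Ω) := (minpoly K x).rootSet_finite Ω
  have hx : x ∈ (minpoly K x).rootSet Ω :=
    (minpoly K x).mem_rootSet.mpr
      ⟨minpoly.ne_zero (Algebra.IsIntegral.isIntegral x), minpoly.aeval K x⟩
  obtain ⟨n, hn, hσ⟩ := (isOfFinOrder_of_finite
    (MulAction.toPermHom Gal(Ω/K) ((minpoly K x).rootSet Ω) σ)).exists_pow_eq_one
  rw [← map_pow] at hσ
  exact ⟨n, hn, congrArg Subtype.val (Equiv.congr_fun hσ ⟨x, hx⟩)⟩

theorem valuation_apply_of_mem_decomposition [Algebra.IsAlgebraic K Ω]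
    (hσ : σ ∈ O.decompositionSubgroup K) (x : Ω) : O.valuation (σ x) = O.valuation x := by
  have hlt {y z : Ω} (h : O.valuation y < O.valuation z) :
      O.valuation (σ y) < O.valuation (σ z) :=
    (isEquiv_comap_of_forall_mem_iff (g := (σ : Ω ≃+* Ω))
      (mem_decomposition_iff.mp hσ)).lt_iff_lt.mpr h
  obtain ⟨n, hn, hx⟩ := exists_pow_apply_eq σ x
  let orbitValuation (k : ℕ) := O.valuation ((σ ^ k) x)
  have h0 : orbitValuation n = orbitValuation 0 := congrArg O.valuation hx
  have hsucc (k : ℕ) : (σ ^ (k + 1)) x = σ ((σ ^ k) x) := by rw [pow_succ', AlgEquiv.mul_apply]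
  rcases lt_trichotomy (O.valuation (σ x)) (O.valuation x) with h | h | h
  · have hanti : StrictAnti orbitValuation := strictAnti_nat_of_succ_lt fun k => by
      induction k with
      | zero => exact h
      | succ k ih => simpa only [orbitValuation, hsucc] using hlt ih
    exact absurd (hanti.injective h0) hn.ne'
  · exact h
  · have hmono : StrictMono orbitValuation := strictMono_nat_of_lt_succ fun k => by
      induction k with
      | zero => exact h
      | succ k ih => simpa only [orbitValuation, hsucc] using hlt ih
    exact absurd (hmono.injective h0) hn.ne'

variable (K O) in
/-- The inertia group of `O` over `K`: the automorphisms in the decomposition group that act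
trivially on the residue field. Unlike `ValuationSubring.inertiaSubgroup` it is a subgroup of the
whole Galois group, so that it has a fixed field. -/
def inertia : Subgroup Gal(Ω/K) where
  carrier := {σ | σ ∈ O.decompositionSubgroup K ∧ ∀ x ∈ O, O.valuation (σ x - x) < 1}
  one_mem' := ⟨one_mem _, fun x _ => by simp⟩
  mul_mem' := by
    rintro σ τ ⟨hσ, hσ'⟩ ⟨hτ, hτ'⟩
    refine ⟨mul_mem hσ hτ, fun x hx => ?_⟩
    simpa using O.valuation.map_add_lt (hσ' (τ x) ((mem_decomposition_iff.mp hτ x).mpr hx))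
      (hτ' x hx)
  inv_mem' := by
    rintro σ ⟨hσ, hσ'⟩
    refine ⟨inv_mem hσ, fun x hx => ?_⟩
    rw [← valuation_lt_one_of_mem_decomposition hσ, map_sub, O.valuation.map_sub_swap,
      ← AlgEquiv.mul_apply, mul_inv_cancel, AlgEquiv.one_apply]
    exact hσ' x hx

theorem conj_mem_inertia (hσ : σ ∈ inertia K O) (hτ : τ ∈ O.decompositionSubgroup K) :
    τ * σ * τ⁻¹ ∈ inertia K O := by
  refine ⟨mul_mem (mul_mem hτ hσ.1) (inv_mem hτ), fun x hx => ?_⟩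
  have hconj : (τ * σ * τ⁻¹) x - x = τ (σ (τ⁻¹ x) - τ⁻¹ x) := by
    rw [map_sub, ← AlgEquiv.mul_apply τ τ⁻¹, mul_inv_cancel]
    rfl
  rw [hconj, valuation_lt_one_of_mem_decomposition hτ]
  exact hσ.2 _ ((mem_decomposition_iff.mp (inv_mem hτ) x).mpr hx)

end Inertia

section Comap

variable {K Ω : Type*} [Field K] [Field Ω] {O : ValuationSubring Ω}

theorem residue_eq_residue_iff {x y : O} :
    residue O x = residue O y ↔ O.valuation ((x : Ω) - y) < 1 := by
  rw [← sub_eq_zero, ← map_sub, residue_eq_zero_iff, ValuationSubring.valuation_lt_one_iff]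
  rfl

variable [Algebra K Ω]

theorem valuation_comap_lt_one_iff {x : K} :
    (O.comap (algebraMap K Ω)).valuation x < 1 ↔ O.valuation (algebraMap K Ω x) < 1 := by
  rw [← ValuationSubring.mem_nonunits_iff, ← ValuationSubring.mem_nonunits_iff,
    ValuationSubring.mem_nonunits_iff_or, ValuationSubring.mem_nonunits_iff_or, map_eq_zero,
    ← map_inv₀]
  rfl

instance : Algebra (O.comap (algebraMap K Ω)) O :=
  ((algebraMap K Ω).restrict (O.comap (algebraMap K Ω)) O fun _ h => h).toAlgebra

instance : IsScalarTower (O.comap (algebraMap K Ω)) O Ω :=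
  .of_algebraMap_eq fun _ => rfl

instance : IsLocalHom (algebraMap (O.comap (algebraMap K Ω)) O) where
  map_nonunit a ha := by
    by_contra hcon
    have hlt := valuation_comap_lt_one_iff.mp
      ((ValuationSubring.valuation_lt_one_iff _ a).mp ((mem_maximalIdeal a).mpr hcon))
    exact hlt.ne ((O.valuation_eq_one_iff (algebraMap _ O a)).mp ha)

theorem mem_of_isIntegral {x : Ω} (hx : IsIntegral (O.comap (algebraMap K Ω)) x) : x ∈ O := by
  obtain ⟨y, rfl⟩ := IsIntegrallyClosed.isIntegral_iff.mp (hx.tower_top (A := O))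
  exact y.2

end Comap

section Center

variable {K Ω : Type*} [Field K] [Field Ω]

theorem aeval_iterate_divX_mem {V : ValuationSubring Ω} {R : Type*} [CommRing R] [Algebra R Ω]
    (hV : ∀ r : R, algebraMap R Ω r ∈ V) {Q : R[X]} {x : Ω} (hx : Polynomial.aeval x Q = 0)
    (j : ℕ) :
    Polynomial.aeval x (Polynomial.divX^[j] Q) ∈ V ∧
      Polynomial.aeval x (Polynomial.divX^[j] Q) * x ∈ V := by
  have haeval (P : R[X]) (hxV : x ∈ V) : Polynomial.aeval x P ∈ V := by
    rw [Polynomial.aeval_eq_sum_range]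
    exact sum_mem fun i _ => by
      rw [Algebra.smul_def]
      exact mul_mem (hV _) (pow_mem hxV i)
  by_cases hxV : x ∈ V
  · exact ⟨haeval _ hxV, mul_mem (haeval _ hxV) hxV⟩
  · have hx0 : x ≠ 0 := fun h => hxV (h ▸ zero_mem V)
    have hmul : Polynomial.aeval x (Polynomial.divX^[j] Q) * x ∈ V →
        Polynomial.aeval x (Polynomial.divX^[j] Q) ∈ V := fun h => by
      simpa [hx0] using mul_mem h ((V.mem_or_inv_mem x).resolve_left hxV)
    suffices h : Polynomial.aeval x (Polynomial.divX^[j] Q) * x ∈ V from ⟨hmul h, h⟩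
    clear hmul
    induction j with
    | zero => simp [hx]
    | succ j ih =>
      have hdivX : Polynomial.aeval x (Polynomial.divX^[j + 1] Q) * x =
          Polynomial.aeval x (Polynomial.divX^[j] Q) -
            algebraMap R Ω ((Polynomial.divX^[j] Q).coeff 0) := by
        rw [Function.iterate_succ_apply', eq_sub_iff_add_eq]
        conv_rhs => rw [← Polynomial.divX_mul_X_add (Polynomial.divX^[j] Q)]
        simp
      rw [hdivX]
      refine sub_mem ?_ (hV _)
      simpa [hx0] using mul_mem ih ((V.mem_or_inv_mem x).resolve_left hxV)

theorem isIntegral_aeval_iterate_divX {R : Type*} [CommRing R] [Algebra R Ω] {Q : R[X]} {x : Ω}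
    (hx : Polynomial.aeval x Q = 0) (j : ℕ) :
    IsIntegral R (Polynomial.aeval x (Polynomial.divX^[j] Q)) ∧
      IsIntegral R (Polynomial.aeval x (Polynomial.divX^[j] Q) * x) :=
  ⟨isIntegral_of_forall_mem_valuationSubring fun _ hV => (aeval_iterate_divX_mem hV hx j).1,
    isIntegral_of_forall_mem_valuationSubring fun _ hV => (aeval_iterate_divX_mem hV hx j).2⟩

theorem coeff_iterate_divX {R : Type*} [Semiring R] (Q : R[X]) (j i : ℕ) :
    (Polynomial.divX^[j] Q).coeff i = Q.coeff (i + j) := by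
  induction j generalizing i with
  | zero => rfl
  | succ j ih => rw [Function.iterate_succ_apply', Polynomial.coeff_divX, ih]; congr 1; omega

theorem exists_primitive_multiple (A : ValuationSubring K) {P : K[X]} (hP : P ≠ 0) :
    ∃ (Q : A[X]) (j : ℕ), P ∣ Q.map (algebraMap A K) ∧ Q.coeff j = 1 ∧
      ∀ i, j < i → Q.coeff i ∈ maximalIdeal A := by
  obtain ⟨j, hj, hmax⟩ := Finset.exists_max_image P.support
    (fun i => toLex (A.valuation (P.coeff i), i)) (Polynomial.support_nonempty.mpr hP)
  have hj0 : P.coeff j ≠ 0 := Polynomial.mem_support_iff.mp hj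
  have hpos : 0 < A.valuation (P.coeff j) := zero_lt_iff.mpr ((map_ne_zero _).mpr hj0)
  have hcoeff (i : ℕ) : A.valuation ((P.coeff j)⁻¹ * P.coeff i) ≤ 1 ∧
      (j < i → A.valuation ((P.coeff j)⁻¹ * P.coeff i) < 1) := by
    rw [map_mul, map_inv₀, inv_mul_le_one₀ hpos, inv_mul_lt_one₀ hpos]
    by_cases hi : P.coeff i = 0
    · rw [hi, map_zero]
      exact ⟨hpos.le, fun _ => hpos⟩
    · rcases Prod.Lex.le_iff.mp (hmax i (Polynomial.mem_support_iff.mpr hi)) with h | ⟨h, hij⟩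
      · exact ⟨le_of_lt h, fun _ => h⟩
      · exact ⟨le_of_eq h, fun hji => absurd hij (not_le.mpr hji)⟩
  have hlifts : Polynomial.C (P.coeff j)⁻¹ * P ∈ Polynomial.lifts (algebraMap A K) :=
    (Polynomial.lifts_iff_coeff_lifts _).mpr fun i => by
      rw [Polynomial.coeff_C_mul]
      exact ⟨⟨_, (A.valuation_le_one_iff _).mp (hcoeff i).1⟩, rfl⟩
  obtain ⟨Q, hQ⟩ := (Polynomial.mem_lifts _).mp hlifts
  have hQcoeff (i : ℕ) : (Q.coeff i : K) = (P.coeff j)⁻¹ * P.coeff i := by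
    rw [← Polynomial.coeff_C_mul, ← hQ, Polynomial.coeff_map]
    rfl
  refine ⟨Q, j, hQ ▸ dvd_mul_left P _, Subtype.ext ?_, fun i hij => ?_⟩
  · rw [hQcoeff, inv_mul_cancel₀ hj0]
    rfl
  · rw [A.valuation_lt_one_iff, hQcoeff]
    exact (hcoeff i).2 hij

variable [Algebra K Ω] {O : ValuationSubring Ω}

variable (K) in
theorem exists_isIntegral_mul [Algebra.IsAlgebraic K Ω] {x : Ω} (hx : x ∈ O) :
    ∃ b, IsIntegral (O.comap (algebraMap K Ω)) b ∧
      IsIntegral (O.comap (algebraMap K Ω)) (b * x) ∧ O.valuation (b - 1) < 1 := by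
  let A := O.comap (algebraMap K Ω)
  obtain ⟨Q, j, ⟨P, hQP⟩, hj, hlt⟩ := exists_primitive_multiple A
    (minpoly.ne_zero (Algebra.IsIntegral.isIntegral (R := K) x))
  have hQx : Polynomial.aeval x Q = 0 := by
    rw [← Polynomial.aeval_map_algebraMap K, hQP, map_mul, minpoly.aeval, zero_mul]
  obtain ⟨hb, hbx⟩ := isIntegral_aeval_iterate_divX hQx j
  refine ⟨_, hb, hbx, ?_⟩
  have hsub : Polynomial.aeval x (Polynomial.divX^[j] Q) - 1 =
      Polynomial.aeval x (Polynomial.divX^[j + 1] Q) * x := by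
    rw [Function.iterate_succ_apply', sub_eq_iff_eq_add]
    conv_lhs => rw [← Polynomial.divX_mul_X_add (Polynomial.divX^[j] Q)]
    simp [coeff_iterate_divX, hj]
  rw [hsub, Polynomial.aeval_eq_sum_range, Finset.sum_mul]
  refine O.valuation.map_sum_lt one_ne_zero fun k _ => ?_
  rw [Algebra.smul_def, mul_assoc, map_mul]
  refine mul_lt_one_of_lt_of_le ?_ ((O.valuation_le_one_iff _).mpr (mul_mem (pow_mem hx k) hx))
  rw [coeff_iterate_divX]
  exact valuation_comap_lt_one_iff.mp
    ((A.valuation_lt_one_iff _).mp (hlt (k + (j + 1)) (by omega)))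

variable (K O) in
/-- The residue map of `O` on the integral closure in `Ω` of the valuation ring of `K`. -/
def centerResidue : integralClosure (O.comap (algebraMap K Ω)) Ω →+* ResidueField O :=
  (residue O).comp ((algebraMap _ Ω).codRestrict O fun b => mem_of_isIntegral b.2)

variable (K O) in
/-- The center of `O` on the integral closure in `Ω` of the valuation ring of `K`. -/
def center : Ideal (integralClosure (O.comap (algebraMap K Ω)) Ω) := RingHom.ker (centerResidue K O)

theorem centerResidue_apply (b : integralClosure (O.comap (algebraMap K Ω)) Ω) :
    centerResidue K O b = residue O ⟨b, mem_of_isIntegral b.2⟩ := rfl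

theorem mem_center {b : integralClosure (O.comap (algebraMap K Ω)) Ω} :
    b ∈ center K O ↔ O.valuation (b : Ω) < 1 := by
  rw [center, RingHom.mem_ker, centerResidue_apply, residue_eq_zero_iff,
    ValuationSubring.valuation_lt_one_iff]

variable [Algebra.IsAlgebraic K Ω]

theorem centerResidue_surjective : Function.Surjective (centerResidue K O) := by
  intro y
  obtain ⟨⟨x, hx⟩, rfl⟩ := residue_surjective y
  obtain ⟨b, -, hbx, hb1⟩ := exists_isIntegral_mul K hx
  refine ⟨⟨_, hbx⟩, residue_eq_residue_iff.mpr ?_⟩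
  change O.valuation (b * x - x) < 1
  rw [← sub_one_mul, map_mul]
  exact mul_lt_one_of_lt_of_le hb1 ((O.valuation_le_one_iff _).mpr hx)

instance : (center K O).IsMaximal :=
  RingHom.ker_isMaximal_of_surjective _ centerResidue_surjective

theorem apply_mem_of_forall_smul_mem_center_iff {σ : Gal(Ω/K)}
    (hσ : ∀ b, σ • b ∈ center K O ↔ b ∈ center K O) {x : Ω} (hx : x ∈ O) : σ x ∈ O := by
  obtain ⟨b, hb, hbx, hb1⟩ := exists_isIntegral_mul K hx
  have hb_unit : O.valuation b = 1 := by
    simpa only [add_sub_cancel] using O.valuation.map_one_add_of_lt hb1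
  have hσb : O.valuation (σ b) = 1 := by
    refine le_antisymm ((O.valuation_le_one_iff _).mpr
      (mem_of_isIntegral (K := K) (σ • (⟨b, hb⟩ : integralClosure _ Ω)).2))
      (not_lt.mp fun hlt => ?_)
    exact (mem_center.mp ((hσ ⟨b, hb⟩).mp (mem_center.mpr hlt))).ne hb_unit
  have hσbx := (O.valuation_le_one_iff _).mpr
    (mem_of_isIntegral (K := K) (σ • (⟨b * x, hbx⟩ : integralClosure _ Ω)).2)
  rw [integralClosure.coe_smul, AlgEquiv.smul_def, map_mul, map_mul, hσb, one_mul] at hσbx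
  exact (O.valuation_le_one_iff _).mp hσbx

theorem mem_decomposition_of_forall_smul_mem_center_iff {σ : Gal(Ω/K)}
    (hσ : ∀ b, σ • b ∈ center K O ↔ b ∈ center K O) : σ ∈ O.decompositionSubgroup K := by
  refine mem_decomposition_iff.mpr fun x =>
    ⟨fun hx => ?_, apply_mem_of_forall_smul_mem_center_iff hσ⟩
  have hσ_inv (b) : σ⁻¹ • b ∈ center K O ↔ b ∈ center K O := by rw [← hσ, smul_inv_smul]
  simpa using apply_mem_of_forall_smul_mem_center_iff hσ_inv hx

end Center

section Lift

variable {K Ω : Type*} [Field K] [Field Ω] [Algebra K Ω] {O : ValuationSubring Ω}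

/-- The automorphism of the residue field induced by an automorphism of `Ω` preserving `O`. -/
def residueEquiv (g : Ω ≃+* Ω) (hg : ∀ x, g x ∈ O ↔ x ∈ O) : ResidueField O ≃+* ResidueField O :=
  ResidueField.mapEquiv
    (RingEquiv.ofBijective ((g : Ω →+* Ω).restrict O O fun x hx => (hg x).mpr hx)
      ⟨fun _ _ h => Subtype.ext (g.injective (congrArg Subtype.val h)),
        fun y => ⟨⟨g.symm y, (hg _).mp (by rw [g.apply_symm_apply]; exact y.2)⟩,
          Subtype.ext (g.apply_symm_apply y)⟩⟩)

theorem residueEquiv_residue {g : Ω ≃+* Ω} (hg : ∀ x, g x ∈ O ↔ x ∈ O) (x : O) :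
    residueEquiv g hg (residue O x) = residue O ⟨g x, (hg x).mpr x.2⟩ := rfl

theorem exists_decomposition_lift [IsGalois K Ω] {g : Ω ≃+* Ω} (hg : ∀ x, g x ∈ O ↔ x ∈ O)
    (hgK : ∀ a : K, algebraMap K Ω a ∈ O →
      O.valuation (g (algebraMap K Ω a) - algebraMap K Ω a) < 1) :
    ∃ ρ ∈ O.decompositionSubgroup K, ∀ x ∈ O, O.valuation (ρ x - g x) < 1 := by
  obtain ⟨ρ, hρ⟩ := exists_apply_smul_eq (K := K) (centerResidue_surjective (K := K) (O := O))
    (residueEquiv g hg) fun a => by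
      rw [centerResidue_apply, residueEquiv_residue]
      exact residue_eq_residue_iff.mpr (hgK a (mem_of_isIntegral a.2.algebraMap))
  have hρD : ρ ∈ O.decompositionSubgroup K :=
    mem_decomposition_of_forall_smul_mem_center_iff fun b => by
      rw [center, RingHom.mem_ker, RingHom.mem_ker, hρ, map_eq_zero_iff _ (RingEquiv.injective _)]
  refine ⟨ρ, hρD, fun x hx => ?_⟩
  obtain ⟨b, -, hbx, hb1⟩ := exists_isIntegral_mul K hx
  have hlt : O.valuation (b * x - x) < 1 := by
    rw [← sub_one_mul, map_mul]
    exact mul_lt_one_of_lt_of_le hb1 ((O.valuation_le_one_iff _).mpr hx)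
  have hρ_lt := (valuation_lt_one_of_mem_decomposition hρD _).mpr hlt
  have hg_lt := (valuation_lt_one_of_forall_mem_iff hg _).mpr hlt
  have hρg_lt : O.valuation (ρ (b * x) - g (b * x)) < 1 := by
    have h := hρ ⟨_, hbx⟩
    rw [centerResidue_apply, centerResidue_apply, residueEquiv_residue] at h
    exact residue_eq_residue_iff.mp h
  have hsum := O.valuation.map_add_lt (O.valuation.map_sub_lt hg_lt hρ_lt) hρg_lt
  convert hsum using 2
  rw [map_sub, map_sub]
  ring

end Lift

section Conjugates

variable {K Ω : Type*} [Field K] [Field Ω] [Algebra K Ω] {O : ValuationSubring Ω}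
  {Y : IntermediateField K Ω}

theorem mem_fixingSubgroup_of_forall_valuation_lt_one_iff [IsGalois K Ω]
    (hY : Y ≤ IntermediateField.fixedField (O.decompositionSubgroup K)) {σ : Gal(Ω/K)}
    (hσ : ∀ y : integralClosure (O.comap (algebraMap K Ω)) Y,
      O.valuation (σ (y : Y)) < 1 ↔ O.valuation ((y : Y) : Ω) < 1) :
    σ ∈ Y.fixingSubgroup := by
  have hmem (b) : b ∈ σ⁻¹ • center K O ↔ O.valuation (σ (b : Ω)) < 1 := by
    rw [Ideal.mem_inv_pointwise_smul_iff, mem_center]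
    rfl
  obtain ⟨ρ, hρ⟩ := exists_smul_eq_of_under_eq (K := Y) (center K O) (σ⁻¹ • center K O) <| by
    ext y
    rw [Ideal.mem_comap, Ideal.mem_comap, mem_center, hmem]
    exact (hσ y).symm
  have hσρ : σ * ρ.restrictScalars K ∈ O.decompositionSubgroup K :=
    mem_decomposition_of_forall_smul_mem_center_iff fun b => by
      have hρb : ρ • b ∈ σ⁻¹ • center K O ↔ b ∈ center K O := by
        rw [hρ, Ideal.smul_mem_pointwise_smul_iff]
      rw [← hρb, hmem, mem_center]
      rfl
  rw [IntermediateField.mem_fixingSubgroup_iff]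
  intro y hy
  have hσρy : σ (ρ y) = y := hY hy ⟨_, hσρ⟩
  have hρy : ρ y = y := ρ.commutes ⟨y, hy⟩
  rwa [hρy] at hσρy

variable (O) in
/-- The prime of the integral closure in `Y` of the valuation ring of `K` cut out by `O` through
the embedding `f` of `Y`. -/
def conjCenter (f : Y →ₐ[K] Ω) : Ideal (integralClosure (O.comap (algebraMap K Ω)) Y) :=
  (center K O).comap (f.restrictScalars _).mapIntegralClosure

theorem mem_conjCenter {f : Y →ₐ[K] Ω} {y : integralClosure (O.comap (algebraMap K Ω)) Y} :
    y ∈ conjCenter O f ↔ O.valuation (f y) < 1 := by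
  rw [conjCenter, Ideal.mem_comap, mem_center]
  rfl

instance [Algebra.IsAlgebraic K Ω] (f : Y →ₐ[K] Ω) : (conjCenter O f).IsMaximal :=
  Ideal.isMaximal_comap_of_isIntegral_of_isMaximal' _
    (RingHom.IsIntegral.tower_top (algebraMap (O.comap (algebraMap K Ω)) _) _ fun b => by
      rw [AlgHom.toRingHom_eq_coe, AlgHom.comp_algebraMap]
      exact Algebra.IsIntegral.isIntegral b) _

theorem conjCenter_ne [IsGalois K Ω]
    (hY : Y ≤ IntermediateField.fixedField (O.decompositionSubgroup K)) {f : Y →ₐ[K] Ω}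
    (hf : f ≠ Y.val) : conjCenter O f ≠ conjCenter O Y.val := by
  intro heq
  let σ : Gal(Ω/K) := AlgEquiv.ofBijective (f.liftNormal Ω) (AlgHom.normal_bijective K Ω Ω _)
  have hσ (y : Y) : σ y = f y := f.liftNormal_commutes Ω y
  have hfix := mem_fixingSubgroup_of_forall_valuation_lt_one_iff (σ := σ) hY fun y => by
    rw [hσ, ← mem_conjCenter, heq]
    exact mem_conjCenter
  exact hf (AlgHom.ext fun y => (hσ y).symm.trans
    ((IntermediateField.mem_fixingSubgroup_iff _ _).mp hfix y y.2))

theorem exists_congr_one_of_le_fixedField_decomposition [IsGalois K Ω] [FiniteDimensional K Y]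
    (hY : Y ≤ IntermediateField.fixedField (O.decompositionSubgroup K)) :
    ∃ e ∈ Y, IsIntegral (O.comap (algebraMap K Ω)) e ∧ O.valuation (e - 1) < 1 ∧
      ∀ τ ∉ Y.fixingSubgroup, O.valuation (τ e) < 1 := by
  classical
  let others : Finset (Y →ₐ[K] Ω) := {f | f ≠ Y.val}
  have hcoprime : IsCoprime (conjCenter O Y.val) (⨅ f ∈ others, conjCenter O f) :=
    Ideal.isCoprime_biInf fun f hf =>
      Ideal.isCoprime_of_isMaximal (conjCenter_ne hY (Finset.mem_filter.mp hf).2).symm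
  obtain ⟨d, hd, e, he, hde⟩ := Ideal.isCoprime_iff_exists.mp hcoprime
  refine ⟨(e : Y), (e : Y).2, e.2.algebraMap, ?_, fun τ hτ => ?_⟩
  · have hadd : ((d : Y) : Ω) + ((e : Y) : Ω) = 1 :=
      congrArg (fun c : integralClosure _ Y => ((c : Y) : Ω)) hde
    rw [← hadd, sub_add_cancel_right, Valuation.map_neg]
    exact mem_conjCenter.mp hd
  · have hmem : (τ : Ω →ₐ[K] Ω).comp Y.val ∈ others := by
      refine Finset.mem_filter.mpr ⟨Finset.mem_univ _, fun heq => hτ ?_⟩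
      exact (IntermediateField.mem_fixingSubgroup_iff _ _).mpr fun y hy =>
        DFunLike.congr_fun heq ⟨y, hy⟩
    exact mem_conjCenter.mp ((Submodule.mem_iInf _).mp ((Submodule.mem_iInf _).mp he _) hmem)

end Conjugates

/-! ### Henselization and strict henselization -/

section Roots

variable {Ω : Type*} [Field Ω] [IsAlgClosed Ω] {O : ValuationSubring Ω}

theorem splits_of_monic {f : O[X]} (hf : f.Monic) : f.Splits := by
  refine .of_splits_map_of_injective (i := algebraMap O Ω) Subtype.val_injective
    (IsAlgClosed.splits _) fun α hα => ?_
  exact IsIntegrallyClosed.isIntegral_iff.mp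
    ⟨f, hf, by rw [← Polynomial.eval_map]; exact (Polynomial.mem_roots'.mp hα).2⟩

theorem exists_isRoot_residue_eq {f : O[X]} (hf : f.Monic) {y : ResidueField O}
    (hy : Polynomial.aeval y f = 0) : ∃ α : O, f.IsRoot α ∧ residue O α = y := by
  rw [(splits_of_monic hf).eq_prod_roots_of_monic hf, map_multiset_prod, Multiset.prod_eq_zero_iff,
    Multiset.map_map, Multiset.mem_map] at hy
  obtain ⟨α, hα, hαy⟩ := hy
  refine ⟨α, (Polynomial.mem_roots'.mp hα).2, (sub_eq_zero.mp ?_).symm⟩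
  simpa only [Function.comp_apply, map_sub, Polynomial.aeval_X, Polynomial.aeval_C,
    ResidueField.algebraMap_eq] using hαy

instance : IsAlgClosed (ResidueField O) :=
  IsAlgClosed.of_exists_root _ fun p hp hp_irr => by
    obtain ⟨f, rfl, -, hf⟩ := Polynomial.lifts_and_natDegree_eq_and_monic
      (Polynomial.mem_lifts_of_surjective residue_surjective p) hp
    exact ((splits_of_monic hf).map (residue O)).exists_eval_eq_zero hp_irr.degree_pos.ne'

end Roots

section SimpleRoot

variable {K Ω : Type*} [Field K] [Field Ω] [Algebra K Ω] {O : ValuationSubring Ω}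

theorem aeval_residue {R : Type*} [CommRing R] [Algebra R O] (α : O) (g : R[X]) :
    Polynomial.aeval (residue O α) g = residue O (Polynomial.aeval α g) :=
  Polynomial.aeval_algebraMap_apply (ResidueField O) α g

theorem aeval_coe (α : O) (g : (O.comap (algebraMap K Ω))[X]) :
    Polynomial.aeval (α : Ω) g = (Polynomial.aeval α g : O) :=
  Polynomial.aeval_algebraMap_apply Ω α g

theorem exists_algebraMap_eq_of_isUnit_aeval_derivative {H : Subgroup Gal(Ω/K)}
    (hH : H ≤ O.decompositionSubgroup K)
    {f : (O.comap (algebraMap (IntermediateField.fixedField H) Ω))[X]} {α : O}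
    (hα : Polynomial.aeval α f = 0) (hα' : IsUnit (Polynomial.aeval α f.derivative))
    (hαH : ∀ σ ∈ H, O.valuation (σ α - α) < 1) :
    ∃ a : O.comap (algebraMap (IntermediateField.fixedField H) Ω),
      f.IsRoot a ∧ algebraMap _ O a = α := by
  let E := IntermediateField.fixedField H
  have hfix (σ : H) : σ.1 (α : Ω) = α := by
    let σα : O := ⟨σ.1 α, (mem_decomposition_iff.mp (hH σ.2) _).mpr α.2⟩
    have hσα : Polynomial.aeval σα f = 0 := by
      let σE : Gal(Ω/E) := IntermediateField.fixingSubgroupEquiv E ⟨σ.1, fun x => x.2 σ⟩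
      refine Subtype.val_injective ((aeval_coe σα f).symm.trans ?_)
      change Polynomial.aeval (σE.restrictScalars (O.comap (algebraMap E Ω)) (α : Ω)) f = 0
      rw [Polynomial.aeval_algHom_apply, aeval_coe, hα, ZeroMemClass.coe_zero, map_zero]
    refine (congrArg Subtype.val (eq_of_eval_eq_zero_of_not_isUnit_sub
      (f := f.map (algebraMap _ O)) (a := α) (b := σα) ?_ ?_ ?_ ?_)).symm
    · rwa [Polynomial.eval_map_algebraMap]
    · rwa [Polynomial.eval_map_algebraMap]
    · rw [← residue_ne_zero_iff_isUnit, not_not, map_sub, sub_eq_zero, eq_comm,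
        residue_eq_residue_iff]
      exact hαH _ σ.2
    · rwa [Polynomial.derivative_map, Polynomial.eval_map_algebraMap]
  let a : O.comap (algebraMap E Ω) := ⟨⟨α, hfix⟩, α.2⟩
  have ha : Polynomial.aeval (algebraMap _ O a) f = 0 := hα
  rw [Polynomial.aeval_algebraMap_apply_eq_algebraMap_eval] at ha
  exact ⟨a, congrArg (fun y : O => (y : Ω)) ha |> fun h => Subtype.ext (Subtype.ext h), rfl⟩

theorem valuation_aeval_derivative_minpoly [IsGalois K Ω] {e : Ω}
    (he : ∀ τ : Gal(Ω/K), τ e ≠ e → O.valuation (e - τ e) = 1) :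
    O.valuation (Polynomial.aeval e (minpoly K e).derivative) = 1 := by
  classical
  have hint : IsIntegral K e := Algebra.IsIntegral.isIntegral e
  have hmonic := (minpoly.monic hint).map (algebraMap K Ω)
  have hroot {α : Ω} : α ∈ ((minpoly K e).map (algebraMap K Ω)).roots ↔
      Polynomial.aeval α (minpoly K e) = 0 := by
    rw [Polynomial.mem_roots hmonic.ne_zero, Polynomial.IsRoot, Polynomial.eval_map_algebraMap]
  have hsep : ((minpoly K e).map (algebraMap K Ω)).Separable :=
    Polynomial.Separable.map (Algebra.IsSeparable.isSeparable K e)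
  rw [← Polynomial.eval_map_algebraMap, ← Polynomial.derivative_map,
    (Normal.splits inferInstance e).eval_root_derivative hmonic (hroot.mpr (minpoly.aeval K e)),
    map_multiset_prod]
  refine Multiset.prod_eq_one fun x hx => ?_
  rw [Multiset.map_map, Multiset.mem_map] at hx
  obtain ⟨α, hα, rfl⟩ := hx
  obtain ⟨hne, hα_root⟩ := (Polynomial.nodup_roots hsep).mem_erase_iff.mp hα
  obtain ⟨τ, rfl⟩ := isConjRoot_iff_exists_algEquiv.mp
    (isConjRoot_of_aeval_eq_zero hint (hroot.mp hα_root)).symm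
  exact he τ hne

end SimpleRoot

section Henselization

variable {K Ω : Type*} [Field K] [Field Ω] [Algebra K Ω] {O : ValuationSubring Ω}

theorem mem_bot_of_henselianLocalRing [IsGalois K Ω]
    (hK : HenselianLocalRing (O.comap (algebraMap K Ω))) {e : Ω}
    (he : IsIntegral (O.comap (algebraMap K Ω)) e) (he1 : O.valuation (e - 1) < 1)
    (heconj : ∀ τ : Gal(Ω/K), τ e ≠ e → O.valuation (τ e) < 1) :
    e ∈ (⊥ : IntermediateField K Ω) := by
  let A := O.comap (algebraMap K Ω)
  let eO : O := ⟨e, mem_of_isIntegral he⟩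
  have hev : O.valuation e = 1 := by
    simpa only [add_sub_cancel] using O.valuation.map_one_add_of_lt he1
  have hminpoly : minpoly K e = (minpoly A e).map (algebraMap A K) :=
    minpoly.isIntegrallyClosed_eq_field_fractions' K he
  have hroot : Polynomial.aeval eO (minpoly A e) = 0 :=
    Subtype.val_injective ((aeval_coe eO _).symm.trans (minpoly.aeval A e))
  have hsimple : IsUnit (Polynomial.aeval eO (minpoly A e).derivative) := by
    rw [O.valuation_eq_one_iff, ← aeval_coe, ← Polynomial.aeval_map_algebraMap K,
      ← Polynomial.derivative_map, ← hminpoly]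
    exact valuation_aeval_derivative_minpoly fun τ hτ =>
      (O.valuation.map_sub_eq_of_lt_left (hev.symm ▸ heconj τ hτ)).trans hev
  have hone : residue O 1 = residue O eO := residue_eq_residue_iff.mpr <| by
    rwa [O.valuation.map_sub_swap]
  have hcongr (g : A[X]) :
      residue O (algebraMap A O (g.eval 1)) = residue O (Polynomial.aeval eO g) := by
    rw [← Polynomial.aeval_algebraMap_apply_eq_algebraMap_eval, map_one, ← aeval_residue,
      ← aeval_residue, hone]
  obtain ⟨a, ha, -⟩ := hK.is_henselian _ (minpoly.monic he) 1
    (by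
      rw [mem_maximalIdeal, ← map_mem_nonunits_iff (algebraMap A O), ← mem_maximalIdeal,
        ← residue_eq_zero_iff, hcongr, hroot, map_zero])
    (by
      refine isUnit_of_map_unit (algebraMap A O) _ ?_
      rwa [← residue_ne_zero_iff_isUnit, hcongr, residue_ne_zero_iff_isUnit])
  refine IntermediateField.mem_bot.mpr (minpoly.mem_range_of_degree_eq_one K e
    (Polynomial.degree_eq_one_of_irreducible_of_root
      (minpoly.irreducible (Algebra.IsIntegral.isIntegral e)) (x := (a : K)) ?_))
  rw [hminpoly]
  exact ha.map

theorem fixedField_decomposition_eq_bot [IsGalois K Ω]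
    (hK : HenselianLocalRing (O.comap (algebraMap K Ω))) :
    IntermediateField.fixedField (O.decompositionSubgroup K) = ⊥ := by
  refine eq_bot_iff.mpr fun z hz => ?_
  let Y := IntermediateField.adjoin K {z}
  have : FiniteDimensional K Y :=
    IntermediateField.adjoin.finiteDimensional (Algebra.IsIntegral.isIntegral z)
  obtain ⟨e, heY, he, he1, heconj⟩ := exists_congr_one_of_le_fixedField_decomposition (Y := Y)
    (IntermediateField.adjoin_le_iff.mpr (Set.singleton_subset_iff.mpr hz))
  obtain ⟨c, hc⟩ := IntermediateField.mem_bot.mp <| mem_bot_of_henselianLocalRing hK he he1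
    fun τ hτ => heconj τ fun h => hτ ((IntermediateField.mem_fixingSubgroup_iff _ _).mp h e heY)
  refine (InfiniteGalois.mem_bot_iff_fixed z).mpr fun τ => ?_
  refine (IntermediateField.mem_fixingSubgroup_iff Y τ).mp ?_ z
    (IntermediateField.mem_adjoin_simple_self K z)
  by_contra hτ
  have hlt := O.valuation.map_sub_lt (heconj τ hτ) he1
  rw [← hc, AlgEquiv.commutes, sub_sub_cancel, map_one] at hlt
  exact lt_irrefl _ hlt

instance [Algebra.IsAlgebraic K Ω] :
    Algebra.IsAlgebraic (ResidueField (O.comap (algebraMap K Ω))) (ResidueField O) where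
  isAlgebraic y := by
    obtain ⟨b, rfl⟩ := centerResidue_surjective (K := K) y
    have hb : IsIntegral (O.comap (algebraMap K Ω)) (⟨b, mem_of_isIntegral b.2⟩ : O) :=
      (isIntegral_algebraMap_iff (B := Ω) Subtype.val_injective).mp b.2
    exact (hb.map (IsScalarTower.toAlgHom (O.comap (algebraMap K Ω)) O
      (ResidueField O))).tower_top.isAlgebraic

theorem decomposition_le_inertia [Algebra.IsAlgebraic K Ω]
    [IsSepClosed (ResidueField (O.comap (algebraMap K Ω)))] :
    O.decompositionSubgroup K ≤ inertia K O := by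
  refine fun σ hσ => ⟨hσ, fun x hx => ?_⟩
  let g := residueEquiv (σ : Ω ≃+* Ω) (mem_decomposition_iff.mp hσ)
  have hg : (g : ResidueField O →+* ResidueField O) = RingHom.id _ := by
    refine IsPurelyInseparable.injective_comp_algebraMap
      (ResidueField (O.comap (algebraMap K Ω))) _ _ (RingHom.ext fun y => ?_)
    obtain ⟨a, rfl⟩ := residue_surjective y
    exact congrArg (residue O) (Subtype.ext (σ.commutes (a : K)))
  exact residue_eq_residue_iff.mp (RingHom.congr_fun hg (residue O ⟨x, hx⟩))

theorem fixedField_inertia_eq_bot [IsGalois K Ω]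
    (hK : HenselianLocalRing (O.comap (algebraMap K Ω)))
    (hk : IsSepClosed (ResidueField (O.comap (algebraMap K Ω)))) :
    IntermediateField.fixedField (inertia K O) = ⊥ := by
  rw [le_antisymm (fun _ hσ => hσ.1) decomposition_le_inertia, fixedField_decomposition_eq_bot hK]

theorem henselianLocalRing_fixedField [IsAlgClosed Ω] {H : Subgroup Gal(Ω/K)}
    (hH : H ≤ O.decompositionSubgroup K) :
    HenselianLocalRing (O.comap (algebraMap (IntermediateField.fixedField H) Ω)) := by
  let A := O.comap (algebraMap (IntermediateField.fixedField H) Ω)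
  refine ((HenselianLocalRing.TFAE A).out 0 1).mpr fun f hf y hy hy' => ?_
  obtain ⟨c, rfl⟩ := residue_surjective y
  let c' := algebraMap _ O c
  have haeval (g : A[X]) : Polynomial.aeval (residue O c') g =
      algebraMap _ (ResidueField O) (Polynomial.aeval (residue _ c) g) :=
    Polynomial.aeval_algebraMap_apply (ResidueField O) (residue _ c) g
  obtain ⟨α, hα, hαc⟩ := exists_isRoot_residue_eq (hf.map (algebraMap _ O)) (y := residue O c')
    (by rw [Polynomial.aeval_map_algebraMap, haeval, hy, map_zero])
  rw [Polynomial.IsRoot, Polynomial.eval_map_algebraMap] at hα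
  have hαc_lt := residue_eq_residue_iff.mp hαc
  obtain ⟨a, ha, rfl⟩ := exists_algebraMap_eq_of_isUnit_aeval_derivative hH hα
    (by
      rw [← residue_ne_zero_iff_isUnit, ← aeval_residue, hαc, haeval]
      exact (map_ne_zero _).mpr hy')
    fun σ hσ => by
      have hσc : σ c' = c' := (c : IntermediateField.fixedField H).2 ⟨σ, hσ⟩
      have hσα_lt := (valuation_lt_one_of_mem_decomposition (hH hσ) _).mpr hαc_lt
      rw [map_sub, hσc] at hσα_lt
      simpa only [sub_sub_sub_cancel_right] using O.valuation.map_sub_lt hσα_lt hαc_lt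
  exact ⟨a, ha, (algebraMap (ResidueField _) (ResidueField O)).injective hαc⟩

theorem isSepClosed_residueField_fixedField_inertia [IsAlgClosed Ω] :
    IsSepClosed (ResidueField
      (O.comap (algebraMap (IntermediateField.fixedField (inertia K O)) Ω))) := by
  refine IsSepClosed.of_exists_root _ fun p hp hp_irr hp_sep => ?_
  obtain ⟨f, rfl, -, hf⟩ := Polynomial.lifts_and_natDegree_eq_and_monic
    (Polynomial.mem_lifts_of_surjective residue_surjective p) hp
  have : FaithfulSMul (ResidueField (O.comap
      (algebraMap (IntermediateField.fixedField (inertia K O)) Ω))) (ResidueField O) :=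
    (faithfulSMul_iff_algebraMap_injective _ _).mpr (RingHom.injective _)
  obtain ⟨y, hy⟩ := IsAlgClosed.exists_aeval_eq_zero (ResidueField O) _ hp_irr.degree_pos.ne'
  have hy' := hp_sep.aeval_derivative_ne_zero hy
  rw [← ResidueField.algebraMap_eq, Polynomial.derivative_map,
    Polynomial.aeval_map_algebraMap] at hy'
  rw [← ResidueField.algebraMap_eq, Polynomial.aeval_map_algebraMap] at hy
  obtain ⟨α, hα, rfl⟩ := exists_isRoot_residue_eq (hf.map (algebraMap _ O)) (y := y)
    (by rwa [Polynomial.aeval_map_algebraMap])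
  rw [Polynomial.IsRoot, Polynomial.eval_map_algebraMap] at hα
  obtain ⟨a, ha, -⟩ := exists_algebraMap_eq_of_isUnit_aeval_derivative (H := inertia K O)
    (fun _ hσ => hσ.1) hα
    (by rwa [← residue_ne_zero_iff_isUnit, ← aeval_residue]) fun σ hσ => hσ.2 α α.2
  exact ⟨residue _ a, ha.map⟩

variable [IsGalois K Ω] [IsAlgClosed Ω]

variable (K O) in
theorem henselization_eq :
    henselization K O = IntermediateField.fixedField (O.decompositionSubgroup K) := by
  refine le_antisymm (sInf_le (henselianLocalRing_fixedField le_rfl)) (le_sInf fun E hE x hx => ?_)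
  have hxE : x ∈ IntermediateField.fixedField (O.decompositionSubgroup E) := fun σ =>
    hx ⟨σ.1.restrictScalars K, mem_decomposition_iff.mpr (mem_decomposition_iff.mp σ.2)⟩
  rw [fixedField_decomposition_eq_bot hE] at hxE
  obtain ⟨y, rfl⟩ := IntermediateField.mem_bot.mp hxE
  exact y.2

variable (K O) in
theorem strictHenselization_eq :
    strictHenselization K O = IntermediateField.fixedField (inertia K O) := by
  refine le_antisymm (sInf_le ⟨henselianLocalRing_fixedField fun σ hσ => hσ.1,
    isSepClosed_residueField_fixedField_inertia⟩) (le_sInf fun E hE x hx => ?_)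
  have hxE : x ∈ IntermediateField.fixedField (inertia E O) := fun σ =>
    hx ⟨σ.1.restrictScalars K, mem_decomposition_iff.mpr (mem_decomposition_iff.mp σ.2.1), σ.2.2⟩
  rw [fixedField_inertia_eq_bot hE.1 hE.2] at hxE
  obtain ⟨y, rfl⟩ := IntermediateField.mem_bot.mp hxE
  exact y.2

end Henselization

/-! ### Crossed homomorphisms and Artin–Schreier theory -/

section CrossedHom

variable {k G M : Type*} [CommRing k] [Group G] [AddCommGroup M] [Module k M]
  {ρ : Representation k G M} {c : G → M}

theorem exists_subgroup_index_eq_of_crossedHom_surjective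
    (hc : ∀ g h, c (g * h) = c g + ρ g (c h)) (hsurj : Function.Surjective c) :
    ∃ X : Subgroup G, X.index = Nat.card M ∧ ∀ g, g ∈ X ↔ c g = 0 := by
  have hc1 : c 1 = 0 := by simpa using hc 1 1
  let : MulAction G M :=
    { smul g x := c g + ρ g x
      one_smul x := by change c 1 + ρ 1 x = x; rw [hc1, map_one, Module.End.one_apply, zero_add]
      mul_smul g h x := by
        change c (g * h) + ρ (g * h) x = c g + ρ g (c h + ρ h x)
        rw [hc, map_mul, Module.End.mul_apply, map_add, add_assoc] }
  have hsmul (g : G) : g • (0 : M) = c g := by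
    change c g + ρ g 0 = c g
    rw [map_zero, add_zero]
  refine ⟨MulAction.stabilizer G (0 : M), ?_, fun g => by rw [MulAction.mem_stabilizer_iff, hsmul]⟩
  rw [MulAction.index_stabilizer, ← Set.ncard_univ]
  exact congrArg Set.ncard (Set.eq_univ_of_forall fun x => (hsurj x).imp fun g hg => by
    rw [← hg, ← hsmul])

variable {Λ : Type*} [Ring Λ] [SMul G Λ] [Module Λ M] {W : Subgroup G}

-- The equivariant partition of unity `E` plays the role of an element of trace one in the usual
-- proof of Hilbert's Theorem 90.
theorem exists_eq_sub_of_crossedHom (hρ : ∀ g (l : Λ) x, ρ g (l • x) = (g • l) • ρ g x)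
    (hc : ∀ g h, c (g * h) = c g + ρ g (c h)) (hcW : ∀ w ∈ W, c w = 0) [Fintype (G ⧸ W)]
    {E : G ⧸ W → Λ} (hE : ∀ (g : G) q, g • E q = E (g • q)) (hE1 : ∑ q, E q = 1) :
    ∃ m, ∀ g, c g = ρ g m - m := by
  have hout (g : G) : c (g : G ⧸ W).out = c g := by
    obtain ⟨w, hw⟩ := QuotientGroup.mk_out_eq_mul W g
    rw [hw, hc, hcW w w.2, map_zero, add_zero]
  have hsmul (g : G) (q : G ⧸ W) : ρ g (c q.out) = c (g • q).out - c g := by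
    conv_rhs => rw [← QuotientGroup.out_eq' q, MulAction.Quotient.smul_mk, hout, smul_eq_mul, hc]
    rw [add_sub_cancel_left]
  refine ⟨-∑ q, E q • c q.out, fun g => ?_⟩
  have hsum : ρ g (∑ q, E q • c q.out) = ∑ q, E q • (c q.out - c g) := by
    rw [map_sum]
    exact Fintype.sum_equiv (MulAction.toPerm g) _ _ fun q => by
      rw [hρ, hE, hsmul, MulAction.toPerm_apply]
  rw [map_neg, hsum]
  simp only [smul_sub, Finset.sum_sub_distrib, ← Finset.sum_smul, hE1, one_smul]
  abel

end CrossedHom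

section Transition

variable {G : Type*} [Group G] (W : Subgroup G) [W.Normal]

/-- The transition elements of the section `Quotient.out` of `G → G ⧸ W`. They form a nonabelian
one-cocycle with values in the functions from `G ⧸ W` to `W`. -/
def transition (g : G) (q : G ⧸ W) : W :=
  ⟨g * q.out * (g • q).out⁻¹, by
    have hmk : (g • q : G ⧸ W) = (g : G ⧸ W) * q := by
      conv_lhs => rw [← QuotientGroup.out_eq' q]
      conv_rhs => rw [← QuotientGroup.out_eq' q]
      rfl
    rw [← QuotientGroup.eq_one_iff, QuotientGroup.mk_mul, QuotientGroup.mk_mul,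
      QuotientGroup.mk_inv, QuotientGroup.out_eq', QuotientGroup.out_eq', hmk, mul_inv_cancel]⟩

theorem transition_mul (g h : G) (q : G ⧸ W) :
    transition W (g * h) q = MulAut.conjNormal g (transition W h q) * transition W g (h • q) := by
  refine Subtype.ext ?_
  rw [Subgroup.coe_mul, MulAut.conjNormal_apply]
  simp only [transition, mul_smul]
  group

theorem transition_of_mem (w : W) (q : G ⧸ W) : transition W w q = w := by
  have hq : (w : G) • q = q := by
    obtain ⟨b, rfl⟩ := QuotientGroup.mk_surjective q
    rw [MulAction.Quotient.smul_mk, smul_eq_mul, eq_comm, QuotientGroup.eq, ← mul_assoc]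
    exact (inferInstance : W.Normal).conj_mem' w w.2 b
  exact Subtype.ext (by simp only [transition, hq, mul_inv_cancel_right])

end Transition

section SemilinearTensor

variable {F Λ G Q : Type*} [CommRing F] [CommRing Λ] [Algebra F Λ] [Group G]
  [MulSemiringAction G Λ] [SMulCommClass G F Λ] [AddCommGroup Q] [Module F Q]
  {ρ : Representation F G Q}

theorem tprod_ofDistribMulAction_smul (g : G) (l : Λ) (x : TensorProduct F Λ Q) :
    (Representation.ofDistribMulAction F G Λ).tprod ρ g (l • x) =
      (g • l) • (Representation.ofDistribMulAction F G Λ).tprod ρ g x := by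
  induction x with
  | zero => simp only [smul_zero, map_zero]
  | add x y hx hy => simp only [smul_add, map_add, hx, hy]
  | tmul a q =>
    rw [TensorProduct.smul_tmul', Representation.tprod_apply, TensorProduct.map_tmul,
      TensorProduct.map_tmul, TensorProduct.smul_tmul']
    exact congrArg (· ⊗ₜ[F] _) (smul_mul' g l a)

variable (Λ) in
theorem exists_finset_tprod_eq_self (x : TensorProduct F Λ Q) :
    ∃ S : Finset Λ, ∀ g : G, ρ g = 1 → (∀ s ∈ S, g • s = s) →
      (Representation.ofDistribMulAction F G Λ).tprod ρ g x = x := by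
  classical
  induction x with
  | zero => exact ⟨∅, fun g _ _ => map_zero _⟩
  | add x y hx hy =>
    obtain ⟨S, hS⟩ := hx
    obtain ⟨T, hT⟩ := hy
    exact ⟨S ∪ T, fun g hg hgST => by
      rw [map_add, hS g hg fun s hs => hgST s (Finset.mem_union_left _ hs),
        hT g hg fun s hs => hgST s (Finset.mem_union_right _ hs)]⟩
  | tmul a q =>
    refine ⟨{a}, fun g hg hga => ?_⟩
    rw [Representation.tprod_apply, TensorProduct.map_tmul, hg, Module.End.one_apply]
    exact congrArg (· ⊗ₜ[F] q) (hga a (Finset.mem_singleton_self a))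

theorem exists_tensor_crossedHom_eq_on_subgroup {W : Subgroup G} [W.Normal]
    [Fintype (G ⧸ W)] {E : G ⧸ W → Λ} {π : Additive W →+ Q} (hE : ∀ (g : G) q, g • E q = E (g • q))
    (hE1 : ∑ q, E q = 1)
    (hπρ : ∀ g w, π (.ofMul (MulAut.conjNormal g w)) = ρ g (π (.ofMul w))) :
    ∃ z : G → TensorProduct F Λ Q,
      (∀ g h, z (g * h) = z g + (Representation.ofDistribMulAction F G Λ).tprod ρ g (z h)) ∧
      ∀ w : W, z w = 1 ⊗ₜ π (.ofMul w) := by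
  refine ⟨fun g => ∑ q, E (g • q) ⊗ₜ π (.ofMul (transition W g q)), fun g h => ?_, fun w => ?_⟩
  · have hg : ∑ q, E (g • q) ⊗ₜ[F] π (.ofMul (transition W g q)) =
        ∑ q, E (g • h • q) ⊗ₜ π (.ofMul (transition W g (h • q))) :=
      (Fintype.sum_equiv (MulAction.toPerm h) _ _ fun q => rfl).symm
    have hh : (Representation.ofDistribMulAction F G Λ).tprod ρ g
          (∑ q, E (h • q) ⊗ₜ π (.ofMul (transition W h q))) =
        ∑ q, E (g • h • q) ⊗ₜ π (.ofMul (MulAut.conjNormal g (transition W h q))) := by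
      rw [map_sum]
      exact Finset.sum_congr rfl fun q _ => by rw [hπρ, ← hE g]; rfl
    beta_reduce
    rw [add_comm, hg, hh, ← Finset.sum_add_distrib]
    exact Finset.sum_congr rfl fun q _ => by
      rw [transition_mul, ofMul_mul, map_add, TensorProduct.tmul_add, mul_smul]
  · simp only [transition_of_mem, ← TensorProduct.sum_tmul]
    rw [← hE1]
    exact congrArg (· ⊗ₜ _) (Fintype.sum_equiv (MulAction.toPerm (w : G)) _ _ fun q => rfl)

end SemilinearTensor

section ArtinSchreier

variable {F Λ : Type*} [Field F] [Field Λ] [Algebra F Λ]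
  {G Q : Type*} [Group G] [MulSemiringAction G Λ] [SMulCommClass G F Λ]
  [AddCommGroup Q] [Module F Q] {ρ : Representation F G Q}

section Fintype

variable [Fintype F]

variable (F Λ) in
/-- The Artin–Schreier map `x ↦ x ^ q - x`, where `q` is the cardinality of `F`. -/
def artinSchreier : Λ →ₗ[F] Λ := (FiniteField.frobeniusAlgHom F Λ).toLinearMap - LinearMap.id

theorem artinSchreier_apply (x : Λ) : artinSchreier F Λ x = x ^ Fintype.card F - x := rfl

theorem artinSchreier_surjective [IsAlgClosed Λ] : Function.Surjective (artinSchreier F Λ) := by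
  intro y
  have hdeg : (Polynomial.X ^ Fintype.card F - Polynomial.X - Polynomial.C y : Λ[X]).degree ≠ 0 :=
    (Polynomial.natDegree_pos_iff_degree_pos.mp (by
      rw [Polynomial.natDegree_sub_C,
        FiniteField.X_pow_card_sub_X_natDegree_eq Λ Fintype.one_lt_card]
      exact Fintype.card_pos)).ne'
  obtain ⟨x, hx⟩ := IsAlgClosed.exists_root _ hdeg
  refine ⟨x, sub_eq_zero.mp ?_⟩
  simpa only [artinSchreier_apply, Polynomial.IsRoot, Polynomial.eval_sub, Polynomial.eval_pow,
    Polynomial.eval_X, Polynomial.eval_C] using hx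

theorem exact_algebraLinearMap_artinSchreier :
    Function.Exact (Algebra.linearMap F Λ) (artinSchreier F Λ) := by
  intro x
  rw [artinSchreier_apply, sub_eq_zero, Set.mem_range]
  refine ⟨fun hx => ?_, ?_⟩
  · let f : F[X] := Polynomial.X ^ Fintype.card F - Polynomial.X
    have hsplits : f.Splits := by
      rw [Polynomial.splits_iff_card_roots, FiniteField.roots_X_pow_card_sub_X,
        FiniteField.X_pow_card_sub_X_natDegree_eq F Fintype.one_lt_card]
      rfl
    refine hsplits.mem_range_of_isRoot
      (FiniteField.X_pow_card_sub_X_ne_zero F Fintype.one_lt_card) ?_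
    rw [Polynomial.IsRoot, Polynomial.eval_map_algebraMap, map_sub, map_pow, Polynomial.aeval_X,
      hx, sub_self]
  · rintro ⟨a, rfl⟩
    rw [Algebra.linearMap_apply, ← map_pow, FiniteField.pow_card]

theorem rTensor_artinSchreier_tprod (g : G) (x : TensorProduct F Λ Q) :
    (artinSchreier F Λ).rTensor Q ((Representation.ofDistribMulAction F G Λ).tprod ρ g x) =
      (Representation.ofDistribMulAction F G Λ).tprod ρ g ((artinSchreier F Λ).rTensor Q x) := by
  induction x with
  | zero => simp only [map_zero]
  | add x y hx hy => simp only [map_add, hx, hy]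
  | tmul a q =>
    have ha : artinSchreier F Λ (g • a) = g • artinSchreier F Λ a := by
      rw [artinSchreier_apply, artinSchreier_apply, smul_sub, smul_pow']
    exact congrArg (· ⊗ₜ[F] _) ha

theorem exists_one_tmul_eq_of_rTensor_artinSchreier_eq_zero [IsAlgClosed Λ]
    {x : TensorProduct F Λ Q} (hx : (artinSchreier F Λ).rTensor Q x = 0) : ∃ y : Q, 1 ⊗ₜ y = x := by
  obtain ⟨y, rfl⟩ := (rTensor_exact Q exact_algebraLinearMap_artinSchreier
    artinSchreier_surjective x).mp hx
  obtain ⟨y, rfl⟩ := (TensorProduct.lid F Q).symm.surjective y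
  exact ⟨y, by rw [TensorProduct.lid_symm_apply, LinearMap.rTensor_tmul,
    Algebra.linearMap_apply, map_one]⟩

end Fintype

variable {W : Subgroup G} [W.Normal] [Fintype (G ⧸ W)] {E : G ⧸ W → Λ} {π : Additive W →+ Q}

theorem exists_crossedHom_eq_on_subgroup [Finite F] [IsAlgClosed Λ]
    (hE : ∀ (g : G) q, g • E q = E (g • q)) (hE1 : ∑ q, E q = 1) (hπ : Function.Surjective π)
    (hπρ : ∀ g w, π (.ofMul (MulAut.conjNormal g w)) = ρ g (π (.ofMul w))) :
    ∃ c : G → Q, (∀ g h, c (g * h) = c g + ρ g (c h)) ∧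
      ∃ S : Finset Λ, ∀ w : W, (∀ s ∈ S, (w : G) • s = s) → c w = π (.ofMul w) := by
  have := Fintype.ofFinite F
  let τ := (Representation.ofDistribMulAction F G Λ).tprod ρ
  let AS := (artinSchreier F Λ).rTensor Q
  obtain ⟨z, hz, hzW⟩ := exists_tensor_crossedHom_eq_on_subgroup (F := F) hE hE1 hπρ
  obtain ⟨m, hm⟩ : ∃ m, ∀ g, AS (z g) = τ g m - m := by
    refine exists_eq_sub_of_crossedHom (c := fun g => AS (z g)) tprod_ofDistribMulAction_smul
      (fun g h => ?_) (fun w hw => ?_) hE hE1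
    · rw [hz, map_add, rTensor_artinSchreier_tprod]
    · rw [hzW ⟨w, hw⟩, LinearMap.rTensor_tmul, artinSchreier_apply, one_pow, sub_self,
        TensorProduct.zero_tmul]
  obtain ⟨n, rfl⟩ := LinearMap.rTensor_surjective Q artinSchreier_surjective m
  have hdescend (g : G) : ∃ x : Q, (1 : Λ) ⊗ₜ[F] x = z g - (τ g n - n) :=
    exists_one_tmul_eq_of_rTensor_artinSchreier_eq_zero (by
      rw [map_sub, map_sub, rTensor_artinSchreier_tprod]
      exact sub_eq_zero.mpr (hm g))
  choose c hc using hdescend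
  have hinj : Function.Injective fun x : Q => (1 : Λ) ⊗ₜ[F] x :=
    Module.FaithfullyFlat.tensorProduct_mk_injective Q
  obtain ⟨S, hS⟩ := exists_finset_tprod_eq_self (ρ := ρ) Λ n
  refine ⟨c, fun g h => hinj ?_, S, fun w hw => hinj ?_⟩
  · have hτ : τ g (1 ⊗ₜ c h) = 1 ⊗ₜ ρ g (c h) := congrArg (· ⊗ₜ _) (smul_one g)
    beta_reduce
    rw [TensorProduct.tmul_add, ← hτ, hc, hc, hc, hz, map_mul, Module.End.mul_apply, map_sub,
      map_sub]
    abel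
  · have hρw : ρ w = 1 := LinearMap.ext fun x => by
      obtain ⟨y, rfl⟩ := hπ x
      obtain ⟨y, rfl⟩ := Additive.ofMul.surjective y
      rw [← hπρ, MulAut.conjNormal_val, MulAut.conj_apply, ofMul_mul, ofMul_mul, ofMul_inv,
        map_add, map_add, map_neg, add_neg_cancel_comm, Module.End.one_apply]
    beta_reduce
    rw [hc, hzW, hS w hρw hw, sub_self, sub_zero]

end ArtinSchreier

section ElementaryAbelianQuotient

/-- The largest elementary abelian `p`-group quotient `H / [H, H] H ^ p` of a group `H`, written
additively. -/
def ElementaryAbelianQuotient (p : ℕ) (H : Type*) [Group H] : Type _ :=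
  ModN (Additive (Abelianization H)) p

namespace ElementaryAbelianQuotient

variable (p : ℕ) {H H' : Type*} [Group H] [Group H']

instance : AddCommGroup (ElementaryAbelianQuotient p H) :=
  inferInstanceAs (AddCommGroup (ModN _ p))

instance : Module (ZMod p) (ElementaryAbelianQuotient p H) :=
  inferInstanceAs (Module (ZMod p) (ModN _ p))

/-- The quotient map onto the largest elementary abelian quotient. -/
def mk : Additive H →+ ElementaryAbelianQuotient p H :=
  (ModN.mkQ p).comp Abelianization.of.toAdditive

theorem mk_surjective : Function.Surjective (mk p (H := H)) := by
  intro x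
  obtain ⟨y, rfl⟩ := Submodule.mkQ_surjective _ x
  obtain ⟨h, hh⟩ := QuotientGroup.mk'_surjective (commutator H) y.toMul
  exact ⟨.ofMul h, congrArg (fun z => ModN.mkQ p (Additive.ofMul z)) hh⟩

instance [Finite H] : Finite (ElementaryAbelianQuotient p H) :=
  .of_surjective _ (mk_surjective p)

/-- The linear map induced by a group homomorphism on the largest elementary abelian quotients. -/
def map (f : H →* H') : ElementaryAbelianQuotient p H →ₗ[ZMod p] ElementaryAbelianQuotient p H' :=
  ModN.liftEquiv'.symm ⟨(ModN.mkQ p).comp (Abelianization.map f).toAdditive,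
    fun _ => ZModModule.char_nsmul_eq_zero p _⟩

theorem nontrivial [Fact p.Prime] [Finite H] [Nontrivial H] (hp : IsPGroup p H) :
    Nontrivial (ElementaryAbelianQuotient p H) := by
  have := hp.isNilpotent
  have hab : Nontrivial (Abelianization H) := QuotientGroup.nontrivial_iff.mpr
    (Group.IsSolvable.commutator_lt_top_of_nontrivial H).ne
  refine Submodule.Quotient.nontrivial_iff.mpr ?_
  intro htop
  have hinj : Function.Injective fun x : Abelianization H => x ^ p :=
    Finite.injective_iff_surjective.mpr fun x => by
      obtain ⟨y, hy⟩ := LinearMap.range_eq_top.mp htop (.ofMul x)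
      refine ⟨y.toMul, Additive.ofMul.injective ?_⟩
      rw [← hy, LinearMap.lsmul_apply, natCast_zsmul]
      rfl
  obtain ⟨x, hx⟩ := exists_ne (1 : Abelianization H)
  obtain ⟨k, hk⟩ := hp.of_surjective (Abelianization.of) QuotientGroup.mk_surjective x
  refine hx (hinj.iterate k ?_)
  rw [pow_iterate]
  beta_reduce
  rw [hk, one_pow]

end ElementaryAbelianQuotient

variable {p : ℕ} {G : Type*} [Group G] {N W : Subgroup G} [N.Normal]

variable (p N W) in
/-- The quotient map from `W` to the largest elementary abelian quotient of `W / N`. -/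
def elementaryAbelianMk : Additive W →+ ElementaryAbelianQuotient p (W ⧸ N.subgroupOf W) :=
  (ElementaryAbelianQuotient.mk p).comp (QuotientGroup.mk' (N.subgroupOf W)).toAdditive

theorem elementaryAbelianMk_apply (w : W) : elementaryAbelianMk p N W (.ofMul w) =
    ElementaryAbelianQuotient.mk p (.ofMul (w : W ⧸ N.subgroupOf W)) := rfl

theorem elementaryAbelianMk_surjective : Function.Surjective (elementaryAbelianMk p N W) := by
  intro x
  obtain ⟨y, rfl⟩ := ElementaryAbelianQuotient.mk_surjective p x
  obtain ⟨y, rfl⟩ := Additive.ofMul.surjective y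
  obtain ⟨w, rfl⟩ := QuotientGroup.mk_surjective y
  exact ⟨.ofMul w, elementaryAbelianMk_apply w⟩

theorem elementaryAbelianMk_eq_of_inv_mul_mem {w w' : W} (h : (w⁻¹ * w' : G) ∈ N) :
    elementaryAbelianMk p N W (.ofMul w) = elementaryAbelianMk p N W (.ofMul w') := by
  have hww' : (w : W ⧸ N.subgroupOf W) = w' := QuotientGroup.eq.mpr h
  rw [elementaryAbelianMk_apply, elementaryAbelianMk_apply, hww']

variable [W.Normal]

variable (N W) in
theorem conjNormal_mem_subgroupOf (g : G) :
    N.subgroupOf W ≤ (N.subgroupOf W).comap (MulAut.conjNormal (H := W) g).toMonoidHom := by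
  intro w hw
  rw [Subgroup.mem_subgroupOf] at hw
  exact (inferInstance : N.Normal).conj_mem _ hw g

variable (p N W) in
theorem exists_conjugation_representation :
    ∃ ρ : Representation (ZMod p) G (ElementaryAbelianQuotient p (W ⧸ N.subgroupOf W)),
      ∀ g w, elementaryAbelianMk p N W (.ofMul (MulAut.conjNormal g w)) =
        ρ g (elementaryAbelianMk p N W (.ofMul w)) := by
  let φ (g : G) : ElementaryAbelianQuotient p (W ⧸ N.subgroupOf W) →ₗ[ZMod p] _ :=
    ElementaryAbelianQuotient.map p (QuotientGroup.map _ _ _ (conjNormal_mem_subgroupOf N W g))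
  have hφ (g : G) (w : Additive W) : φ g (elementaryAbelianMk p N W w) =
      elementaryAbelianMk p N W (.ofMul (MulAut.conjNormal g w.toMul)) := rfl
  refine ⟨⟨⟨φ, ?_⟩, fun g h => ?_⟩, fun g w => (hφ g (.ofMul w)).symm⟩ <;>
    refine LinearMap.ext (elementaryAbelianMk_surjective.forall.mpr fun w => ?_)
  · rw [hφ, map_one, MulAut.one_apply, ofMul_toMul, Module.End.one_apply]
  · rw [Module.End.mul_apply, hφ, hφ, hφ, toMul_ofMul, map_mul, MulAut.mul_apply]

theorem exists_subgroup_index_prime_pow [Fact p.Prime] [N.FiniteIndex] (hNW : N < W)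
    (hp : ∀ w ∈ W, ∃ k : ℕ, w ^ p ^ k ∈ N) {Λ : Type*} [Field Λ] [IsAlgClosed Λ] [CharP Λ p]
    [MulSemiringAction G Λ] (hWN : ∀ w ∈ W, ∃ j ∈ W, (∀ x : Λ, j • x = x) ∧ j⁻¹ * w ∈ N)
    [Fintype (G ⧸ W)] {E : G ⧸ W → Λ} (hE : ∀ (g : G) q, g • E q = E (g • q))
    (hE1 : ∑ q, E q = 1) :
    ∃ (X : Subgroup G) (n : ℕ), X.index = p ^ (n + 1) ∧
      ∃ S : Finset Λ, ∀ g ∈ N, (∀ s ∈ S, g • s = s) → g ∈ X := by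
  let _ : Algebra (ZMod p) Λ := ZMod.algebra Λ p
  have : SMulCommClass G (ZMod p) Λ :=
    ⟨fun g a x => ZMod.map_smul (DistribSMul.toAddMonoidHom Λ g) a x⟩
  obtain ⟨ρ, hρ⟩ := exists_conjugation_representation p N W
  obtain ⟨c, hc, S, hS⟩ :=
    exists_crossedHom_eq_on_subgroup hE hE1 elementaryAbelianMk_surjective hρ
  have hcsurj : Function.Surjective c := by
    intro x
    obtain ⟨w, rfl⟩ := elementaryAbelianMk_surjective x
    obtain ⟨j, hjW, hj, hjw⟩ := hWN w.toMul w.toMul.2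
    exact ⟨j, (hS ⟨j, hjW⟩ fun s _ => hj s).trans (elementaryAbelianMk_eq_of_inv_mul_mem hjw)⟩
  obtain ⟨X, hX, hXc⟩ := exists_subgroup_index_eq_of_crossedHom_surjective hc hcsurj
  have hnontrivial : Nontrivial (W ⧸ N.subgroupOf W) :=
    QuotientGroup.nontrivial_iff.mpr fun h => hNW.not_ge (Subgroup.subgroupOf_eq_top.mp h)
  have hpgroup : IsPGroup p (W ⧸ N.subgroupOf W) := fun x => by
    obtain ⟨w, rfl⟩ := QuotientGroup.mk_surjective x
    exact (hp w w.2).imp fun k hk => (QuotientGroup.eq_one_iff (w ^ p ^ k)).mpr hk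
  have := ElementaryAbelianQuotient.nontrivial p hpgroup
  have hfinite : Finite (ElementaryAbelianQuotient p (W ⧸ N.subgroupOf W)) := inferInstance
  have hrank := Module.finrank_pos (R := ZMod p)
    (M := ElementaryAbelianQuotient p (W ⧸ N.subgroupOf W))
  refine ⟨X, Module.finrank (ZMod p) (ElementaryAbelianQuotient p (W ⧸ N.subgroupOf W)) - 1, ?_,
    S, fun g hg hgS => (hXc g).mpr ?_⟩
  · rw [hX, Nat.sub_add_cancel hrank, Module.natCard_eq_pow_finrank (K := ZMod p), Nat.card_zmod]
  · have h1 : elementaryAbelianMk p N W (.ofMul ⟨g, hNW.le hg⟩) =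
        elementaryAbelianMk p N W (.ofMul 1) :=
      elementaryAbelianMk_eq_of_inv_mul_mem (by
        rw [Subgroup.coe_one, mul_one]
        exact inv_mem hg)
    exact (hS ⟨g, hNW.le hg⟩ hgS).trans (h1.trans (map_zero _))

end ElementaryAbelianQuotient

/-! ### Approximation in rank one -/

section RankOne

variable {K Ω : Type*} [Field K] [Field Ω] [Algebra K Ω] {O : ValuationSubring Ω}

/-- The valuation ring `O` has rank at most one: its value group is archimedean. -/
def IsRankLeOne (O : ValuationSubring Ω) : Prop :=
  ∀ x c : Ω, O.valuation x < 1 → c ≠ 0 → ∃ n : ℕ, O.valuation x ^ n ≤ O.valuation c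

theorem valuation_one_sub_pow_le {x : Ω} (hx : x ∈ O) (n : ℕ) :
    O.valuation (1 - x ^ n) ≤ O.valuation (1 - x) := by
  obtain ⟨y, hy⟩ : 1 - (⟨x, hx⟩ : O) ∣ 1 - ⟨x, hx⟩ ^ n := by
    simpa only [one_pow] using sub_dvd_pow_sub_pow (1 : O) ⟨x, hx⟩ n
  have hy' : 1 - x ^ n = (1 - x) * y := congrArg Subtype.val hy
  rw [hy', map_mul]
  exact mul_le_of_le_one_right' ((O.valuation_le_one_iff _).mpr y.2)

theorem exists_valuation_apply_le_of_isRankLeOne [IsGalois K Ω] (hR : IsRankLeOne O)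
    {Y : IntermediateField K Ω} [FiniteDimensional K Y]
    (hY : Y ≤ IntermediateField.fixedField (O.decompositionSubgroup K)) {d : Ω} (hd : d ≠ 0) :
    ∃ u : Y, O.valuation (1 - (u : Ω)) ≤ O.valuation d ∧
      ∀ f : Y →ₐ[K] Ω, f ≠ Y.val → O.valuation (f u) ≤ O.valuation d := by
  obtain ⟨e, heY, he, he1, hτ⟩ := exists_congr_one_of_le_fixedField_decomposition hY
  have hlt (f : Y →ₐ[K] Ω) (hf : f ≠ Y.val) : O.valuation (f ⟨e, heY⟩) < 1 := by
    let τ : Gal(Ω/K) := AlgEquiv.ofBijective (f.liftNormal Ω) (AlgHom.normal_bijective K Ω Ω _)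
    have hτf (y : Y) : τ y = f y := f.liftNormal_commutes Ω y
    rw [← hτf]
    exact hτ τ fun hfix => hf (AlgHom.ext fun y => (hτf y).symm.trans
      ((IntermediateField.mem_fixingSubgroup_iff _ _).mp hfix y y.2))
  have hex (f : Y →ₐ[K] Ω) :
      ∃ n : ℕ, f ≠ Y.val → O.valuation (f ⟨e, heY⟩) ^ n ≤ O.valuation d := by
    by_cases hf : f = Y.val
    · exact ⟨0, fun h => absurd hf h⟩
    · exact (hR _ _ (hlt f hf) hd).imp fun n hn _ => hn
  choose n hn using hex
  let n₁ := Finset.univ.sup n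
  have hn₁ (f : Y →ₐ[K] Ω) (hf : f ≠ Y.val) : O.valuation (f ⟨e, heY⟩ ^ n₁) ≤ O.valuation d := by
    rw [map_pow]
    exact (pow_le_pow_right_of_le_one' (hlt f hf).le (Finset.le_sup (Finset.mem_univ f))).trans
      (hn f hf)
  have he₁ : O.valuation (1 - e ^ n₁) < 1 :=
    (valuation_one_sub_pow_le (mem_of_isIntegral he) n₁).trans_lt
      (by rwa [Valuation.map_sub_swap])
  obtain ⟨n₂, hn₂⟩ := hR _ _ he₁ hd
  refine ⟨1 - (1 - ⟨e, heY⟩ ^ n₁) ^ n₂, ?_, fun f hf => ?_⟩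
  · have hval : (1 : Ω) - ((1 - (1 - ⟨e, heY⟩ ^ n₁) ^ n₂ : Y) : Ω) = (1 - e ^ n₁) ^ n₂ :=
      sub_sub_cancel _ _
    rw [hval, map_pow]
    exact hn₂
  · have hfe : f ⟨e, heY⟩ ^ n₁ ∈ O :=
      pow_mem ((O.valuation_le_one_iff _).mp (hlt f hf).le) n₁
    have hval : f (1 - (1 - ⟨e, heY⟩ ^ n₁) ^ n₂) = 1 - (1 - f ⟨e, heY⟩ ^ n₁) ^ n₂ := by
      simp only [map_sub, map_one, map_pow]
    rw [hval]
    refine (valuation_one_sub_pow_le (sub_mem O.one_mem hfe) n₂).trans ?_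
    rw [sub_sub_cancel]
    exact hn₁ f hf

theorem exists_valuation_sub_algebraMap_le [IsGalois K Ω] [IsAlgClosed Ω] (hR : IsRankLeOne O)
    {z : Ω} (hz : z ∈ IntermediateField.fixedField (O.decompositionSubgroup K)) {c : Ω}
    (hc : c ≠ 0) : ∃ a : K, O.valuation (z - algebraMap K Ω a) ≤ O.valuation c := by
  classical
  obtain rfl | hz0 := eq_or_ne z 0
  · exact ⟨0, by rw [map_zero, sub_zero, map_zero]; exact zero_le⟩
  let Y := IntermediateField.adjoin K {z}
  have : FiniteDimensional K Y :=
    IntermediateField.adjoin.finiteDimensional (Algebra.IsIntegral.isIntegral z)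
  have hY : Y ≤ IntermediateField.fixedField (O.decompositionSubgroup K) := by
    rwa [IntermediateField.adjoin_le_iff, Set.singleton_subset_iff]
  let zY : Y := ⟨z, IntermediateField.mem_adjoin_simple_self K z⟩
  obtain ⟨f₀, -, hf₀⟩ := Finset.exists_max_image (Finset.univ : Finset (Y →ₐ[K] Ω))
    (fun f => O.valuation (f zY)) ⟨Y.val, Finset.mem_univ _⟩
  have hf₀z : f₀ zY ≠ 0 := (map_ne_zero f₀).mpr fun h => hz0 (congrArg Subtype.val h)
  have hdz (f : Y →ₐ[K] Ω) : O.valuation (c / f₀ zY) * O.valuation (f zY) ≤ O.valuation c :=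
    calc O.valuation (c / f₀ zY) * O.valuation (f zY)
        ≤ O.valuation (c / f₀ zY) * O.valuation (f₀ zY) :=
          mul_le_mul_right (hf₀ f (Finset.mem_univ f)) _
      _ = O.valuation c := by rw [← map_mul, div_mul_cancel₀ _ hf₀z]
  obtain ⟨u, hu, hfu⟩ := exists_valuation_apply_le_of_isRankLeOne hR hY (div_ne_zero hc hf₀z)
  -- The conjugates of `u * z` other than `u * z` itself contribute little to its trace.
  refine ⟨Algebra.trace K Y (u * zY), ?_⟩
  rw [trace_eq_sum_embeddings Ω, ← Finset.add_sum_erase _ _ (Finset.mem_univ Y.val), ← sub_sub]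
  refine (O.valuation.map_sub _ _).trans (max_le ?_ ?_)
  · have hval : z - Y.val (u * zY) = (1 - (u : Ω)) * z := (one_sub_mul _ _).symm
    rw [hval, map_mul]
    exact (mul_le_mul_left hu _).trans (hdz Y.val)
  · refine O.valuation.map_sum_le fun f hf => ?_
    rw [map_mul, map_mul]
    exact (mul_le_mul_left (hfu f (Finset.mem_erase.mp hf).1) _).trans (hdz f)

theorem exists_monic_valuation_aeval_sub_le [IsGalois K Ω] [IsAlgClosed Ω] (hR : IsRankLeOne O)
    {f : Polynomial Ω} (hf : f.Monic)
    (hcoeff : ∀ i, f.coeff i ∈ IntermediateField.fixedField (O.decompositionSubgroup K))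
    (r : Ω) {c : Ω} (hc : c ≠ 0) :
    ∃ g : K[X], g.Monic ∧ g.natDegree = f.natDegree ∧
      O.valuation (Polynomial.aeval r g - f.eval r) ≤ O.valuation c := by
  let n := f.natDegree
  obtain ⟨y, hy0, hy1, hyr⟩ : ∃ y : Ω, y ≠ 0 ∧ 1 ≤ O.valuation y ∧
      O.valuation r ≤ O.valuation y := by
    rcases le_total (O.valuation r) 1 with h | h
    · exact ⟨1, one_ne_zero, (map_one _).ge, h.trans (map_one _).ge⟩
    · exact ⟨r, (O.valuation.ne_zero_iff).mp (zero_lt_one.trans_le h).ne', h, le_rfl⟩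
  choose a ha using fun i =>
    exists_valuation_sub_algebraMap_le hR (hcoeff i) (div_ne_zero hc (pow_ne_zero n hy0))
  let h : K[X] := ∑ i ∈ Finset.range n, Polynomial.C (a i) * Polynomial.X ^ i
  have hdeg : h.degree < n := by
    refine (Polynomial.degree_sum_le _ _).trans_lt ?_
    refine (Finset.sup_lt_iff (WithBot.bot_lt_coe n)).mpr fun i hi => ?_
    exact (Polynomial.degree_C_mul_X_pow_le i (a i)).trans_lt
      (Nat.cast_lt.mpr (Finset.mem_range.mp hi))
  refine ⟨Polynomial.X ^ n + h, Polynomial.monic_X_pow_add hdeg, ?_, ?_⟩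
  · rw [Polynomial.natDegree_add_eq_left_of_degree_lt (by rwa [Polynomial.degree_X_pow]),
      Polynomial.natDegree_X_pow]
  · have hfr : f.eval r = r ^ n + ∑ i ∈ Finset.range n, f.coeff i * r ^ i := by
      conv_lhs => rw [hf.as_sum]
      simp only [Polynomial.eval_add, Polynomial.eval_finsetSum, Polynomial.eval_mul,
        Polynomial.eval_pow, Polynomial.eval_X, Polynomial.eval_C, n]
    have hsum : Polynomial.aeval r (Polynomial.X ^ n + h) - f.eval r =
        -∑ i ∈ Finset.range n, (f.coeff i - algebraMap K Ω (a i)) * r ^ i := by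
      simp only [hfr, h, map_add, map_sum, map_mul, map_pow, Polynomial.aeval_X,
        Polynomial.aeval_C, sub_mul, Finset.sum_sub_distrib]
      ring
    rw [hsum, Valuation.map_neg]
    refine O.valuation.map_sum_le fun i hi => ?_
    rw [map_mul, map_pow]
    calc O.valuation (f.coeff i - algebraMap K Ω (a i)) * O.valuation r ^ i
        ≤ O.valuation (c / y ^ n) * O.valuation y ^ n :=
          mul_le_mul' (ha i) ((pow_le_pow_left' hyr i).trans
            (pow_le_pow_right' hy1 (Finset.mem_range.mp hi).le))
      _ = O.valuation c := by
          rw [← map_pow, ← map_mul, div_mul_cancel₀ _ (pow_ne_zero n hy0)]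

theorem exists_ne_zero_valuation_le_sub (R : Finset Ω) :
    ∃ d : Ω, d ≠ 0 ∧ ∀ r ∈ R, ∀ s ∈ R, r ≠ s → O.valuation d ≤ O.valuation (r - s) := by
  classical
  rcases R.offDiag.eq_empty_or_nonempty with h | h
  · refine ⟨1, one_ne_zero, fun r hr s hs hrs => ?_⟩
    exact absurd (Finset.mem_offDiag.mpr ⟨hr, hs, hrs⟩) (h ▸ Finset.notMem_empty (r, s))
  · obtain ⟨⟨r, s⟩, hrs, hmin⟩ :=
      Finset.exists_min_image R.offDiag (fun q => O.valuation (q.1 - q.2)) h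
    exact ⟨r - s, sub_ne_zero.mpr (Finset.mem_offDiag.mp hrs).2.2, fun a ha b hb hab =>
      hmin (a, b) (Finset.mem_offDiag.mpr ⟨ha, hb, hab⟩)⟩

theorem exists_isRoot_valuation_sub_lt [IsAlgClosed Ω] {g : K[X]} (hg : g.Monic) {r : Ω}
    {γ : O.ValueGroup} (h : O.valuation (Polynomial.aeval r g) < γ ^ g.natDegree) :
    ∃ β : Ω, Polynomial.aeval β g = 0 ∧ O.valuation (r - β) < γ := by
  have hsplits : (g.map (algebraMap K Ω)).Splits := IsAlgClosed.splits _
  by_contra! hcon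
  refine h.not_ge ?_
  rw [Polynomial.aeval_def, ← Polynomial.eval_map,
    hsplits.eval_eq_prod_roots_of_monic (hg.map _), map_multiset_prod, Multiset.map_map,
    ← hg.natDegree_map (algebraMap K Ω), hsplits.natDegree_eq_card_roots,
    ← Multiset.card_map (O.valuation ∘ (r - ·))]
  refine Multiset.pow_card_le_prod fun x hx => ?_
  obtain ⟨β, hβ, rfl⟩ := Multiset.mem_map.mp hx
  refine hcon β ?_
  rw [← Polynomial.eval_map_algebraMap]
  exact (Polynomial.mem_roots (hg.map _).ne_zero).mp hβ

section Orbit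

variable [Algebra.IsAlgebraic K Ω] (H : Subgroup Gal(Ω/K))

theorem orbit_subset_rootSet_minpoly (x : Ω) :
    MulAction.orbit H x ⊆ (minpoly K x).rootSet Ω := by
  rintro _ ⟨σ, rfl⟩
  rw [Polynomial.mem_rootSet_of_ne (minpoly.ne_zero (Algebra.IsIntegral.isIntegral x))]
  exact (Polynomial.aeval_algHom_apply (σ : Gal(Ω/K)).toAlgHom x _).trans
    (by rw [minpoly.aeval, map_zero])

theorem finite_orbit (x : Ω) : (MulAction.orbit H x).Finite :=
  ((minpoly K x).rootSet_finite Ω).subset (orbit_subset_rootSet_minpoly H x)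

instance finiteIndex_stabilizer (x : Ω) : (MulAction.stabilizer H x).FiniteIndex := by
  have := (finite_orbit H x).to_subtype
  have := Finite.of_equiv _ (MulAction.orbitEquivQuotientStabilizer H x)
  exact Subgroup.finiteIndex_of_finite_quotient

theorem index_stabilizer_le_natDegree_minpoly (x : Ω) :
    (MulAction.stabilizer H x).index ≤ (minpoly K x).natDegree := by
  rw [MulAction.index_stabilizer]
  exact (Set.ncard_le_ncard (orbit_subset_rootSet_minpoly H x)
    ((minpoly K x).rootSet_finite Ω)).trans (Polynomial.ncard_rootSet_le _ _)

theorem coeff_prod_X_sub_C_orbit_mem_fixedField (x : Ω) (i : ℕ) :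
    (∏ r ∈ (finite_orbit H x).toFinset, (Polynomial.X - Polynomial.C r)).coeff i ∈
      IntermediateField.fixedField H := by
  intro σ
  have hσ : σ • ∏ r ∈ (finite_orbit H x).toFinset, (Polynomial.X - Polynomial.C r) =
      ∏ r ∈ (finite_orbit H x).toFinset, (Polynomial.X - Polynomial.C r) := by
    rw [Finset.smul_prod']
    refine Finset.prod_equiv (MulAction.toPerm σ) (fun r => ?_) fun r _ => ?_
    · rw [Set.Finite.mem_toFinset, Set.Finite.mem_toFinset, MulAction.toPerm_apply,
        ← MulAction.orbit_eq_iff, ← MulAction.orbit_eq_iff, MulAction.orbit_smul]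
    · rw [smul_sub, Polynomial.smul_X, Polynomial.smul_C, MulAction.toPerm_apply]
  rw [← Polynomial.coeff_smul, hσ]

end Orbit

theorem exists_natDegree_minpoly_eq_index_stabilizer [IsGalois K Ω] [IsAlgClosed Ω]
    (hR : IsRankLeOne O) {π : Ω} (hπ0 : π ≠ 0) (hπ : O.valuation π < 1) (r : Ω) :
    ∃ β : Ω, (minpoly K β).natDegree =
      (MulAction.stabilizer (O.decompositionSubgroup K) r).index := by
  let R := (finite_orbit (O.decompositionSubgroup K) r).toFinset
  let f : Polynomial Ω := ∏ s ∈ R, (Polynomial.X - Polynomial.C s)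
  have hindex : (MulAction.stabilizer (O.decompositionSubgroup K) r).index = R.card := by
    rw [MulAction.index_stabilizer, Set.ncard_eq_toFinset_card _ (finite_orbit _ r)]
  have hrR : r ∈ R := (Set.Finite.mem_toFinset _).mpr (MulAction.mem_orbit_self r)
  have hfdeg : f.natDegree = R.card := Polynomial.natDegree_finsetProd_X_sub_C_eq_card _ _
  have hfr : f.eval r = 0 := by
    rw [Polynomial.eval_prod]
    exact Finset.prod_eq_zero hrR (by rw [Polynomial.eval_sub, Polynomial.eval_X,
      Polynomial.eval_C, sub_self])
  obtain ⟨d, hd0, hd⟩ := exists_ne_zero_valuation_le_sub (O := O) R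
  obtain ⟨g, hg, hgdeg, hgr⟩ := exists_monic_valuation_aeval_sub_le hR (f := f)
    (Polynomial.monic_prod_X_sub_C _ _) (coeff_prod_X_sub_C_orbit_mem_fixedField _ r) r
    (mul_ne_zero (pow_ne_zero R.card hd0) hπ0)
  have hlt : O.valuation (Polynomial.aeval r g) < O.valuation d ^ g.natDegree := by
    have hdn : 0 < O.valuation d ^ R.card :=
      pow_pos (zero_lt_iff.mpr ((map_ne_zero _).mpr hd0)) _
    rw [hgdeg, hfdeg]
    rw [hfr, sub_zero, map_mul, map_pow] at hgr
    exact hgr.trans_lt (mul_lt_of_lt_one_right hdn hπ)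
  obtain ⟨β, hβ, hrβ⟩ := exists_isRoot_valuation_sub_lt hg hlt
  refine ⟨β, le_antisymm ?_ ?_⟩
  · rw [hindex, ← hfdeg, ← hgdeg]
    exact Polynomial.natDegree_le_of_dvd (minpoly.dvd K β hβ) hg.ne_zero
  -- Krasner's lemma: an automorphism fixing `β` moves `r` by less than `d`.
  · refine le_trans (Subgroup.index_antitone fun σ hσ => ?_)
      (index_stabilizer_le_natDegree_minpoly (O.decompositionSubgroup K) β)
    by_contra hne
    have hσr : (σ : Gal(Ω/K)) r ∈ R :=
      (Set.Finite.mem_toFinset _).mpr (MulAction.mem_orbit r σ)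
    refine (hd _ hσr r hrR hne).not_gt ?_
    have hσβ : (σ : Gal(Ω/K)) β = β := hσ
    have h := O.valuation.map_sub_lt
      ((valuation_apply_of_mem_decomposition σ.2 (r - β)).trans_lt hrβ) hrβ
    rwa [map_sub (σ : Gal(Ω/K)), hσβ, sub_sub_sub_cancel_right] at h

end RankOne

/-! ### Wild inertia at a finite level -/

section ResidueCharacteristic

variable {Ω : Type*} [Field Ω] {O : ValuationSubring Ω} {p : ℕ} [Fact p.Prime]

theorem natCast_residueField_eq_zero_iff {n : ℕ} :
    (n : ResidueField O) = 0 ↔ O.valuation (n : Ω) < 1 := by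
  rw [← map_natCast (residue O), ← map_zero (residue O), residue_eq_residue_iff,
    ZeroMemClass.coe_zero, sub_zero]
  rfl

theorem charP_residueField (hp : O.valuation (p : Ω) < 1) : CharP (ResidueField O) p :=
  (CharP.charP_iff_prime_eq_zero Fact.out).mpr (natCast_residueField_eq_zero_iff.mpr hp)

theorem valuation_natCast_eq_one (hp : O.valuation (p : Ω) < 1) {m : ℕ} (hm : ¬ p ∣ m) :
    O.valuation (m : Ω) = 1 := by
  have := charP_residueField hp
  refine le_antisymm ((O.valuation_le_one_iff _).mpr (natCast_mem O m)) (not_lt.mp fun hlt => hm ?_)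
  exact (CharP.cast_eq_zero_iff (ResidueField O) p m).mp (natCast_residueField_eq_zero_iff.mpr hlt)

theorem valuation_div_sub_one_lt_one_iff {x y : Ω} (hy : y ≠ 0) :
    O.valuation (x / y - 1) < 1 ↔ O.valuation (x - y) < O.valuation y := by
  rw [div_sub_one hy, map_div₀, div_lt_one₀ (zero_lt_iff.mpr ((map_ne_zero _).mpr hy))]

end ResidueCharacteristic

section Wild

variable {K Ω : Type*} [Field K] [Field Ω] [Algebra K Ω] {O : ValuationSubring Ω}
  (N : IntermediateField K Ω) [Normal K N]

theorem apply_mem_of_normal (g : Gal(Ω/K)) {x : Ω} (hx : x ∈ N) : g x ∈ N :=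
  AlgEquiv.restrictNormal_commutes g N ⟨x, hx⟩ ▸ Subtype.mem _

instance normal_fixingSubgroup : N.fixingSubgroup.Normal := by
  rw [← N.restrictNormalHom_ker]
  infer_instance

instance finiteIndex_fixingSubgroup [FiniteDimensional K N] : N.fixingSubgroup.FiniteIndex := by
  rw [← N.restrictNormalHom_ker]
  infer_instance

variable (O) in
/-- The elements of the decomposition group of `O` which act trivially on the residues of the
elements of `N`. -/
def residualInertia : Subgroup (O.decompositionSubgroup K) where
  carrier := {g | ∀ x ∈ N, x ∈ O → O.valuation (g.1 x - x) < 1}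
  one_mem' := fun x _ _ => by simp
  mul_mem' := by
    intro g h hg hh x hxN hx
    simpa using O.valuation.map_add_lt (hg (h.1 x) (apply_mem_of_normal N _ hxN)
      ((mem_decomposition_iff.mp h.2 x).mpr hx)) (hh x hxN hx)
  inv_mem' := by
    intro g hg x hxN hx
    rw [← valuation_lt_one_of_mem_decomposition g.2, map_sub, Valuation.map_sub_swap]
    change O.valuation (g.1 x - g.1 (g.1.symm x)) < 1
    rw [AlgEquiv.apply_symm_apply]
    exact hg x hxN hx

variable {N}

theorem exists_inertia_of_residualInertia [IsGalois K Ω] {g : O.decompositionSubgroup K}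
    (hg : g ∈ residualInertia O N) : ∃ j : O.decompositionSubgroup K, j.1 ∈ inertia K O ∧
      j⁻¹ * g ∈ N.fixingSubgroup.subgroupOf (O.decompositionSubgroup K) := by
  obtain ⟨ρ, hρ, hρg⟩ := exists_decomposition_lift (K := N) (O := O) (g := (g.1 : Ω ≃+* Ω))
    (mem_decomposition_iff.mp g.2) (fun a ha => hg a a.2 ha)
  let ρ' : O.decompositionSubgroup K :=
    ⟨ρ.restrictScalars K, mem_decomposition_iff.mpr (mem_decomposition_iff.mp hρ)⟩
  refine ⟨g * ρ'⁻¹, ⟨Subtype.mem _, fun x hx => ?_⟩, ?_⟩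
  · have hρx := hρg _ ((mem_decomposition_iff.mp (inv_mem hρ) x).mpr hx)
    rw [Valuation.map_sub_swap] at hρx
    change O.valuation (g.1 (ρ.symm x) - ρ (ρ.symm x)) < 1 at hρx
    rwa [AlgEquiv.apply_symm_apply] at hρx
  · rw [mul_inv_rev, inv_inv, inv_mul_cancel_right]
    exact fun x => ρ.commutes x

theorem smul_residue_eq_of_mem_inertia {j : O.decompositionSubgroup K} (hj : j.1 ∈ inertia K O)
    (x : ResidueField O) : j • x = x := by
  obtain ⟨y, rfl⟩ := residue_surjective x
  rw [← ResidueField.residue_smul, residue_eq_residue_iff]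
  exact hj.2 y y.2

variable [Algebra.IsAlgebraic K Ω]

variable (O N) in
/-- The elements of the decomposition group of `O` which move every nonzero element of `N` by less
than its absolute value: the preimage of the wild inertia group of `N` over `K`. -/
def wildInertia : Subgroup (O.decompositionSubgroup K) where
  carrier := {g | ∀ x ∈ N, x ≠ 0 → O.valuation (g.1 x - x) < O.valuation x}
  one_mem' := fun x _ hx => by simpa [zero_lt_iff] using hx
  mul_mem' := by
    intro g h hg hh x hxN hx
    have hgh := hg (h.1 x) (apply_mem_of_normal N _ hxN) ((map_ne_zero _).mpr hx)
    rw [valuation_apply_of_mem_decomposition h.2] at hgh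
    simpa using O.valuation.map_add_lt hgh (hh x hxN hx)
  inv_mem' := by
    intro g hg x hxN hx
    rw [← valuation_apply_of_mem_decomposition g.2, map_sub, Valuation.map_sub_swap]
    change O.valuation (g.1 x - g.1 (g.1.symm x)) < _
    rw [AlgEquiv.apply_symm_apply]
    exact hg x hxN hx

instance normal_wildInertia : (wildInertia O N).Normal := by
  refine ⟨fun w hw g x hxN hx => ?_⟩
  have hwx := hw (g.1.symm x) (apply_mem_of_normal N _ hxN) ((map_ne_zero _).mpr hx)
  rwa [← valuation_apply_of_mem_decomposition g.2, map_sub,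
    ← valuation_apply_of_mem_decomposition g.2 (g.1.symm x), AlgEquiv.apply_symm_apply] at hwx

theorem wildInertia_le_residualInertia : wildInertia O N ≤ residualInertia O N := by
  intro g hg x hxN hx
  obtain rfl | hx0 := eq_or_ne x 0
  · rw [map_zero, sub_zero, map_zero]
    exact zero_lt_one
  · exact (hg x hxN hx0).trans_le ((O.valuation_le_one_iff x).mpr hx)

theorem fixingSubgroup_le_wildInertia :
    N.fixingSubgroup.subgroupOf (O.decompositionSubgroup K) ≤ wildInertia O N := by
  intro g hg x hxN hx
  have hgx : g.1 x = x := hg ⟨x, hxN⟩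
  rw [hgx, sub_self, map_zero]
  exact zero_lt_iff.mpr ((map_ne_zero _).mpr hx)

theorem exists_inertia_of_wildInertia [IsGalois K Ω] {w : O.decompositionSubgroup K}
    (hw : w ∈ wildInertia O N) : ∃ j ∈ wildInertia O N, (∀ x : ResidueField O, j • x = x) ∧
      j⁻¹ * w ∈ N.fixingSubgroup.subgroupOf (O.decompositionSubgroup K) := by
  obtain ⟨j, hj, hjw⟩ := exists_inertia_of_residualInertia (wildInertia_le_residualInertia hw)
  refine ⟨j, ?_, smul_residue_eq_of_mem_inertia hj, hjw⟩
  simpa using mul_mem hw (inv_mem (fixingSubgroup_le_wildInertia hjw))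

theorem valuation_apply_div_eq_one {g : Gal(Ω/K)} (hg : g ∈ O.decompositionSubgroup K) {y : Ω}
    (hy : y ≠ 0) : O.valuation (g y / y) = 1 := by
  rw [map_div₀, valuation_apply_of_mem_decomposition hg, div_self ((map_ne_zero _).mpr hy)]

theorem valuation_pow_apply_div_sub_lt {g : O.decompositionSubgroup K}
    (hg : g ∈ residualInertia O N) {y : Ω} (hyN : y ∈ N) (hy : y ≠ 0) (n : ℕ) :
    O.valuation ((g.1 ^ n) y / y - (g.1 y / y) ^ n) < 1 := by
  induction n with
  | zero => simp [hy]
  | succ n ih =>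
    have hgn := hg ((g.1 ^ n) y / y) (div_mem (apply_mem_of_normal N _ hyN) hyN)
      ((O.valuation_le_one_iff _).mp (valuation_apply_div_eq_one (pow_mem g.2 n) hy).le)
    have hsucc : (g.1 ^ (n + 1)) y / y - (g.1 y / y) ^ (n + 1) =
        (g.1 ((g.1 ^ n) y / y) - (g.1 ^ n) y / y + ((g.1 ^ n) y / y - (g.1 y / y) ^ n)) *
          (g.1 y / y) := by
      have hgy : g.1 y ≠ 0 := (map_ne_zero _).mpr hy
      rw [sub_add_sub_cancel, sub_mul, ← pow_succ, map_div₀, pow_succ', AlgEquiv.mul_apply,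
        div_mul_div_cancel₀ hgy]
    rw [hsucc, map_mul, valuation_apply_div_eq_one g.2 hy, mul_one]
    exact O.valuation.map_add_lt hgn ih

variable {p : ℕ} [Fact p.Prime]

theorem mem_wildInertia_of_pow_mem (hp : O.valuation (p : Ω) < 1)
    {g : O.decompositionSubgroup K} (hg : g ∈ residualInertia O N)
    (hgp : g ^ p ∈ wildInertia O N) : g ∈ wildInertia O N := by
  have := charP_residueField hp
  intro y hyN hy
  let z : O :=
    ⟨g.1 y / y, (O.valuation_le_one_iff _).mp (valuation_apply_div_eq_one g.2 hy).le⟩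
  have hzp : O.valuation (((z ^ p : O) : Ω) - (1 : O)) < 1 := by
    have h : O.valuation ((g.1 ^ p) y / y - 1 - ((g.1 ^ p) y / y - (g.1 y / y) ^ p)) < 1 :=
      O.valuation.map_sub_lt ((valuation_div_sub_one_lt_one_iff hy).mpr (hgp y hyN hy))
        (valuation_pow_apply_div_sub_lt hg hyN hy p)
    rwa [sub_sub_sub_cancel_left] at h
  have hz : residue O z = residue O 1 := by
    refine frobenius_inj (ResidueField O) p ?_
    rwa [frobenius_def, frobenius_def, ← map_pow, ← map_pow, one_pow, residue_eq_residue_iff]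
  exact (valuation_div_sub_one_lt_one_iff hy).mp (residue_eq_residue_iff.mp hz)

theorem apply_eq_of_pow_apply_eq_of_wildInertia (hp : O.valuation (p : Ω) < 1)
    {g : O.decompositionSubgroup K} (hg : g ∈ wildInertia O N) {m : ℕ} (hm : ¬ p ∣ m) {x : Ω}
    (hx : x ∈ N) (hgm : (g.1 ^ m) x = x) : g.1 x = x := by
  by_contra hne
  let y := g.1 x - x
  have hyN : y ∈ N := sub_mem (apply_mem_of_normal N _ hx) hx
  have hy : y ≠ 0 := sub_ne_zero.mpr hne
  have hsum : ∑ i ∈ Finset.range m, (g.1 ^ i) y = 0 := by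
    have hstep (i : ℕ) : (g.1 ^ i) y = (g.1 ^ (i + 1)) x - (g.1 ^ i) x := by
      rw [map_sub, pow_succ, AlgEquiv.mul_apply]
    simp only [hstep, Finset.sum_range_sub (fun i => (g.1 ^ i) x), hgm, pow_zero,
      AlgEquiv.one_apply, sub_self]
  have hsub : ∑ i ∈ Finset.range m, ((g.1 ^ i) y - y) = -(m * y) := by
    rw [Finset.sum_sub_distrib, hsum, Finset.sum_const, Finset.card_range, nsmul_eq_mul, zero_sub]
  have hlt : O.valuation (∑ i ∈ Finset.range m, ((g.1 ^ i) y - y)) < O.valuation y :=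
    O.valuation.map_sum_lt ((map_ne_zero _).mpr hy) fun i _ => pow_mem hg i y hyN hy
  rw [hsub, Valuation.map_neg, map_mul, valuation_natCast_eq_one hp hm, one_mul] at hlt
  exact hlt.false

theorem exists_pow_mem_fixingSubgroup_of_wildInertia [FiniteDimensional K N]
    (hp : O.valuation (p : Ω) < 1) {w : O.decompositionSubgroup K} (hw : w ∈ wildInertia O N) :
    ∃ k : ℕ, w ^ p ^ k ∈ N.fixingSubgroup.subgroupOf (O.decompositionSubgroup K) := by
  obtain ⟨n, hn, -, hwn⟩ := Subgroup.exists_pow_mem_of_index_ne_zero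
    (H := N.fixingSubgroup.subgroupOf (O.decompositionSubgroup K))
    Subgroup.FiniteIndex.index_ne_zero w
  obtain ⟨k, m, hm, rfl⟩ := Nat.exists_eq_pow_mul_and_not_dvd hn.ne' p
    (Fact.out (p := p.Prime)).ne_one
  refine ⟨k, fun x => apply_eq_of_pow_apply_eq_of_wildInertia hp (pow_mem hw _) hm x.2 ?_⟩
  rw [pow_mul] at hwn
  exact hwn x

end Wild

section ResidueHom

variable {K Ω : Type*} [Field K] [Field Ω] [Algebra K Ω] {O : ValuationSubring Ω}
  (N : IntermediateField K Ω)

/-- The ring homomorphism to the residue field of `O` sending an element `x` of `N` in `O` to the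
residue of `g x`. -/
def residueHom (g : O.decompositionSubgroup K) : O.comap (algebraMap N Ω) →+* ResidueField O :=
  (MulSemiringAction.toRingHom _ (ResidueField O) g).comp
    ((residue O).comp (algebraMap (O.comap (algebraMap N Ω)) O))

theorem smul_residueHom (g h : O.decompositionSubgroup K) (x : O.comap (algebraMap N Ω)) :
    g • residueHom N h x = residueHom N (g * h) x :=
  smul_smul g h (residue O (algebraMap _ O x))

variable {N} [Normal K N]

theorem residueHom_eq_residueHom_iff {g h : O.decompositionSubgroup K} :
    residueHom N g = residueHom N h ↔ g⁻¹ * h ∈ residualInertia O N := by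
  have hiff (x : O.comap (algebraMap N Ω)) : residueHom N g x = residueHom N h x ↔
      O.valuation ((g⁻¹ * h).1 x - x) < 1 := by
    rw [← smul_left_cancel_iff g⁻¹, smul_residueHom, smul_residueHom, inv_mul_cancel, eq_comm]
    exact residue_eq_residue_iff
  refine ⟨fun hgh x hxN hx => (hiff ⟨⟨x, hxN⟩, hx⟩).mp (congrArg (· ⟨⟨x, hxN⟩, hx⟩) hgh),
    fun hgh => RingHom.ext fun x => (hiff x).mpr (hgh x x.1.2 x.2)⟩

variable [Algebra.IsAlgebraic K Ω]

variable (O N) in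
/-- The homomorphism `residueHom N g`, which depends only on the class of `g` modulo wild
inertia. -/
def cosetResidueHom (q : O.decompositionSubgroup K ⧸ wildInertia O N) :
    O.comap (algebraMap N Ω) →+* ResidueField O :=
  Quotient.liftOn' q (residueHom N) fun _ _ h => residueHom_eq_residueHom_iff.mpr
    (wildInertia_le_residualInertia (QuotientGroup.leftRel_apply.mp h))

theorem smul_cosetResidueHom (g : O.decompositionSubgroup K)
    (q : O.decompositionSubgroup K ⧸ wildInertia O N) (x : O.comap (algebraMap N Ω)) :
    g • cosetResidueHom O N q x = cosetResidueHom O N (g • q) x := by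
  induction q using QuotientGroup.induction_on with
  | H h => exact smul_residueHom N g h x

theorem natCast_card_fiber_eq_zero_of_sum_eq_zero {ι M L : Type*} [Fintype ι] [Monoid M]
    [CommRing L] [IsDomain L] (ψ : ι → M →* L) (hψ : ∀ x, ∑ i, ψ i x = 0) (i : ι) :
    (Nat.card {j // ψ j = ψ i} : L) = 0 := by
  classical
  have hsum : ∑ f ∈ Finset.univ.image ψ,
      (({j | ψ j = f} : Finset ι).card : L) • (f : M → L) = 0 := by
    ext x
    have h := Finset.sum_comp (s := Finset.univ) (fun f : M →* L => f x) ψ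
    rw [hψ x] at h
    simpa [Finset.sum_apply] using h.symm
  rw [Nat.card_eq_fintype_card, Fintype.card_subtype]
  exact linearIndependent_iff'.mp (linearIndependent_monoidHom M L) _ _ hsum (ψ i)
    (Finset.mem_image_of_mem ψ (Finset.mem_univ i))

theorem not_dvd_card_map_mk' {G : Type*} [Group G] {W J : Subgroup G} [W.Normal] [Finite (G ⧸ W)]
    {p : ℕ} [hp : Fact p.Prime] (hJ : ∀ j ∈ J, j ^ p ∈ W → j ∈ W) :
    ¬ p ∣ Nat.card (J.map (QuotientGroup.mk' W)) := by
  intro hdvd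
  obtain ⟨x, hord⟩ := exists_prime_orderOf_dvd_card' p hdvd
  obtain ⟨j, hj, hjx⟩ := x.2
  rw [← Subgroup.orderOf_coe, ← hjx, QuotientGroup.mk'_apply] at hord
  have hjW : j ∈ W := hJ j hj ((QuotientGroup.eq_one_iff _).mp (by
    rw [QuotientGroup.mk_pow, ← hord, pow_orderOf_eq_one]))
  rw [(QuotientGroup.eq_one_iff j).mpr hjW, orderOf_one] at hord
  exact hp.out.one_lt.ne hord

variable {p : ℕ} [Fact p.Prime]

theorem exists_sum_cosetResidueHom_ne_zero (hp : O.valuation (p : Ω) < 1)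
    [Fintype (O.decompositionSubgroup K ⧸ wildInertia O N)] :
    ∃ x, ∑ q, cosetResidueHom O N q x ≠ 0 := by
  have := charP_residueField hp
  by_contra! hsum
  have hcard := natCast_card_fiber_eq_zero_of_sum_eq_zero
    (fun q => (cosetResidueHom O N q : O.comap (algebraMap N Ω) →* ResidueField O)) hsum 1
  have hfiber (q : O.decompositionSubgroup K ⧸ wildInertia O N) :
      (cosetResidueHom O N q : O.comap (algebraMap N Ω) →* ResidueField O) =
        cosetResidueHom O N 1 ↔ q ∈ (residualInertia O N).map (QuotientGroup.mk' _) := by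
    induction q using QuotientGroup.induction_on with
    | H g =>
      rw [← QuotientGroup.mk'_apply, ← Subgroup.mem_comap, QuotientGroup.comap_map_mk',
        sup_eq_right.mpr wildInertia_le_residualInertia, ← inv_mem_iff, ← mul_one g⁻¹,
        ← residueHom_eq_residueHom_iff]
      exact RingHom.coe_monoidHom_injective.eq_iff
  rw [CharP.cast_eq_zero_iff (ResidueField O) p, Nat.card_congr (Equiv.subtypeEquivRight hfiber)]
    at hcard
  exact not_dvd_card_map_mk' (fun j hj => mem_wildInertia_of_pow_mem hp hj) hcard

theorem exists_equivariant_sum_eq_one (hp : O.valuation (p : Ω) < 1)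
    [Fintype (O.decompositionSubgroup K ⧸ wildInertia O N)] :
    ∃ E : O.decompositionSubgroup K ⧸ wildInertia O N → ResidueField O,
      (∀ (g : O.decompositionSubgroup K) q, g • E q = E (g • q)) ∧ ∑ q, E q = 1 := by
  obtain ⟨x, hx⟩ := exists_sum_cosetResidueHom_ne_zero (O := O) (N := N) hp
  let S := ∑ q, cosetResidueHom O N q x
  have hS (g : O.decompositionSubgroup K) : g • S = S := by
    simp only [S, Finset.smul_sum, smul_cosetResidueHom]
    exact Fintype.sum_equiv (MulAction.toPerm g) _ _ fun q => rfl
  refine ⟨fun q => cosetResidueHom O N q x / S, fun g q => ?_, ?_⟩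
  · rw [smul_div₀', hS, smul_cosetResidueHom]
  · rw [← Finset.sum_div, div_self hx]

end ResidueHom

/-! ### Inertia in rank one -/

section PrimeTo

variable {K Ω : Type*} [Field K] [Field Ω] [Algebra K Ω] {O : ValuationSubring Ω}

variable (K O) in
/-- The pro-order of the inertia group is prime to `p`. This is encoded as: an element of `Ω` fixed
by the `p`-th power of an element of the inertia group is fixed by that element. -/
def InertiaPrimeTo (p : ℕ) : Prop :=
  ∀ σ ∈ inertia K O, ∀ x : Ω, (σ ^ p) x = x → σ x = x

variable (K Ω) in
/-- No element of `Ω` has as its degree over `K` a non-trivial power of `p`. -/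
def NoPrimePowDegree (p : ℕ) : Prop :=
  ∀ (β : Ω) (n : ℕ), (minpoly K β).natDegree = p ^ n → n = 0

theorem not_dvd_orderOf_of_forall_pow {G : Type*} [Group G] [Finite G] {p : ℕ} {g : G}
    (hg : ∀ m : ℕ, (g ^ m) ^ p = 1 → g ^ m = 1) (hp : 1 < p) : ¬ p ∣ orderOf g := by
  rintro ⟨m, hm⟩
  have hgm : g ^ m = 1 := hg m (by rw [← pow_mul, mul_comm, ← hm, pow_orderOf_eq_one])
  have hle : orderOf g ≤ m := Nat.le_of_dvd
    (Nat.pos_of_ne_zero fun h => (orderOf_pos g).ne' (by rw [hm, h, mul_zero]))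
    (orderOf_dvd_of_pow_eq_one hgm)
  have := orderOf_pos g
  nlinarith

theorem smul_eq_of_pow_smul_eq {G α : Type*} [Group G] [MulAction G α] {m n : ℕ}
    (hmn : m.Coprime n) {g : G} {x : α} (hm : g ^ m • x = x) (hn : g ^ n • x = x) : g • x = x := by
  rw [MulAction.pow_smul_eq_iff_period_dvd] at hm hn
  rw [← pow_one g, MulAction.pow_smul_eq_iff_period_dvd]
  exact (Nat.dvd_gcd hm hn).trans (Nat.coprime_iff_gcd_eq_one.mp hmn).dvd

variable {p : ℕ} [hp : Fact p.Prime]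

theorem inertiaPrimeTo_of_forall_normal [IsGalois K Ω]
    (h : ∀ σ ∈ inertia K O, ∀ N : IntermediateField K Ω, FiniteDimensional K N → Normal K N →
      σ ^ p ∈ N.fixingSubgroup → σ ∈ N.fixingSubgroup) : InertiaPrimeTo K O p := by
  intro σ hσ x hx
  let N := FiniteGaloisIntermediateField.adjoin K {x}
  let F := N.toIntermediateField.fixingSubgroup
  have hxN : x ∈ N.toIntermediateField :=
    FiniteGaloisIntermediateField.subset_adjoin K {x} (Set.mem_singleton x)
  have hdvd : ¬ p ∣ orderOf (σ : Gal(Ω/K) ⧸ F) := by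
    refine not_dvd_orderOf_of_forall_pow (fun m hm => ?_) hp.out.one_lt
    rw [← QuotientGroup.mk_pow, ← QuotientGroup.mk_pow, QuotientGroup.eq_one_iff] at hm
    rw [← QuotientGroup.mk_pow, QuotientGroup.eq_one_iff]
    exact h _ (pow_mem hσ m) _ inferInstance inferInstance hm
  have hσF : σ ^ orderOf (σ : Gal(Ω/K) ⧸ F) ∈ F := by
    rw [← QuotientGroup.eq_one_iff, QuotientGroup.mk_pow, pow_orderOf_eq_one]
  exact smul_eq_of_pow_smul_eq ((Nat.Prime.coprime_iff_not_dvd hp.out).mpr hdvd) hx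
    (hσF ⟨x, hxN⟩)

end PrimeTo

section RankOneInertia

variable {K Ω : Type*} [Field K] [Field Ω] [Algebra K Ω] {O : ValuationSubring Ω}

theorem exists_stabilizer_eq_of_isOpen [IsGalois K Ω] {Y : Subgroup Gal(Ω/K)}
    (hY : IsOpen (Y : Set Gal(Ω/K))) : ∃ θ : Ω, MulAction.stabilizer Gal(Ω/K) θ = Y := by
  let F := IntermediateField.fixedField Y
  have hF : F.fixingSubgroup = Y :=
    InfiniteGalois.fixingSubgroup_fixedField ⟨Y, Subgroup.isClosed_of_isOpen Y hY⟩
  have : FiniteDimensional K F := (InfiniteGalois.isOpen_iff_finite F).mp (by rwa [hF])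
  obtain ⟨θ, hθ⟩ := Field.exists_primitive_element K F
  have hθF : IntermediateField.adjoin K {(θ : Ω)} = F := by
    rw [← IntermediateField.lift_adjoin_simple, hθ, IntermediateField.lift_top]
  refine ⟨θ, Subgroup.ext fun σ => ?_⟩
  have hfix := IntermediateField.forall_mem_adjoin_smul_eq_self_iff K (S := {(θ : Ω)}) σ
  simp only [hθF, Set.mem_singleton_iff, forall_eq] at hfix
  rw [← hF, MulAction.mem_stabilizer_iff, ← hfix, IntermediateField.mem_fixingSubgroup_iff]
  rfl

theorem exists_isOpen_subgroupOf_eq {H : Subgroup Gal(Ω/K)} [Normal K Ω]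
    {X : Subgroup H} (hX : IsOpen (X : Set H)) :
    ∃ Y : Subgroup Gal(Ω/K), IsOpen (Y : Set Gal(Ω/K)) ∧ Y.subgroupOf H = X := by
  obtain ⟨U, hU, hUX⟩ := mem_nhds_induced _ _ _ |>.mp (hX.mem_nhds X.one_mem)
  obtain ⟨N, hNfin, hNnormal, hNU⟩ := (krullTopology_mem_nhds_one_iff_of_normal K Ω U).mp hU
  refine ⟨X.map H.subtype ⊔ N.fixingSubgroup,
    Subgroup.isOpen_mono le_sup_right N.fixingSubgroup_isOpen, Subgroup.ext fun g => ?_⟩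
  refine ⟨fun hg => ?_, fun hg => Subgroup.mem_sup_left ⟨g, hg, rfl⟩⟩
  obtain ⟨_, ⟨x, hx, rfl⟩, n, hn, hxn⟩ := Subgroup.mem_sup_of_normal_right.mp hg
  have hn' : x⁻¹ * g ∈ X := hUX (hNU (by
    have hn_eq : n = (x⁻¹ * g : H) := by
      simpa using eq_inv_mul_of_mul_eq hxn
    exact hn_eq ▸ hn))
  simpa using mul_mem hx hn'

theorem exists_stabilizer_eq [IsGalois K Ω] {H : Subgroup Gal(Ω/K)} {X : Subgroup H}
    (hX : IsOpen (X : Set H)) : ∃ θ : Ω, MulAction.stabilizer H θ = X := by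
  obtain ⟨Y, hY, hYX⟩ := exists_isOpen_subgroupOf_eq hX
  obtain ⟨θ, hθ⟩ := exists_stabilizer_eq_of_isOpen hY
  exact ⟨θ, by rw [← hYX, ← hθ]; rfl⟩

theorem isOpen_stabilizer_residueField [Algebra.IsAlgebraic K Ω] (x : ResidueField O) :
    IsOpen (MulAction.stabilizer (O.decompositionSubgroup K) x :
      Set (O.decompositionSubgroup K)) := by
  obtain ⟨y, rfl⟩ := residue_surjective x
  have hy : IsOpen (MulAction.stabilizer Gal(Ω/K) (y : Ω) : Set Gal(Ω/K)) :=
    stabilizer_isOpen_of_isIntegral (y : Ω)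
  refine Subgroup.isOpen_mono (H₁ := (MulAction.stabilizer Gal(Ω/K) (y : Ω)).subgroupOf _)
    (fun g hg => ?_) (hy.preimage continuous_subtype_val)
  rw [MulAction.mem_stabilizer_iff, ← ResidueField.residue_smul]
  exact congrArg (residue O) (Subtype.ext hg)

theorem isOpen_of_forall_mem_fixingSubgroup [Algebra.IsAlgebraic K Ω] {N : IntermediateField K Ω}
    [FiniteDimensional K N] {X : Subgroup (O.decompositionSubgroup K)}
    {S : Finset (ResidueField O)}
    (h : ∀ g ∈ N.fixingSubgroup.subgroupOf (O.decompositionSubgroup K),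
      (∀ s ∈ S, g • s = s) → g ∈ X) : IsOpen (X : Set (O.decompositionSubgroup K)) := by
  refine Subgroup.isOpen_of_mem_nhds X (g := 1) ?_
  filter_upwards [(N.fixingSubgroup_isOpen.preimage continuous_subtype_val).mem_nhds
      (one_mem (N.fixingSubgroup.subgroupOf (O.decompositionSubgroup K))),
    (Filter.eventually_all_finset S).mpr fun s _ =>
      (isOpen_stabilizer_residueField s).mem_nhds (one_mem (MulAction.stabilizer _ s))]
    with g hg hgS
  exact h g hg hgS

variable {p : ℕ} [Fact p.Prime]

theorem inertiaPrimeTo_of_isRankLeOne [IsGalois K Ω] [IsAlgClosed Ω]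
    (hp : O.valuation (p : Ω) < 1) (hR : IsRankLeOne O) (hK : NoPrimePowDegree K Ω p) :
    InertiaPrimeTo K O p := by
  refine inertiaPrimeTo_of_forall_normal fun σ hσ N hfin hnorm hσp => ?_
  by_contra hσN
  have := charP_residueField hp
  let F := N.fixingSubgroup.subgroupOf (O.decompositionSubgroup K)
  have hσW : ⟨σ, hσ.1⟩ ∈ wildInertia O N :=
    mem_wildInertia_of_pow_mem hp (fun y _ hy => hσ.2 y hy) (fixingSubgroup_le_wildInertia hσp)
  have hFW : F < wildInertia O N :=
    SetLike.lt_iff_le_and_exists.mpr ⟨fixingSubgroup_le_wildInertia, _, hσW, hσN⟩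
  have : (wildInertia O N).FiniteIndex := Subgroup.finiteIndex_of_le hFW.le
  have : Fintype (O.decompositionSubgroup K ⧸ wildInertia O N) := Fintype.ofFinite _
  obtain ⟨E, hE, hE1⟩ := exists_equivariant_sum_eq_one (O := O) (N := N) hp
  obtain ⟨X, n, hXindex, S, hS⟩ := exists_subgroup_index_prime_pow hFW
    (fun w hw => exists_pow_mem_fixingSubgroup_of_wildInertia hp hw)
    (fun w hw => exists_inertia_of_wildInertia hw) hE hE1
  obtain ⟨θ, hθ⟩ := exists_stabilizer_eq (isOpen_of_forall_mem_fixingSubgroup hS)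
  obtain ⟨x, hxN, hx⟩ : ∃ x ∈ N, σ x ≠ x := by
    by_contra! h
    exact hσN fun y => h y y.2
  have hx0 : x ≠ 0 := fun h => hx (by rw [h, map_zero])
  obtain ⟨β, hβ⟩ := exists_natDegree_minpoly_eq_index_stabilizer (K := K) hR
    (π := σ x / x - 1) (sub_ne_zero.mpr fun h => hx ((div_eq_one_iff_eq hx0).mp h))
    ((valuation_div_sub_one_lt_one_iff hx0).mpr (hσW x hxN hx0)) θ
  rw [hθ, hXindex] at hβ
  exact n.succ_ne_zero (hK β _ hβ)

end RankOneInertia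

/-! ### Tame inertia -/

section NoPrimePowDegree

variable {K Ω : Type*} [Field K] [Field Ω] [Algebra K Ω] {p : ℕ} [hp : Fact p.Prime]

theorem charZero_or_charP_of_valuation_lt_one {O : ValuationSubring Ω}
    (hpO : O.valuation (p : Ω) < 1) : CharZero Ω ∨ CharP Ω p := by
  obtain ⟨q, hq⟩ := CharP.exists Ω
  rcases CharP.char_is_prime_or_zero Ω q with hq_prime | rfl
  · by_cases hpq : p = q
    · exact .inr (hpq ▸ hq)
    · have hq_val := valuation_natCast_eq_one hpO
        fun h => hpq ((Nat.prime_dvd_prime_iff_eq hp.out hq_prime).mp h)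
      rw [CharP.cast_eq_zero, map_zero] at hq_val
      exact absurd hq_val zero_ne_one
  · exact .inl (CharP.charP_to_charZero Ω)

variable [IsAlgClosed Ω]

theorem NoPrimePowDegree.exists_pow_eq (hK : NoPrimePowDegree K Ω p) (a : K) :
    ∃ b : K, b ^ p = a := by
  by_contra! ha
  have hirr := X_pow_sub_C_irreducible_of_prime hp.out ha
  obtain ⟨β, hβ⟩ := IsAlgClosed.exists_aeval_eq_zero Ω _ hirr.degree_pos.ne'
  refine one_ne_zero (hK β 1 ?_)
  rw [← minpoly.eq_of_irreducible_of_monic hirr hβ (Polynomial.monic_X_pow_sub_C a hp.out.ne_zero),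
    Polynomial.natDegree_X_pow_sub_C, pow_one]

theorem NoPrimePowDegree.exists_pow_pow_eq (hK : NoPrimePowDegree K Ω p) (e : ℕ) (a : K) :
    ∃ b : K, b ^ p ^ e = a := by
  induction e generalizing a with
  | zero => exact ⟨a, by rw [pow_zero, pow_one]⟩
  | succ e ih =>
    obtain ⟨b, rfl⟩ := hK.exists_pow_eq a
    obtain ⟨c, rfl⟩ := ih b
    exact ⟨c, by rw [← pow_mul, pow_succ]⟩

theorem NoPrimePowDegree.perfectField [CharP K p] (hK : NoPrimePowDegree K Ω p) :
    PerfectField K := by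
  have : ExpChar K p := ExpChar.prime hp.out
  have : PerfectRing K p := PerfectRing.ofSurjective K p hK.exists_pow_eq
  exact PerfectRing.toPerfectField K p

theorem NoPrimePowDegree.isGalois [Algebra.IsAlgebraic K Ω] {O : ValuationSubring Ω}
    (hpO : O.valuation (p : Ω) < 1) (hK : NoPrimePowDegree K Ω p) : IsGalois K Ω := by
  have : PerfectField K := by
    rcases charZero_or_charP_of_valuation_lt_one hpO with _ | _
    · have := (algebraMap K Ω).charZero_iff (algebraMap K Ω).injective |>.mpr ‹_›
      infer_instance
    · have := (algebraMap K Ω).charP_iff (algebraMap K Ω).injective p |>.mpr ‹_›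
      exact hK.perfectField
  have : IsAlgClosure K Ω := ⟨inferInstance, inferInstance⟩
  have := IsAlgClosure.normal K Ω
  constructor

end NoPrimePowDegree

section Valuation

variable {R Γ₀ ι : Type*} [Ring R] [LinearOrderedCommGroupWithZero Γ₀] {v : Valuation R Γ₀}
  {s : Finset ι} {f : ι → R}

theorem exists_valuation_sum_eq (hs : s.Nonempty) (hf : Set.InjOn (fun i => v (f i)) s) :
    ∃ i ∈ s, v (∑ i ∈ s, f i) = v (f i) := by
  classical
  obtain ⟨i, hi, hmax⟩ := s.exists_max_image (fun i => v (f i)) hs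
  refine ⟨i, hi, v.map_sum_eq_of_lt hi fun j hj => ?_⟩
  rw [Finset.mem_sdiff, Finset.mem_singleton] at hj
  exact (hmax j hj.1).lt_of_ne fun heq => hj.2 (hf hj.1 hi heq)

theorem exists_ne_valuation_eq_of_sum_eq_zero (hs : s.Nonempty) (hf : ∀ i ∈ s, v (f i) ≠ 0)
    (hsum : ∑ i ∈ s, f i = 0) : ∃ i ∈ s, ∃ j ∈ s, i ≠ j ∧ v (f i) = v (f j) := by
  by_contra! hne
  obtain ⟨i, hi, hval⟩ := exists_valuation_sum_eq hs fun i hi j hj heq =>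
    by_contra fun hij => hne i hi j hj hij heq
  rw [hsum, map_zero] at hval
  exact hf i hi hval.symm

end Valuation

section TameCharacter

variable {K Ω : Type*} [Field K] [Field Ω] [Algebra K Ω] {O : ValuationSubring Ω}

theorem sum_pow_apply_apply_sub_self (σ : Gal(Ω/K)) (n : ℕ) (x : Ω) :
    ∑ i ∈ Finset.range n, (σ ^ i) (σ x - x) = (σ ^ n) x - x := by
  simp only [map_sub, ← AlgEquiv.mul_apply, ← pow_succ]
  exact Finset.sum_range_sub (fun i => (σ ^ i) x) n

variable [Algebra.IsAlgebraic K Ω]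

variable (K O) in
theorem exists_pow_valuation_eq {y : Ω} (hy : y ≠ 0) :
    ∃ k : ℕ, 0 < k ∧ ∃ b : K, O.valuation (y ^ k) = O.valuation (algebraMap K Ω b) := by
  have hint : IsIntegral K y := Algebra.IsIntegral.isIntegral y
  obtain ⟨i, hi, j, hj, hij, hval⟩ := exists_ne_valuation_eq_of_sum_eq_zero (v := O.valuation)
    (f := fun i => algebraMap K Ω ((minpoly K y).coeff i) * y ^ i)
    (Polynomial.support_nonempty.mpr (minpoly.ne_zero hint))
    (fun i hi => (map_ne_zero _).mpr (mul_ne_zero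
      ((map_ne_zero _).mpr (Polynomial.mem_support_iff.mp hi)) (pow_ne_zero i hy)))
    (by simpa only [Polynomial.aeval_def, Polynomial.eval₂_eq_sum, Polynomial.sum_def] using
      minpoly.aeval K y)
  wlog hlt : i < j generalizing i j
  · exact this j hj i hi hij.symm hval.symm (hij.lt_or_gt.resolve_left hlt)
  refine ⟨j - i, Nat.sub_pos_of_lt hlt, (minpoly K y).coeff i / (minpoly K y).coeff j, ?_⟩
  have hcoeff : O.valuation (algebraMap K Ω ((minpoly K y).coeff j)) ≠ 0 :=
    (map_ne_zero _).mpr ((map_ne_zero _).mpr (Polynomial.mem_support_iff.mp hj))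
  rw [map_div₀, map_div₀, eq_div_iff hcoeff]
  refine mul_right_cancel₀ (pow_ne_zero i ((map_ne_zero O.valuation).mpr hy)) ?_
  rw [← pow_sub_mul_pow y hlt.le] at hval
  simp only [map_mul, map_pow] at hval ⊢
  rw [hval]
  ac_rfl

/-- The character by which an element `g` of the inertia group acts on leading terms: it sends `y`
to the class of `g y / y` in the residue field. -/
def tameCharacter (g : inertia K O) : Ωˣ →* ResidueField O where
  toFun y := residue O ⟨(g : Gal(Ω/K)) y / y,
    (O.valuation_le_one_iff _).mp (valuation_apply_div_eq_one g.2.1 y.ne_zero).le⟩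
  map_one' := by
    rw [← map_one (residue O)]
    exact congrArg _ (Subtype.ext (by simp))
  map_mul' y z := by
    rw [← map_mul]
    exact congrArg _ (Subtype.ext (by simp [mul_div_mul_comm]))

theorem tameCharacter_eq_one_iff {g : inertia K O} {y : Ωˣ} :
    tameCharacter g y = 1 ↔ O.valuation ((g : Gal(Ω/K)) y / y - 1) < 1 := by
  rw [← map_one (residue O)]
  exact residue_eq_residue_iff

theorem tameCharacter_mul (g h : inertia K O) (y : Ωˣ) :
    tameCharacter (g * h) y = tameCharacter g y * tameCharacter h y := by
  let u : O := ⟨(h : Gal(Ω/K)) y / y,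
    (O.valuation_le_one_iff _).mp (valuation_apply_div_eq_one h.2.1 y.ne_zero).le⟩
  have hgu : residue O ⟨(g : Gal(Ω/K)) u, (mem_decomposition_iff.mp g.2.1 _).mpr u.2⟩ =
      tameCharacter h y :=
    residue_eq_residue_iff.mpr (g.2.2 _ u.2)
  rw [← hgu, mul_comm]
  refine (congrArg (residue O) (Subtype.ext ?_)).trans (map_mul _ _ _)
  have hgy : (g : Gal(Ω/K)) y ≠ 0 := (map_ne_zero _).mpr y.ne_zero
  change (g * h : Gal(Ω/K)) y / y =
    (g : Gal(Ω/K)) ((h : Gal(Ω/K)) y / y) * ((g : Gal(Ω/K)) y / y)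
  rw [map_div₀, div_mul_div_cancel₀ hgy, AlgEquiv.mul_apply]

theorem tameCharacter_pow (g : inertia K O) (n : ℕ) (y : Ωˣ) :
    tameCharacter (g ^ n) y = tameCharacter g y ^ n := by
  induction n with
  | zero => simp [tameCharacter_eq_one_iff]
  | succ n ih => rw [pow_succ, tameCharacter_mul, ih, pow_succ]

theorem tameCharacter_eq_one_of_valuation_eq {g : inertia K O} {y : Ωˣ} {b : K}
    (hb : O.valuation (y : Ω) = O.valuation (algebraMap K Ω b)) : tameCharacter g y = 1 := by
  have hb0 : algebraMap K Ω b ≠ 0 := by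
    rw [← map_ne_zero O.valuation, ← hb, map_ne_zero]
    exact y.ne_zero
  have hu : O.valuation (y / algebraMap K Ω b) = 1 := by
    rw [map_div₀, hb, div_self ((map_ne_zero _).mpr hb0)]
  have hgu := g.2.2 _ ((O.valuation_le_one_iff _).mp hu.le)
  rw [tameCharacter_eq_one_iff, valuation_div_sub_one_lt_one_iff y.ne_zero]
  rwa [map_div₀ (g : Gal(Ω/K)), AlgEquiv.commutes, ← sub_div, map_div₀, ← hb,
    div_lt_one₀ (zero_lt_iff.mpr ((map_ne_zero _).mpr y.ne_zero))] at hgu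

variable {p : ℕ} [hp : Fact p.Prime]

theorem exists_tameCharacter_pow_eq_one [IsAlgClosed Ω] (hK : NoPrimePowDegree K Ω p)
    (g : inertia K O) (y : Ωˣ) : ∃ m : ℕ, ¬ p ∣ m ∧ tameCharacter g y ^ m = 1 := by
  obtain ⟨k, hk, b, hb⟩ := exists_pow_valuation_eq K O y.ne_zero
  obtain ⟨e, m, hm, rfl⟩ := Nat.exists_eq_pow_mul_and_not_dvd hk.ne' p hp.out.ne_one
  obtain ⟨c, rfl⟩ := hK.exists_pow_pow_eq e b
  refine ⟨m, hm, ?_⟩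
  rw [mul_comm, pow_mul, map_pow O.valuation (_ ^ m), map_pow (algebraMap K Ω),
    map_pow O.valuation (algebraMap K Ω c)] at hb
  rw [← map_pow]
  refine tameCharacter_eq_one_of_valuation_eq (b := c) ?_
  rw [Units.val_pow_eq_pow_val]
  exact (pow_left_inj₀ zero_le zero_le (pow_ne_zero e hp.out.ne_zero)).mp hb

theorem sum_tameCharacter_pow_eq_zero {n : ℕ} {g : inertia K O} {y : Ωˣ}
    (hsum : ∑ i ∈ Finset.range n, ((g : Gal(Ω/K)) ^ i) (y : Ω) = 0) :
    ∑ i ∈ Finset.range n, tameCharacter g y ^ i = 0 := by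
  let u (i : ℕ) : O := ⟨((g : Gal(Ω/K)) ^ i) y / y, (O.valuation_le_one_iff _).mp
    (valuation_apply_div_eq_one (pow_mem g.2.1 i) y.ne_zero).le⟩
  have hu : ∑ i ∈ Finset.range n, u i = 0 := Subtype.ext <| by
    rw [AddSubmonoidClass.coe_finsetSum, ← Finset.sum_div, hsum, zero_div]
    rfl
  rw [← map_zero (residue O), ← hu, map_sum]
  exact Finset.sum_congr rfl fun i _ => (tameCharacter_pow g i y).symm

theorem inertiaPrimeTo_of_valuation_eq_one [IsAlgClosed Ω] (hpO : O.valuation (p : Ω) = 1)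
    (hK : NoPrimePowDegree K Ω p) : InertiaPrimeTo K O p := by
  intro σ hσ x hx
  by_contra hne
  let g : inertia K O := ⟨σ, hσ⟩
  let y : Ωˣ := Units.mk0 (σ x - x) (sub_ne_zero.mpr hne)
  have hpow : tameCharacter g y ^ p = 1 := by
    have hy : (σ ^ p) (σ x - x) = σ x - x := by
      rw [map_sub, ← AlgEquiv.mul_apply, ← pow_succ, pow_succ', AlgEquiv.mul_apply, hx]
    rw [← tameCharacter_pow, tameCharacter_eq_one_iff]
    change O.valuation ((σ ^ p) (σ x - x) / (σ x - x) - 1) < 1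
    rw [hy, div_self (sub_ne_zero.mpr hne), sub_self, map_zero]
    exact zero_lt_one
  obtain ⟨m, hm, hpowm⟩ := exists_tameCharacter_pow_eq_one hK g y
  have hone : tameCharacter g y = 1 := by
    simpa only [(Nat.Prime.coprime_iff_not_dvd hp.out).mpr hm, pow_one] using
      (pow_gcd_eq_one (n := m)).mpr ⟨hpow, hpowm⟩
  have hsum := sum_tameCharacter_pow_eq_zero (g := g) (y := y) (n := p) (by
    rw [show (y : Ω) = σ x - x from rfl, sum_pow_apply_apply_sub_self, hx, sub_self])
  simp only [hone, one_pow, Finset.sum_const, Finset.card_range, nsmul_one,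
    natCast_residueField_eq_zero_iff] at hsum
  exact absurd hsum hpO.not_lt

end TameCharacter

/-! ### Composite valuations -/

section Composite

variable {K Ω : Type*} [Field K] [Field Ω] [Algebra K Ω] {S T : ValuationSubring Ω}

theorem valuation_lt_one_iff_inv_notMem {x : Ω} : S.valuation x < 1 ↔ x = 0 ∨ x⁻¹ ∉ S := by
  rw [← ValuationSubring.mem_nonunits_iff, ValuationSubring.mem_nonunits_iff_or]

theorem valuation_lt_one_of_le (h : S ≤ T) {x : Ω} (hx : T.valuation x < 1) :
    S.valuation x < 1 := by
  rw [valuation_lt_one_iff_inv_notMem] at hx ⊢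
  exact hx.imp_right fun hT hS => hT (h hS)

theorem mem_decomposition_of_le [Algebra.IsAlgebraic K Ω] (h : S ≤ T) {σ : Gal(Ω/K)}
    (hσ : σ ∈ S.decompositionSubgroup K) : σ ∈ T.decompositionSubgroup K := by
  have hmem {τ : Gal(Ω/K)} (hτ : τ ∈ S.decompositionSubgroup K) {x : Ω} (hx : x ∈ T) :
      τ x ∈ T := by
    by_cases hx0 : x = 0
    · rw [hx0, map_zero]
      exact zero_mem T
    · have hunit : S.valuation (τ x / x) = 1 := by
        rw [map_div₀, valuation_apply_of_mem_decomposition hτ,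
          div_self ((map_ne_zero _).mpr hx0)]
      rw [← div_mul_cancel₀ (τ x) hx0]
      exact mul_mem (h ((S.valuation_le_one_iff _).mp hunit.le)) hx
  refine mem_decomposition_iff.mpr fun x => ⟨fun hx => ?_, hmem hσ⟩
  have hinv := hmem (inv_mem hσ) hx
  rwa [← AlgEquiv.mul_apply, inv_mul_cancel] at hinv

variable (S T) in
/-- The image of `S ∩ T` in the residue field of `T`. When `S ≤ T`, this is the valuation ring
such that `S` is the composite of `T` with it. -/
def residueSubring : ValuationSubring (ResidueField T) where
  toSubring := (S.toSubring.comap T.subtype).map (residue T)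
  mem_or_inv_mem' z := by
    obtain ⟨x, rfl⟩ := residue_surjective z
    by_cases hx : IsUnit x
    · obtain ⟨y, rfl⟩ := hx
      refine (S.mem_or_inv_mem (y : T)).imp (fun hy => ⟨y, hy, rfl⟩) fun hy => ?_
      have hy_inv : T.subtype (y⁻¹ : Tˣ) ∈ S := by
        rw [map_units_inv]
        exact hy
      exact ⟨(y⁻¹ : Tˣ), hy_inv, map_units_inv (residue T) y⟩
    · exact .inl ⟨0, zero_mem S, by rw [map_zero, (residue_eq_zero_iff x).mpr hx]⟩

theorem residue_mem_residueSubring (h : S ≤ T) {x : T} :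
    residue T x ∈ residueSubring S T ↔ (x : Ω) ∈ S := by
  refine ⟨?_, fun hx => ⟨x, hx, rfl⟩⟩
  rintro ⟨y, hy, hyx⟩
  have hlt := valuation_lt_one_of_le h (residue_eq_residue_iff.mp hyx)
  rw [← sub_sub_cancel (y : Ω) x]
  exact sub_mem (show (y : Ω) ∈ S from hy) ((S.valuation_le_one_iff _).mp hlt.le)

theorem valuation_residue_lt_one_iff (h : S ≤ T) {x : T} :
    (residueSubring S T).valuation (residue T x) < 1 ↔ S.valuation (x : Ω) < 1 := by
  by_cases hx : IsUnit x
  · obtain ⟨y, rfl⟩ := hx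
    have hy : ((y : T) : Ω)⁻¹ = (y⁻¹ : Tˣ) := (map_units_inv T.subtype y).symm
    have hy0 : ((y : T) : Ω) ≠ 0 := (y.isUnit.map T.subtype).ne_zero
    rw [valuation_lt_one_iff_inv_notMem, valuation_lt_one_iff_inv_notMem, ← map_units_inv,
      residue_mem_residueSubring h, hy, or_iff_right hy0,
      or_iff_right ((residue_ne_zero_iff_isUnit _).mpr y.isUnit)]
  · rw [(residue_eq_zero_iff x).mpr hx, map_zero]
    exact iff_of_true zero_lt_one (valuation_lt_one_of_le h ((T.valuation_lt_one_iff x).mp hx))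

/-- The valuation ring `S[t⁻¹]`. -/
def invertElement (S : ValuationSubring Ω) {t : Ω} (ht : t ∈ S) : ValuationSubring Ω :=
  ValuationSubring.ofLE S
    { carrier := {z | ∃ n : ℕ, z * t ^ n ∈ S}
      zero_mem' := ⟨0, by simp⟩
      one_mem' := ⟨0, by simp⟩
      mul_mem' := by
        rintro a b ⟨m, hm⟩ ⟨n, hn⟩
        refine ⟨m + n, ?_⟩
        rw [pow_add, mul_mul_mul_comm]
        exact mul_mem hm hn
      add_mem' := by
        rintro a b ⟨m, hm⟩ ⟨n, hn⟩
        refine ⟨m + n, ?_⟩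
        convert! add_mem (mul_mem hm (pow_mem ht n)) (mul_mem hn (pow_mem ht m)) using 1
        ring
      neg_mem' := by
        rintro a ⟨m, hm⟩
        exact ⟨m, by rw [neg_mul]; exact neg_mem hm⟩ }
    fun x hx => ⟨0, by simpa using hx⟩

theorem mem_invertElement {t : Ω} (ht : t ∈ S) {z : Ω} :
    z ∈ invertElement S ht ↔ ∃ n : ℕ, z * t ^ n ∈ S := Iff.rfl

theorem lt_invertElement {t : Ω} (ht : S.valuation t < 1) (ht0 : t ≠ 0) :
    S < invertElement S ((S.valuation_le_one_iff t).mp ht.le) := by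
  refine SetLike.lt_iff_le_and_exists.mpr ⟨fun z hz => ?_, t⁻¹, ?_, ?_⟩
  · exact (mem_invertElement _).mpr ⟨0, by rwa [pow_zero, mul_one]⟩
  · exact (mem_invertElement _).mpr ⟨1, by rw [pow_one, inv_mul_cancel₀ ht0]; exact one_mem S⟩
  · exact (valuation_lt_one_iff_inv_notMem.mp ht).resolve_left ht0

theorem isRankLeOne_residueSubring (h : S < T) (hmin : ∀ U, S < U → T ≤ U) :
    IsRankLeOne (residueSubring S T) := by
  intro x c hx hc
  obtain ⟨x, rfl⟩ := residue_surjective x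
  obtain ⟨c, rfl⟩ := residue_surjective c
  rw [valuation_residue_lt_one_iff h.le] at hx
  rw [residue_ne_zero_iff_isUnit] at hc
  obtain ⟨c, rfl⟩ := hc
  by_cases hx0 : (x : Ω) = 0
  · refine ⟨1, ?_⟩
    rw [show x = 0 from Subtype.ext hx0, map_zero, map_zero, pow_one]
    exact zero_le
  · obtain ⟨n, hn⟩ := (mem_invertElement _).mp (hmin _ (lt_invertElement hx hx0) (c⁻¹ : Tˣ).1.2)
    refine ⟨n, ?_⟩
    have hmem : residue T ((c⁻¹ : Tˣ) * x ^ n) ∈ residueSubring S T :=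
      (residue_mem_residueSubring h.le).mpr hn
    have hxn : x ^ n = c * ((c⁻¹ : Tˣ) * x ^ n) := (c.mul_inv_cancel_left _).symm
    rw [← map_pow, ← map_pow, hxn, map_mul, map_mul]
    exact mul_le_of_le_one_right' ((ValuationSubring.valuation_le_one_iff _ _).mpr hmem)

theorem NoPrimePowDegree.residueField [Algebra.IsAlgebraic K Ω] [IsAlgClosed Ω] {p : ℕ}
    (hK : NoPrimePowDegree K Ω p) :
    NoPrimePowDegree (ResidueField (S.comap (algebraMap K Ω))) (ResidueField S) p := by
  intro β n hn
  let A := S.comap (algebraMap K Ω)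
  have hβ : IsIntegral (ResidueField A) β := Algebra.IsIntegral.isIntegral β
  obtain ⟨f, hf, hf_deg, hf_monic⟩ := Polynomial.lifts_and_natDegree_eq_and_monic
    (Polynomial.mem_lifts_of_surjective (residue_surjective (R := A)) (minpoly _ β))
    (minpoly.monic hβ)
  have hf_irr : Irreducible f :=
    hf_monic.irreducible_of_irreducible_map (residue A) _ (hf ▸ minpoly.irreducible hβ)
  have hfK_irr := (hf_monic.irreducible_iff_irreducible_map_fraction_map (K := K)).mp hf_irr
  obtain ⟨γ, hγ⟩ := IsAlgClosed.exists_aeval_eq_zero Ω _ hfK_irr.degree_pos.ne'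
  refine hK γ n ?_
  rw [← minpoly.eq_of_irreducible_of_monic hfK_irr hγ (hf_monic.map _), hf_monic.natDegree_map,
    hf_deg, hn]

instance : SMulCommClass (S.decompositionSubgroup K) (ResidueField (S.comap (algebraMap K Ω)))
    (ResidueField S) where
  smul_comm σ a z := by
    obtain ⟨a, rfl⟩ := residue_surjective a
    obtain ⟨z, rfl⟩ := residue_surjective z
    have hσa : σ • algebraMap (S.comap (algebraMap K Ω)) S a = algebraMap _ _ a :=
      Subtype.ext (σ.1.commutes (a : K))
    rw [Algebra.smul_def, Algebra.smul_def, smul_mul', ResidueField.algebraMap_residue,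
      ← ResidueField.residue_smul, hσa]

theorem toAlgAut_mem_inertia (h : S ≤ T) {σ : T.decompositionSubgroup K}
    (hσ : σ.1 ∈ inertia K S) :
    MulSemiringAction.toAlgAut _ (ResidueField (T.comap (algebraMap K Ω))) (ResidueField T) σ ∈
      inertia (ResidueField (T.comap (algebraMap K Ω))) (residueSubring S T) := by
  refine ⟨mem_decomposition_iff.mpr fun z => ?_, fun z hz => ?_⟩
  · obtain ⟨x, rfl⟩ := residue_surjective z
    rw [MulSemiringAction.toAlgAut_apply, MulSemiringAction.toAlgEquiv_apply,
      ← ResidueField.residue_smul, residue_mem_residueSubring h, residue_mem_residueSubring h]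
    exact mem_decomposition_iff.mp hσ.1 x
  · obtain ⟨x, rfl⟩ := residue_surjective z
    rw [residue_mem_residueSubring h] at hz
    rw [MulSemiringAction.toAlgAut_apply, MulSemiringAction.toAlgEquiv_apply,
      ← ResidueField.residue_smul, ← map_sub, valuation_residue_lt_one_iff h]
    exact hσ.2 x hz

theorem exists_inertia_of_lt [IsGalois K Ω] [IsAlgClosed Ω] {p : ℕ} [Fact p.Prime]
    (hpS : S.valuation (p : Ω) < 1) (hK : NoPrimePowDegree K Ω p) (h : S < T)
    (hmin : ∀ U, S < U → T ≤ U) {σ : Gal(Ω/K)} (hσ : σ ∈ inertia K S)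
    {N : IntermediateField K Ω} [Normal K N] (hσp : σ ^ p ∈ N.fixingSubgroup) :
    ∃ τ ∈ inertia K T, τ⁻¹ * σ ∈ N.fixingSubgroup := by
  have hpT : (residueSubring S T).valuation (p : ResidueField T) < 1 := by
    rw [← map_natCast (residue T), valuation_residue_lt_one_iff h.le]
    exact hpS
  have hK_res := hK.residueField (S := T)
  have := hK_res.isGalois hpT
  have hprime := inertiaPrimeTo_of_isRankLeOne hpT (isRankLeOne_residueSubring h hmin) hK_res
  let σT : T.decompositionSubgroup K := ⟨σ, mem_decomposition_of_le h.le hσ.1⟩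
  have hσT : σT ∈ residualInertia T N := by
    intro x hxN hx
    have hfix := hprime _ (toAlgAut_mem_inertia (σ := σT) h.le hσ) (residue T ⟨x, hx⟩) <| by
      rw [← map_pow, MulSemiringAction.toAlgAut_apply, MulSemiringAction.toAlgEquiv_apply,
        ← ResidueField.residue_smul]
      exact congrArg _ (Subtype.ext ((N.mem_fixingSubgroup_iff _).mp hσp x hxN))
    exact residue_eq_residue_iff.mp hfix
  obtain ⟨j, hj, hjσ⟩ := exists_inertia_of_residualInertia hσT
  exact ⟨j, hj, hjσ⟩

end Composite

/-! ### Overrings and transcendence degree -/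

section Overrings

variable {Ω : Type v} [Field Ω] {S T : ValuationSubring Ω}

theorem valuation_eq_of_le (h : S ≤ T) {x y : Ω} (hxy : S.valuation x = S.valuation y) :
    T.valuation x = T.valuation y :=
  congrArg (S.mapOfLE T h) hxy

variable {k : Type v} [Field k] [Algebra k Ω] {p : ℕ}

theorem valuation_le_of_comap_le (hk : T.comap (algebraMap k Ω) ≤ S.comap (algebraMap k Ω))
    {a b : k} (hab : T.valuation (algebraMap k Ω a) ≤ T.valuation (algebraMap k Ω b)) :
    S.valuation (algebraMap k Ω a) ≤ S.valuation (algebraMap k Ω b) := by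
  by_cases hb : b = 0
  · rw [hb, map_zero, map_zero, le_zero_iff, map_eq_zero, map_eq_zero] at hab
    rw [hab, hb]
  · have hb_pos (U : ValuationSubring Ω) : 0 < U.valuation (algebraMap k Ω b) :=
      zero_lt_iff.mpr ((map_ne_zero _).mpr ((map_ne_zero _).mpr hb))
    have hmem (U : ValuationSubring Ω) : a / b ∈ U.comap (algebraMap k Ω) ↔
        U.valuation (algebraMap k Ω a) ≤ U.valuation (algebraMap k Ω b) := by
      rw [ValuationSubring.mem_comap, ← U.valuation_le_one_iff, map_div₀, map_div₀,
        div_le_one₀ (hb_pos U)]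
    exact (hmem S).mp (hk ((hmem T).mpr hab))

theorem exists_valuation_aeval_eq (hk : T.comap (algebraMap k Ω) ≤ S.comap (algebraMap k Ω))
    (h : S ≤ T) {t : Ω} (ht0 : t ≠ 0) (htS : S.valuation t < 1) (htT : T.valuation t = 1) {f : k[X]}
    (hf : f ≠ 0) : ∃ a : k, a ≠ 0 ∧
      T.valuation (Polynomial.aeval t f) = T.valuation (algebraMap k Ω a) := by
  have hterm (i : ℕ) : T.valuation (algebraMap k Ω (f.coeff i) * t ^ i) =
      T.valuation (algebraMap k Ω (f.coeff i)) := by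
    rw [map_mul, map_pow, htT, one_pow, mul_one]
  have hinj : Set.InjOn (fun i => S.valuation (algebraMap k Ω (f.coeff i) * t ^ i)) f.support := by
    intro i hi j _ hij
    have hT : T.valuation (algebraMap k Ω (f.coeff i)) =
        T.valuation (algebraMap k Ω (f.coeff j)) := by
      rw [← hterm, ← hterm, valuation_eq_of_le h hij]
    have hS := le_antisymm (valuation_le_of_comap_le hk hT.le) (valuation_le_of_comap_le hk hT.ge)
    simp only [map_mul, map_pow] at hij
    rw [← hS] at hij
    have hi0 : S.valuation (algebraMap k Ω (f.coeff i)) ≠ 0 :=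
      (map_ne_zero _).mpr ((map_ne_zero _).mpr (Polynomial.mem_support_iff.mp hi))
    exact pow_right_injective₀ (zero_lt_iff.mpr ((map_ne_zero _).mpr ht0)) htS.ne
      (mul_left_cancel₀ hi0 hij)
  obtain ⟨i, hi, hval⟩ := exists_valuation_sum_eq (Polynomial.support_nonempty.mpr hf) hinj
  refine ⟨f.coeff i, Polynomial.mem_support_iff.mp hi, ?_⟩
  rw [Polynomial.aeval_def, Polynomial.eval₂_eq_sum, Polynomial.sum_def,
    valuation_eq_of_le h hval, hterm]

/-- The valuation ring induced by `S` on `k` does not change when `S` is replaced by an overring in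
which `p` is still not a unit. -/
def NoCoarsening {Ω : Type v} [Field Ω] (p : ℕ) (S : ValuationSubring Ω) (k : Type v) [Field k]
    [Algebra k Ω] : Prop :=
  ∀ T, S ≤ T → T.valuation (p : Ω) < 1 → T.comap (algebraMap k Ω) ≤ S.comap (algebraMap k Ω)

theorem exists_noCoarsening_adjoin (hk : NoCoarsening p S k) (h : S < T)
    (hpT : T.valuation (p : Ω) < 1) : ∃ t : Ω, Transcendental k t ∧
      NoCoarsening p T (IntermediateField.adjoin k {t}) := by
  obtain ⟨x, hxT, hxS⟩ := SetLike.exists_of_lt h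
  have ht0 : x⁻¹ ≠ 0 := inv_ne_zero fun hx => hxS (hx ▸ zero_mem S)
  have htS : S.valuation x⁻¹ < 1 :=
    valuation_lt_one_iff_inv_notMem.mpr (.inr (by rwa [inv_inv]))
  have htT : T.valuation x⁻¹ = 1 := by
    refine le_antisymm ((T.valuation_le_one_iff _).mpr
      (h.le ((S.valuation_le_one_iff _).mp htS.le))) (not_lt.mp fun hlt => ?_)
    rw [valuation_lt_one_iff_inv_notMem, inv_inv] at hlt
    exact hlt.elim ht0 fun hx => hx hxT
  have haeval {f : k[X]} (hf : f ≠ 0) :=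
    exists_valuation_aeval_eq (hk T h.le hpT) h.le ht0 htS htT hf
  refine ⟨x⁻¹, transcendental_iff.mpr fun f hf => ?_, fun U hTU hpU ⟨z, hz⟩ hzU => ?_⟩
  · by_contra hf0
    obtain ⟨a, ha, hval⟩ := haeval hf0
    rw [hf, map_zero, eq_comm, map_eq_zero, map_eq_zero] at hval
    exact ha hval
  · change z ∈ U at hzU
    change z ∈ T
    obtain ⟨f, g, rfl⟩ := (IntermediateField.mem_adjoin_simple_iff k z).mp hz
    by_cases hfg : Polynomial.aeval x⁻¹ f / Polynomial.aeval x⁻¹ g = 0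
    · exact hfg ▸ zero_mem T
    · have hf : f ≠ 0 := by rintro rfl; simp at hfg
      have hg : g ≠ 0 := by rintro rfl; simp at hfg
      obtain ⟨a, -, ha⟩ := haeval hf
      obtain ⟨b, -, hb⟩ := haeval hg
      have hab : T.valuation (Polynomial.aeval x⁻¹ f / Polynomial.aeval x⁻¹ g) =
          T.valuation (algebraMap k Ω (a / b)) := by
        rw [map_div₀, ha, hb, map_div₀, map_div₀]
      rw [← ValuationSubring.valuation_le_one_iff, valuation_eq_of_le hTU hab,
        ValuationSubring.valuation_le_one_iff] at hzU
      rw [← ValuationSubring.valuation_le_one_iff, hab, ValuationSubring.valuation_le_one_iff]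
      exact h.le (hk U (h.le.trans hTU) hpU hzU)

theorem natCast_card_le_trdeg (hk : NoCoarsening p S k) (F : Finset (ValuationSubring Ω))
    (hF : ∀ U ∈ F, S < U ∧ U.valuation (p : Ω) < 1) :
    (F.card : Cardinal) ≤ Algebra.trdeg k Ω := by
  classical
  induction hn : F.card generalizing F k S with
  | zero => exact zero_le
  | succ n ih =>
    obtain ⟨U, hU, hmin⟩ := F.exists_minimal (Finset.card_pos.mp (by omega))
    obtain ⟨hSU, hpU⟩ := hF U hU
    obtain ⟨t, ht, hkt⟩ := exists_noCoarsening_adjoin hk hSU hpU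
    have hle : (n : Cardinal) ≤ Algebra.trdeg (IntermediateField.adjoin k {t}) Ω := by
      refine ih hkt (F.erase U) (fun V hV => ?_) (by rw [Finset.card_erase_of_mem hU, hn]; rfl)
      obtain ⟨hVU, hVF⟩ := Finset.mem_erase.mp hV
      have hUV : U ≤ V := (le_total (⟨U, hSU.le⟩ : {R // S ≤ R}) ⟨V, (hF V hVF).1.le⟩).elim id
        fun hle => hmin hVF hle
      exact ⟨lt_of_le_of_ne hUV hVU.symm, (hF V hVF).2⟩
    have : Algebra.Transcendental k (IntermediateField.adjoin k {t}) :=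
      ⟨IntermediateField.AdjoinSimple.gen k t, fun halg =>
        ht (by simpa using halg.algebraMap (A := Ω))⟩
    have hone : 1 ≤ Algebra.trdeg k (IntermediateField.adjoin k {t}) :=
      Cardinal.one_le_iff_pos.mpr (trdeg_pos _ _)
    rw [← trdeg_add_eq k (IntermediateField.adjoin k {t}) (A := Ω), Nat.cast_succ, add_comm]
    exact add_le_add hone hle

theorem finite_setOf_overring [FinTrdeg k Ω] (hk : NoCoarsening p S k) :
    {U | S < U ∧ U.valuation (p : Ω) < 1}.Finite := by
  by_contra hinf
  obtain ⟨n, hn⟩ := Cardinal.lt_aleph0.mp (trdeg_lt_aleph0 k Ω)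
  obtain ⟨F, hF, hcard⟩ := Set.Infinite.exists_subset_card_eq hinf (n + 1)
  have hle := natCast_card_le_trdeg hk F fun U hU => hF hU
  rw [hn, hcard, Nat.cast_le] at hle
  omega

theorem ratCast_mem_iff_not_dvd_den [CharZero Ω] [hp : Fact p.Prime]
    (hpS : S.valuation (p : Ω) < 1) (q : ℚ) : (q : Ω) ∈ S ↔ ¬ p ∣ q.den := by
  constructor
  · intro hq hden
    have hnum : ¬ p ∣ q.num.natAbs := fun hnum =>
      hp.out.ne_one (Nat.eq_one_of_dvd_coprimes q.reduced hnum hden)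
    have hden_lt : S.valuation (q.den : Ω) < 1 := by
      obtain ⟨m, hm⟩ := hden
      rw [hm, Nat.cast_mul, map_mul]
      exact mul_lt_one_of_lt_of_le hpS (S.valuation_le_one ⟨_, natCast_mem S m⟩)
    have hnum_eq : S.valuation (q.num : Ω) = 1 := by
      rw [← valuation_natCast_eq_one hpS hnum]
      rcases Int.natAbs_eq q.num with h | h
      · rw [h, Int.cast_natCast, Int.natAbs_natCast]
      · rw [h, Int.cast_neg, Valuation.map_neg, Int.cast_natCast, Int.natAbs_neg,
          Int.natAbs_natCast]
    refine ((mul_le_of_le_one_left' ((S.valuation_le_one_iff _).mpr hq)).trans_lt hden_lt).ne ?_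
    rw [← map_mul, ← hnum_eq]
    exact_mod_cast congrArg (fun r : ℚ => S.valuation (r : Ω)) q.mul_den_eq_num
  · intro hden
    rw [← S.valuation_le_one_iff, Rat.cast_def, map_div₀, valuation_natCast_eq_one hpS hden,
      div_one]
    exact S.valuation_le_one ⟨_, intCast_mem S _⟩

theorem noCoarsening_bot [hp : Fact p.Prime] (hpS : S.valuation (p : Ω) < 1) :
    NoCoarsening p S (⊥ : Subfield Ω) := by
  rintro T - hpT ⟨a, ha⟩ haT
  change a ∈ T at haT
  change a ∈ S
  rcases charZero_or_charP_of_valuation_lt_one hpS with _ | _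
  · rw [Subfield.bot_eq_of_charZero] at ha
    obtain ⟨q, rfl⟩ := ha
    exact (ratCast_mem_iff_not_dvd_den hpS q).mpr ((ratCast_mem_iff_not_dvd_den hpT q).mp haT)
  · let : Algebra (ZMod p) Ω := ZMod.algebra Ω p
    rw [Subfield.bot_eq_of_zMod_algebra p] at ha
    obtain ⟨b, rfl⟩ := ha
    rw [← ZMod.natCast_zmod_val b, map_natCast]
    exact natCast_mem S _

end Overrings

section FiniteOverrings

variable {K : Type u} {Ω : Type v} [Field K] [Field Ω] [Algebra K Ω] {O S : ValuationSubring Ω}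
  {p : ℕ}

theorem exists_minimal_overring (hfin : {U | S < U ∧ U.valuation (p : Ω) < 1}.Finite)
    (hpS : S.valuation (p : Ω) < 1) (hS : S ≠ ⊤) : ∃ T, S < T ∧ ∀ U, S < U → T ≤ U := by
  by_cases hne : {U | S < U ∧ U.valuation (p : Ω) < 1}.Nonempty
  · obtain ⟨T, ⟨hST, hpT⟩, hmin⟩ := hfin.exists_minimal hne
    refine ⟨T, hST, fun U hSU => ?_⟩
    exact (le_total (⟨T, hST.le⟩ : {R // S ≤ R}) ⟨U, hSU.le⟩).elim id fun hUT =>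
      hmin ⟨hSU, valuation_lt_one_of_le hUT hpT⟩ hUT
  · have hunit (U : ValuationSubring Ω) (hSU : S < U) : ¬ U.valuation (p : Ω) < 1 :=
      fun hlt => hne ⟨U, hSU, hlt⟩
    have hp0 : (p : Ω) ≠ 0 := fun hp0 =>
      hunit ⊤ (lt_top_iff_ne_top.mpr hS) (by rw [hp0, map_zero]; exact zero_lt_one)
    refine ⟨_, lt_invertElement hpS hp0, fun U hSU z hz => ?_⟩
    obtain ⟨n, hn⟩ := (mem_invertElement _).mp hz
    have hpU := hunit U hSU
    rw [valuation_lt_one_iff_inv_notMem, not_or, not_not] at hpU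
    have hmem := mul_mem (hSU.le hn) (pow_mem hpU.2 n)
    rwa [inv_pow, mul_inv_cancel_right₀ (pow_ne_zero n hp0)] at hmem

theorem inertia_top : inertia K (⊤ : ValuationSubring Ω) = ⊥ := by
  refine (Subgroup.eq_bot_iff_forall _).mpr fun σ hσ => AlgEquiv.ext fun x => ?_
  have hx := hσ.2 x (ValuationSubring.mem_top x)
  rw [valuation_lt_one_iff_inv_notMem] at hx
  exact sub_eq_zero.mp (hx.resolve_right fun h => h (ValuationSubring.mem_top _))

theorem pow_mem_of_inv_mul_mem {G : Type*} [Group G] {H : Subgroup G} [H.Normal] {a b : G}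
    (hab : a⁻¹ * b ∈ H) {n : ℕ} (hb : b ^ n ∈ H) : a ^ n ∈ H := by
  rw [← QuotientGroup.eq] at hab
  rw [← QuotientGroup.eq_one_iff, QuotientGroup.mk_pow] at hb ⊢
  rwa [hab]

theorem inertiaPrimeTo_of_finite [IsGalois K Ω] [IsAlgClosed Ω] [Fact p.Prime]
    (hK : NoPrimePowDegree K Ω p) (hfin : {U | O < U ∧ U.valuation (p : Ω) < 1}.Finite) :
    InertiaPrimeTo K O p := by
  refine inertiaPrimeTo_of_forall_normal fun σ hσ N _ hN hσp => ?_
  by_contra hσN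
  let bad : Set (ValuationSubring Ω) :=
    {U | O ≤ U ∧ ∃ τ ∈ inertia K U, τ⁻¹ * σ ∈ N.fixingSubgroup}
  have notMem_of_inv_mul_mem {τ : Gal(Ω/K)} (hτσ : τ⁻¹ * σ ∈ N.fixingSubgroup) :
      τ ∉ N.fixingSubgroup := fun hτN =>
    hσN (by simpa only [mul_inv_cancel_left] using mul_mem hτN hτσ)
  have valuation_lt_one_of_bad {U : ValuationSubring Ω} (hU : U ∈ bad) :
      U.valuation (p : Ω) < 1 := by
    obtain ⟨-, τ, hτ, hτσ⟩ := hU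
    refine lt_of_le_of_ne ((U.valuation_le_one_iff _).mpr (natCast_mem U p)) fun hpU =>
      notMem_of_inv_mul_mem hτσ ((N.mem_fixingSubgroup_iff _).mpr fun x hx => ?_)
    exact inertiaPrimeTo_of_valuation_eq_one hpU hK τ hτ x
      ((N.mem_fixingSubgroup_iff _).mp (pow_mem_of_inv_mul_mem hτσ hσp) x hx)
  have hbad : bad.Finite := by
    refine (hfin.union (Set.finite_singleton O)).subset fun U hU => ?_
    exact hU.1.eq_or_lt.elim (fun h => .inr h.symm) fun h => .inl ⟨h, valuation_lt_one_of_bad hU⟩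
  obtain ⟨S, hS, hmax⟩ := hbad.exists_maximal
    ⟨O, le_rfl, σ, hσ, by rw [inv_mul_cancel]; exact one_mem _⟩
  have hpS := valuation_lt_one_of_bad hS
  obtain ⟨hOS, τ, hτ, hτσ⟩ := hS
  have hS_top : S ≠ ⊤ := by
    rintro rfl
    rw [inertia_top, Subgroup.mem_bot] at hτ
    exact notMem_of_inv_mul_mem hτσ (hτ ▸ one_mem _)
  obtain ⟨T, hST, hT⟩ := exists_minimal_overring
    (hfin.subset fun U hU => ⟨hOS.trans_lt hU.1, hU.2⟩) hpS hS_top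
  obtain ⟨ρ, hρ, hρτ⟩ := exists_inertia_of_lt hpS hK hST hT hτ (pow_mem_of_inv_mul_mem hτσ hσp)
  have hρσ : ρ⁻¹ * σ ∈ N.fixingSubgroup := by
    simpa only [mul_assoc, mul_inv_cancel_left] using mul_mem hρτ hτσ
  exact hST.not_ge (hmax ⟨hOS.trans hST.le, ρ, hρ, hρσ⟩ hST.le)

end FiniteOverrings

/-! ### Descent to finite transcendence degree -/

section RelativeAlgebraicClosure

variable (F : Type*) {K Ω : Type*} [Field F] [Field K] [Field Ω] [Algebra F K] [Algebra F Ω]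
  [Algebra K Ω] [IsScalarTower F K Ω] {O : ValuationSubring Ω} {p : ℕ}

instance : Algebra (algebraicClosure F K) (algebraicClosure F Ω) :=
  ((algebraMap K Ω).restrict (algebraicClosure F K).toSubfield (algebraicClosure F Ω).toSubfield
    fun _ ha => mem_algebraicClosure_iff.mpr
      ((mem_algebraicClosure_iff.mp ha).algHom (IsScalarTower.toAlgHom F K Ω))).toAlgebra

instance : IsScalarTower F (algebraicClosure F K) (algebraicClosure F Ω) :=
  IsScalarTower.of_algebraMap_eq fun a => Subtype.ext (IsScalarTower.algebraMap_apply F K Ω a)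

instance : IsScalarTower (algebraicClosure F K) (algebraicClosure F Ω) Ω :=
  IsScalarTower.of_algebraMap_eq fun _ => rfl

instance : Algebra.IsAlgebraic (algebraicClosure F K) (algebraicClosure F Ω) :=
  Algebra.IsAlgebraic.tower_top (K := F) (algebraicClosure F K)

theorem natDegree_minpoly_algebraicClosure (β : algebraicClosure F Ω) :
    (minpoly (algebraicClosure F K) β).natDegree = (minpoly K (β : Ω)).natDegree := by
  have hβ : IsIntegral F (β : Ω) := (mem_algebraicClosure_iff.mp β.2).isIntegral
  have hlifts : minpoly K (β : Ω) ∈ Polynomial.lifts (algebraMap (algebraicClosure F K) K) := by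
    refine (Polynomial.lifts_iff_coeff_lifts _).mpr fun i => ⟨⟨_, ?_⟩, rfl⟩
    exact mem_algebraicClosure_iff'.mpr (Polynomial.isIntegral_coeff_of_dvd _ _
      (minpoly.monic hβ) (minpoly.monic hβ.tower_top)
      (minpoly.dvd_map_of_isScalarTower F K (β : Ω)) i)
  rw [← minpoly.map_algebraMap hβ.tower_top hlifts, Polynomial.natDegree_map,
    ← minpoly.algebraMap_eq (algebraMap (algebraicClosure F Ω) Ω).injective]
  rfl

theorem NoPrimePowDegree.algebraicClosure (hK : NoPrimePowDegree K Ω p) :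
    NoPrimePowDegree (algebraicClosure F K) (algebraicClosure F Ω) p := fun β n hn =>
  hK β n (natDegree_minpoly_algebraicClosure F (K := K) β ▸ hn)

/-- The restriction of automorphisms of `Ω` to the algebraic closure of `F` in `Ω`. -/
def restrictAlgebraicClosure :
    Gal(Ω/K) →* Gal(algebraicClosure F Ω/algebraicClosure F K) where
  toFun σ :=
    { algebraicClosure.algEquivOfAlgEquiv (σ.restrictScalars F) with
      commutes' := fun a => Subtype.ext (σ.commutes (a : K)) }
  map_one' := rfl
  map_mul' _ _ := rfl

theorem coe_restrictAlgebraicClosure_apply (σ : Gal(Ω/K)) (x : algebraicClosure F Ω) :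
    (restrictAlgebraicClosure F σ x : Ω) = σ x := rfl

theorem restrictAlgebraicClosure_mem_inertia {σ : Gal(Ω/K)} (hσ : σ ∈ inertia K O) :
    restrictAlgebraicClosure F σ ∈
      inertia (algebraicClosure F K) (O.comap (algebraMap (algebraicClosure F Ω) Ω)) :=
  ⟨mem_decomposition_iff.mpr fun x => mem_decomposition_iff.mp hσ.1 x, fun x hx =>
    valuation_comap_lt_one_iff.mpr (hσ.2 x hx)⟩

end RelativeAlgebraicClosure

section Descent

variable {K Ω : Type*} [Field K] [Field Ω] [Algebra K Ω] {O : ValuationSubring Ω}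

theorem finTrdeg_algebraicClosure {s : Set K} (hs : s.Finite) :
    FinTrdeg (⊥ : Subfield (algebraicClosure (Subfield.closure s) Ω))
      (algebraicClosure (Subfield.closure s) Ω) := by
  have := hs.to_subtype
  let F := Subfield.closure s
  let Ω' := algebraicClosure F Ω
  let generator : s → Ω' := fun a => algebraMap F Ω' ⟨a, Subfield.subset_closure a.2⟩
  let E := IntermediateField.adjoin (⊥ : Subfield Ω') (Set.range generator)
  refine ⟨E, IntermediateField.fg_adjoin_of_finite (Set.finite_range generator), ?_⟩
  have hle : F ≤ (E.toSubfield.map (algebraMap Ω' Ω)).comap (algebraMap K Ω) := by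
    rw [Subfield.closure_le]
    intro a ha
    exact ⟨generator ⟨a, ha⟩, IntermediateField.subset_adjoin _ _ ⟨⟨a, ha⟩, rfl⟩, rfl⟩
  have hmem (a : F) : algebraMap F Ω' a ∈ E := by
    obtain ⟨e, he, hea⟩ := hle a.2
    rwa [← show e = algebraMap F Ω' a from Subtype.ext hea]
  let : Algebra F E := ((algebraMap F Ω').codRestrict E.toSubfield hmem).toAlgebra
  have : IsScalarTower F E Ω' := IsScalarTower.of_algebraMap_eq fun _ => rfl
  exact Algebra.IsAlgebraic.tower_top (K := F) E

theorem exists_finite_mem_algebraicClosure {x : Ω} (hx : IsAlgebraic K x) :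
    ∃ s : Set K, s.Finite ∧ x ∈ algebraicClosure (Subfield.closure s) Ω := by
  obtain ⟨f, hf, hfx⟩ := hx
  refine ⟨f.coeffs, f.coeffs.finite_toSet, ?_⟩
  obtain ⟨g, hg⟩ : f ∈ Polynomial.lifts (algebraMap (Subfield.closure (f.coeffs : Set K)) K) :=
    (Polynomial.lifts_iff_coeffs_subset_range _).mpr fun a ha =>
      ⟨⟨a, Subfield.subset_closure ha⟩, rfl⟩
  refine mem_algebraicClosure_iff.mpr ⟨g, ?_, ?_⟩
  · rintro rfl
    exact hf (hg ▸ map_zero _)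
  · rwa [← Polynomial.aeval_map_algebraMap K, ← Polynomial.coe_mapRingHom, hg]

theorem inertiaPrimeTo [Algebra.IsAlgebraic K Ω] [IsAlgClosed Ω] {p : ℕ} [Fact p.Prime]
    (hpO : O.valuation (p : Ω) < 1) (hK : NoPrimePowDegree K Ω p) : InertiaPrimeTo K O p := by
  intro σ hσ x hx
  obtain ⟨s, hs, hxF⟩ := exists_finite_mem_algebraicClosure
    (Algebra.IsAlgebraic.isAlgebraic (R := K) x)
  let F := Subfield.closure s
  have : IsAlgClosed (algebraicClosure F Ω) := IsAlgClosure.isAlgClosed F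
  have hpO_comap : (O.comap (algebraMap (algebraicClosure F Ω) Ω)).valuation
      (p : algebraicClosure F Ω) < 1 := by
    rwa [valuation_comap_lt_one_iff, map_natCast]
  have hKF := hK.algebraicClosure F
  have := hKF.isGalois hpO_comap
  have := finTrdeg_algebraicClosure (Ω := Ω) hs
  have hfixed := inertiaPrimeTo_of_finite hKF (finite_setOf_overring (noCoarsening_bot hpO_comap)) _
    (restrictAlgebraicClosure_mem_inertia F hσ) ⟨x, hxF⟩
    (Subtype.ext (by rwa [← map_pow, coe_restrictAlgebraicClosure_apply]))
  exact congrArg Subtype.val hfixed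

end Descent

/-! ### Tameness over a henselian field -/

section Galois

variable {K Ω : Type*} [Field K] [Field Ω] [Algebra K Ω]

theorem linearDisjoint_of_inf_eq_bot {A B : IntermediateField K Ω} [IsGalois K A]
    [Algebra.IsAlgebraic K B] (h : A ⊓ B = ⊥) : A.LinearDisjoint B := by
  rw [IntermediateField.linearDisjoint_iff']
  have : Algebra.IsIntegral K A.toSubalgebra := inferInstanceAs (Algebra.IsIntegral K A)
  have : Algebra.IsIntegral K B.toSubalgebra := inferInstanceAs (Algebra.IsIntegral K B)
  refine Subalgebra.LinearDisjoint.of_linearDisjoint_finite fun A' B' hA' hB' _ _ => ?_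
  let A₁ : IntermediateField K Ω := Algebra.IsAlgebraic.toIntermediateField A'
  let B₁ : IntermediateField K Ω := Algebra.IsAlgebraic.toIntermediateField B'
  have hA₁ : A₁ ≤ A := hA'
  have : FiniteDimensional K A₁ := inferInstanceAs (Module.Finite K A')
  have : FiniteDimensional K B₁ := inferInstanceAs (Module.Finite K B')
  have : FiniteDimensional K (IntermediateField.restrict hA₁) :=
    Module.Finite.equiv (IntermediateField.restrictAlgEquiv hA₁).toLinearEquiv
  let C := IntermediateField.normalClosure K (IntermediateField.restrict hA₁) A
  have : IsGalois K (IntermediateField.lift C) :=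
    IsGalois.of_algEquiv (IntermediateField.liftAlgEquiv C)
  have : FiniteDimensional K (IntermediateField.lift C) :=
    Module.Finite.equiv (IntermediateField.liftAlgEquiv C).toLinearEquiv
  have hA₁C : A₁ ≤ IntermediateField.lift C := by
    rw [← IntermediateField.lift_restrict hA₁]
    exact IntermediateField.map_mono A.val (IntermediateField.le_normalClosure _)
  have hdisj : (IntermediateField.lift C).LinearDisjoint B₁ :=
    IntermediateField.LinearDisjoint.of_inf_eq_bot
      (le_bot_iff.mp ((inf_le_inf (IntermediateField.lift_le C) (show B₁ ≤ B from hB')).trans h.le))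
  exact IntermediateField.linearDisjoint_iff'.mp (hdisj.of_le_left hA₁C)

theorem finrank_dvd_card_map_restrictNormalHom [IsGalois K Ω] {H : Subgroup Gal(Ω/K)} [H.Normal]
    {A N : IntermediateField K Ω} [Normal K N] [FiniteDimensional K N] (hAN : A ≤ N)
    (h : A ⊓ IntermediateField.fixedField H = ⊥) :
    Module.finrank K A ∣ Nat.card (H.map (AlgEquiv.restrictNormalHom (F := K) N)) := by
  let J := H.map (AlgEquiv.restrictNormalHom (F := K) N)
  let B := IntermediateField.fixedField J
  have : J.Normal := Subgroup.Normal.map inferInstance _ (AlgEquiv.restrictNormalHom_surjective Ω)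
  have : IsGalois K N := ⟨⟩
  have : IsGalois K (IntermediateField.lift B) :=
    IsGalois.of_algEquiv (IntermediateField.liftAlgEquiv B)
  have : FiniteDimensional K A :=
    FiniteDimensional.of_injective (IntermediateField.inclusion hAN).toLinearMap
      (IntermediateField.inclusion_injective hAN)
  have hdisj : (IntermediateField.lift B).LinearDisjoint A := by
    refine linearDisjoint_of_inf_eq_bot (le_bot_iff.mp ?_)
    rw [← InfiniteGalois.restrict_fixedField, ← h, inf_comm]
    exact inf_le_inf_left A inf_le_left
  have hdvd : Module.finrank K B * Module.finrank K A ∣ Module.finrank K N := by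
    rw [(IntermediateField.liftAlgEquiv B).toLinearEquiv.finrank_eq, ← hdisj.finrank_sup]
    exact IntermediateField.finrank_dvd_of_le_right (sup_le (IntermediateField.lift_le B) hAN)
  rw [← Module.finrank_mul_finrank K B N, IntermediateField.finrank_fixedField_eq_card] at hdvd
  exact Nat.dvd_of_mul_dvd_mul_left Module.finrank_pos hdvd

end Galois

section Henselian

variable {K Ω : Type*} [Field K] [Field Ω] [Algebra K Ω] {O : ValuationSubring Ω}

theorem isClosed_decomposition [Algebra.IsAlgebraic K Ω] :
    IsClosed (O.decompositionSubgroup K : Set Gal(Ω/K)) := by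
  rw [← closure_subset_iff_isClosed]
  intro σ hσ
  refine mem_decomposition_iff.mpr fun x => ?_
  have hopen : IsOpen {τ : Gal(Ω/K) | σ⁻¹ * τ ∈ MulAction.stabilizer Gal(Ω/K) x} :=
    (stabilizer_isOpen_of_isIntegral x).preimage (continuous_const_mul σ⁻¹)
  obtain ⟨τ, hτ, hτD⟩ := mem_closure_iff.mp hσ _ hopen (by
    rw [Set.mem_ofPred_eq, inv_mul_cancel]
    exact one_mem _)
  have hτσ : τ x = σ x := by
    rw [Set.mem_ofPred_eq, MulAction.mem_stabilizer_iff, mul_smul, inv_smul_eq_iff] at hτ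
    exact hτ
  rw [← hτσ]
  exact mem_decomposition_iff.mp hτD x

theorem decomposition_eq_top [IsGalois K Ω] (hK : HenselianLocalRing (O.comap (algebraMap K Ω))) :
    O.decompositionSubgroup K = ⊤ := by
  rw [← IntermediateField.fixingSubgroup_bot, ← fixedField_decomposition_eq_bot hK]
  exact (InfiniteGalois.fixingSubgroup_fixedField
    ⟨O.decompositionSubgroup K, isClosed_decomposition⟩).symm

theorem henselianLocalRing_henselization [IsGalois K Ω] [IsAlgClosed Ω] :
    HenselianLocalRing (O.comap (algebraMap (henselization K O) Ω)) := by
  rw [henselization_eq]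
  exact henselianLocalRing_fixedField le_rfl

theorem normal_inertia (hD : O.decompositionSubgroup K = ⊤) : (inertia K O).Normal :=
  ⟨fun _ hσ τ => conj_mem_inertia hσ (hD ▸ Subgroup.mem_top τ)⟩

theorem InertiaPrimeTo.not_dvd_card_map_restrictNormalHom {p : ℕ} [hp : Fact p.Prime]
    (hI : InertiaPrimeTo K O p) (N : IntermediateField K Ω) [Normal K N] [FiniteDimensional K N] :
    ¬ p ∣ Nat.card ((inertia K O).map (AlgEquiv.restrictNormalHom (F := K) N)) := by
  intro hdvd
  obtain ⟨⟨τ, hτ⟩, horder⟩ := exists_prime_orderOf_dvd_card' p hdvd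
  rw [Subgroup.orderOf_mk] at horder
  obtain ⟨σ, hσ, rfl⟩ := Subgroup.mem_map.mp hτ
  rw [orderOf_eq_prime_iff, ← map_pow] at horder
  refine horder.2 (AlgEquiv.ext fun x => Subtype.ext ?_)
  rw [AlgEquiv.restrictNormalHom_apply]
  refine hI σ hσ x ?_
  rw [← AlgEquiv.restrictNormalHom_apply, horder.1]
  rfl

variable {M : Type*} [Field M] [Algebra K M] [Algebra M Ω] [IsScalarTower K M Ω]

theorem decomposition_eq_top_of_tower (hD : O.decompositionSubgroup K = ⊤) :
    O.decompositionSubgroup M = ⊤ :=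
  eq_top_iff.mpr fun σ _ => mem_decomposition_iff.mpr <| mem_decomposition_iff.mp <|
    show σ.restrictScalars K ∈ O.decompositionSubgroup K from hD ▸ Subgroup.mem_top _

theorem InertiaPrimeTo.of_tower {p : ℕ} (h : InertiaPrimeTo K O p) : InertiaPrimeTo M O p := by
  intro σ hσ x hx
  refine h (σ.restrictScalars K)
    ⟨mem_decomposition_iff.mpr (mem_decomposition_iff.mp hσ.1), hσ.2⟩ x ?_
  rwa [← AlgEquiv.smul_def, ← smul_iterate_apply] at hx ⊢

theorem strictHenselization_restrictScalars_le {M : IntermediateField K Ω}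
    (hM : M ≤ strictHenselization K O) :
    (strictHenselization M O).restrictScalars K ≤ strictHenselization K O :=
  le_sInf fun _ hE _ hx =>
    (sInf_le (a := IntermediateField.extendScalars (hM.trans (sInf_le hE))) hE :
      strictHenselization M O ≤ _) hx

theorem extendScalars_inf_strictHenselization (E : IntermediateField K Ω) :
    IntermediateField.extendScalars (inf_le_left : E ⊓ strictHenselization K O ≤ E) ⊓
      strictHenselization ↥(E ⊓ strictHenselization K O) O = ⊥ :=
  le_bot_iff.mp fun _ ⟨hxE, hx⟩ => IntermediateField.mem_bot.mpr
    ⟨⟨_, hxE, strictHenselization_restrictScalars_le inf_le_right hx⟩, rfl⟩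

theorem isTameHenselian [IsGalois K Ω] [IsAlgClosed Ω]
    (hK : HenselianLocalRing (O.comap (algebraMap K Ω)))
    (hI : ∀ q ∈ primesOf (ringExpChar (ResidueField (O.comap (algebraMap K Ω)))),
      InertiaPrimeTo K O q) (E : IntermediateField K Ω) : IsTameHenselian K O E := by
  let M := E ⊓ strictHenselization K O
  have : (inertia M O).Normal :=
    normal_inertia (decomposition_eq_top_of_tower (decomposition_eq_top hK))
  have hinf := extendScalars_inf_strictHenselization (O := O) E
  refine ⟨M, inf_le_left, inf_le_right, ?_, inferInstance, fun F _ q hq hqF => ⟨hq, fun hqp => ?_⟩⟩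
  · have : IsGalois M (strictHenselization M O) := by
      rw [strictHenselization_eq]
      infer_instance
    exact (linearDisjoint_of_inf_eq_bot ((inf_comm _ _).trans hinf)).symm
  · have : Fact q.Prime := ⟨hq⟩
    have : FiniteDimensional M (IntermediateField.lift F) :=
      Module.Finite.equiv (IntermediateField.liftAlgEquiv F).toLinearEquiv
    refine ((hI q hqp).of_tower (M := M)).not_dvd_card_map_restrictNormalHom
      (IntermediateField.normalClosure M (IntermediateField.lift F) Ω) (dvd_trans ?_
        (finrank_dvd_card_map_restrictNormalHom (IntermediateField.le_normalClosure _)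
          (le_bot_iff.mp ?_)))
    · rwa [← (IntermediateField.liftAlgEquiv F).toLinearEquiv.finrank_eq]
    · rw [← hinf, strictHenselization_eq M]
      exact inf_le_inf_right _ (IntermediateField.lift_le F)

end Henselian

/-! ### Fields without `p`-extensions -/

section Closed

variable {K : Type u} {Ω : Type v} [Field K] [Field Ω] [Algebra K Ω] {O : ValuationSubring Ω}
  {p : ℕ}

theorem noPrimePowDegree_of_isPClosed [Algebra.IsAlgebraic K Ω] [hp : Fact p.Prime]
    (hK : IsPClosed (primesOf p) K) : NoPrimePowDegree K Ω p := by
  intro β n hn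
  have hβ : IsIntegral K β := Algebra.IsIntegral.isIntegral β
  have : Fact (Irreducible (minpoly K β)) := ⟨minpoly.irreducible hβ⟩
  let L := AdjoinRoot (minpoly K β)
  have hfinrank : Module.finrank K L = p ^ n :=
    (PowerBasis.finrank (AdjoinRoot.powerBasis (minpoly.ne_zero hβ))).trans hn
  have : FiniteDimensional K L := (AdjoinRoot.powerBasis (minpoly.ne_zero hβ)).finite
  have hdvd (F : IntermediateField K L) : Module.finrank K F ∣ p ^ n :=
    hfinrank ▸ ⟨_, (Module.finrank_mul_finrank K F L).symm⟩
  have hsurj := hK L ⟨inferInstance, fun F _ q hq hqF =>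
    ⟨hq, hq.dvd_of_dvd_pow (hqF.trans (hdvd F))⟩⟩
  have hone : Module.finrank K L = 1 := Subalgebra.bot_eq_top_iff_finrank_eq_one.mp
    (eq_top_iff.mpr fun x _ => Algebra.mem_bot.mpr (hsurj x))
  exact (pow_eq_one_iff.mp (hfinrank.symm.trans hone)).resolve_left hp.out.ne_one

theorem expChar_residueField_comap_iff :
    ExpChar (ResidueField (O.comap (algebraMap K Ω))) p ↔ ExpChar (ResidueField O) p :=
  (algebraMap _ (ResidueField O)).expChar_iff (RingHom.injective _) p

theorem isTameHenselian_of_isPClosed [Algebra.IsAlgebraic K Ω] [IsAlgClosed Ω]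
    (hO : ExpChar (ResidueField (O.comap (algebraMap K Ω))) p) (hK : IsPClosed (primesOf p) K)
    (E : IntermediateField (henselization K O) Ω) : IsTameHenselian (henselization K O) O E := by
  rw [expChar_residueField_comap_iff] at hO
  have : ExpChar (ResidueField (O.comap (algebraMap (henselization K O) Ω))) p :=
    expChar_residueField_comap_iff.mpr hO
  rcases hO with _ | hp
  · have : CharZero O := (residue O).charZero
    have : CharZero K := (algebraMap K Ω).charZero_iff (algebraMap K Ω).injective |>.mpr
      (charZero_of_injective_algebraMap Subtype.val_injective (R := O))
    have : IsAlgClosure K Ω := ⟨inferInstance, inferInstance⟩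
    have : Normal K Ω := IsAlgClosure.normal K Ω
    have : IsGalois K Ω := ⟨⟩
    refine isTameHenselian henselianLocalRing_henselization (fun q hq => ?_) E
    rw [ringExpChar.eq _ 1] at hq
    exact absurd (Nat.dvd_one.mp hq.2) hq.1.ne_one
  · have : Fact p.Prime := ⟨hp⟩
    have hpO : O.valuation (p : Ω) < 1 :=
      natCast_residueField_eq_zero_iff.mp (CharP.cast_eq_zero _ p)
    have hdegree := noPrimePowDegree_of_isPClosed (Ω := Ω) hK
    have : IsGalois K Ω := hdegree.isGalois hpO
    refine isTameHenselian henselianLocalRing_henselization (fun q hq => ?_) E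
    rw [ringExpChar.eq _ p] at hq
    obtain rfl := (Nat.prime_dvd_prime_iff_eq hq.1 hp).mp hq.2
    exact (inertiaPrimeTo hpO hdegree).of_tower

end Closed

end ValuedTame

end

theorem mainTheorem6 {K : Type u} [Field K] {Γ : Type v} [LinearOrderedCommGroupWithZero Γ]
    (ν : Valuation K Γ) (p : ℕ) [ExpChar (IsLocalRing.ResidueField ν.valuationSubring) p]
    (hK : ValuedTame.IsPClosed (ValuedTame.primesOf p) K) :
    ValuedTame.IsTameField ν.valuationSubring ∧
    ∀ (L : Type w) [Field L] [Algebra K L] [Algebra.IsAlgebraic K L]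
      (Γ' : Type x) [LinearOrderedCommGroupWithZero Γ'] (ω : Valuation L Γ'),
      ν.IsEquiv (ω.comap (algebraMap K L)) →
        ValuedTame.IsTameExtension K ω.valuationSubring := by
  refine ⟨fun O hO => ?_, fun L _ _ _ Γ' _ ω hνω O hO => ?_⟩
  · have h := ValuedTame.isTameHenselian_of_isPClosed (O := O) (by rw [hO]; infer_instance) hK ⊤
    have htop : sSup {E | ValuedTame.IsTameHenselian (ValuedTame.henselization K O) O E} = ⊤ :=
      top_le_iff.mp (le_sSup h)
    rw [ValuedTame.tameClosure, htop, IntermediateField.restrictScalars_top]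
  · have : Algebra.IsAlgebraic K (AlgebraicClosure L) := Algebra.IsAlgebraic.trans K L _
    refine ValuedTame.isTameHenselian_of_isPClosed (O := O) ?_ hK _
    have h : O.comap (algebraMap K (AlgebraicClosure L)) = ν.valuationSubring := by
      ext a
      rw [ValuationSubring.mem_comap, IsScalarTower.algebraMap_apply K L (AlgebraicClosure L),
        ← ValuationSubring.mem_comap, hO, Valuation.mem_valuationSubring_iff,
        Valuation.mem_valuationSubring_iff]
      exact hνω.le_one_iff_le_one.symm
    rw [h]
    infer_instance
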